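/- Let $q=e^{2\pi i z}$. For $k\in\mathbb Z$ and $N\ge 1$ let $M_k^!(\Gamma_0(N))$ be the space of weakly holomorphic modular forms of weight $k$ on $\Gamma_0(N)$ (holomorphic on the upper half plane, meromorphic at the cusps), and let $M_k^\infty(\Gamma_0(N))$ (respectively $S_k^\infty(\Gamma_0(N))$) be the subspace of those $f$ that are holomorphic (respectively vanish) at every cusp except possibly $\infty$. Write $f\in\mathbb Z(\!(q)\!)$ if the Fourier expansion of $f$ at $\infty$ has integer coefficients. For $m\ge 1$ the Hecke operator $T_k(m)$ acts on Fourier expansions by $$\Big(\sum_n a(n)q^n\Big)\,\Big|\,T_k(m)=\sum_n\Big(\sum_{d\mid (m,n)}d^{k-1}a(mn/d^2)\Big)q^n .$$ **Proposition 4.2.** Let $(k,N)\in\{(2,27),(2,32),(2,36),(2,49),(4,9)\}$, and let $g=q+O(q^2)$ be the normalized cusp form spanning the one-dimensional space $S_k(\Gamma_0(N))$. (a) For every integer $n\ge 2$ there exists $\phi_n\in M_{2-k}^\infty(\Gamma_0(N))\cap\mathbb Z(\!(q)\!)$ of the form $$\phi_n=q^{-n}+A_n(-1)q^{-1}+\sum_{m=1}^\infty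 A_n(m)q^m\quad\text{if }k=2,\qquad \phi_n=q^{-n}+\sum_{m=-1}^\infty A_n(m)q^m\quad\text{if }k=4.$$ (b) For $m=-1$ and for every integer $m\ge 1$ there exists a unique $F_m\in S_k^\infty(\Gamma_0(N))\cap\mathbb Z(\!(q)\!)$ of the form $$F_m=-q^{-m}+\sum_{n=2}^\infty C_m(n)q^n.$$ If $k=4$, this also holds for $m=0$. (c) Put $F:=F_1=\sum_{n\ge -1}C(n)q^n$. If $p$ is a prime with $p\nmid N$, then for every $n\ge 0$ $$F\mid T_k(p^n)=p^{(k-1)n}F_{p^n}+C(p^n)\,g .$$ -/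

import Mathlib

open UpperHalfPlane ModularForm CongruenceSubgroup Matrix.SpecialLinearGroup
open scoped MatrixGroups Manifold

namespace WeaklyHolomorphic

/-- `f` has the Fourier expansion `f(z) = ∑ a(n) q ^ n` at infinity, where `q = exp (2 π i z)`, with
only finitely many nonzero terms of negative index. -/
def HasQExpansion (f : ℍ → ℂ) (a : ℤ → ℂ) : Prop :=
  (∃ n₀ : ℤ, ∀ n < n₀, a n = 0) ∧
    ∀ τ : ℍ, HasSum (fun n : ℤ ↦ a n * Complex.exp (2 * Real.pi * Complex.I * τ) ^ n) (f τ)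

/-- `f` lies in `M_k^!(Γ₀(N))`: it is holomorphic on the upper half plane, invariant under the weight
`k` slash action of `Γ₀(N)`, and meromorphic at all cusps, i.e. for every `γ` in `SL(2, ℤ)` the
function `f ∣[k] γ` is `O(exp (2 π n Im τ))` at `i∞` for some `n`. -/
structure MemWeak (k : ℤ) (N : ℕ) (f : ℍ → ℂ) : Prop where
  holo : MDifferentiable 𝓘(ℂ) 𝓘(ℂ) f
  slash : ∀ γ ∈ Gamma0 N, f ∣[k] γ = f
  mero : ∀ γ : SL(2, ℤ), ∃ n : ℕ,
    (f ∣[k] γ) =O[atImInfty] fun τ : ℍ ↦ Real.exp (2 * Real.pi * n * τ.im)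

/-- `c` is a cusp of `Γ₀(N)` which is not `Γ₀(N)`-equivalent to `∞`. -/
def IsOtherCusp (N : ℕ) (c : OnePoint ℝ) : Prop :=
  IsCusp c ((Gamma0 N).map (mapGL ℝ)) ∧
    ∀ γ ∈ Gamma0 N, mapGL ℝ γ • (OnePoint.infty : OnePoint ℝ) ≠ c

/-- `f` lies in `M_k^∞(Γ₀(N))`: it is a weakly holomorphic modular form that is holomorphic at every
cusp except possibly `∞`. -/
def MemMInfty (k : ℤ) (N : ℕ) (f : ℍ → ℂ) : Prop :=
  MemWeak k N f ∧ ∀ c, IsOtherCusp N c → c.IsBoundedAt f k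

/-- `f` lies in `S_k^∞(Γ₀(N))`: it is a weakly holomorphic modular form that vanishes at every
cusp except possibly `∞`. -/
def MemSInfty (k : ℤ) (N : ℕ) (f : ℍ → ℂ) : Prop :=
  MemWeak k N f ∧ ∀ c, IsOtherCusp N c → c.IsZeroAt f k

/-- The Hecke operator `T_k(m)` on Fourier expansions: the `n`-th coefficient of `f ∣ T_k(m)` is
`∑ d ^ (k - 1) a(m n / d ^ 2)`, the sum over the positive common divisors `d` of `m` and `n`. -/
noncomputable def heckeT (k : ℤ) (m : ℕ) (a : ℤ → ℂ) (n : ℤ) : ℂ :=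
  ∑ d ∈ (Int.gcd m n).divisors, (d : ℂ) ^ (k - 1) * a (m * n / (d : ℤ) ^ 2)

/-- `F` lies in `S_k^∞(Γ₀(N))` and has the integral Fourier expansion `∑ C(n) q ^ n`, which is of the
form `-q ^ (-m) + ∑_{n ≥ 2} C(n) q ^ n`. (For `m ≥ -1`, as below.) -/
structure IsFm (k : ℤ) (N : ℕ) (m : ℤ) (F : ℍ → ℂ) (C : ℤ → ℤ) : Prop where
  mem : MemSInfty k N F
  hasQExpansion : HasQExpansion F (fun n ↦ (C n : ℂ))
  coeff_neg : C (-m) = -1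
  coeff_eq_zero : ∀ n < 2, n ≠ -m → C n = 0

/-- `φ` lies in `M_{2-k}^∞(Γ₀(N))` and has the integral Fourier expansion `∑ A(m) q ^ m`, which is
of the form `q ^ (-n) + ∑_{m ≥ -1} A(m) q ^ m`, with `A(0) = 0` if `k = 2`. (For `n ≥ 2`.) -/
structure IsPhin (k : ℤ) (N : ℕ) (n : ℕ) (φ : ℍ → ℂ) (A : ℤ → ℤ) : Prop where
  mem : MemMInfty (2 - k) N φ
  hasQExpansion : HasQExpansion φ (fun m ↦ (A m : ℂ))
  coeff_neg : A (-n) = 1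
  coeff_eq_zero : ∀ m < -1, m ≠ -(n : ℤ) → A m = 0
  coeff_zero : k = 2 → A 0 = 0

end WeaklyHolomorphic

/-! ### Infinite q-products. -/

section QPochhammer

open Filter Topology

/-! The engine is a duality between `S_k^∞(Γ₀(N))` and `M_{2-k}^∞(Γ₀(N))`. If `f` lies in the first
space and `φ` in the second, then `f φ` lies in `S_2^∞(Γ₀(N))`: the differential `f φ dτ` on the
modular curve has no pole outside `∞`, so its residue there, the constant coefficient of `f φ`,
vanishes (`IsSForm.coeff_zero`). This residue theorem is proved by a trace. Summing the translates
of a form in `S_2^∞` over cosets gives a weakly holomorphic form of weight 2 and level one with the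
same constant coefficient; subtracting derivatives of weight 0 forms with poles of prescribed order
leaves a holomorphic form of weight 2 and level one, which is zero.

Suppose `M_{2-k}^∞` contains a form `q^{-n} + ...` for every `n ≥ 2`. Pairing with these shows that
a form in `S_k^∞` cannot have leading exponent `n ≥ 2`, so it is determined by its coefficients of
index below 2 (`IsSForm.eq_zero_of_coeff`). This one fact gives the uniqueness in (b), the
one-dimensionality of `S_k(Γ₀(N))`, and (c): for `p ∤ N` the Hecke operators preserve `S_k^∞`, and
both sides of (c) have the same coefficients below index 2. The existence statements follow by
Gaussian elimination over the integers (`exists_reduced`), applied to any families of forms with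
integral coefficients, leading coefficient 1 and the required orders (`exists_dual_families`).

It remains to exhibit such forms (`HasLeadingForms`). At the four levels of weight 2 the curve has
genus one, and a cusp form `q + ...` together with two functions having poles of orders 2 and 3 at
`∞` suffices, since every `n ≥ 2` is `2 i + 3 j`. At level 9 the genus is zero, and a function with
a simple pole, a form of weight -2 with a double pole and the cusp form suffice. They are built from
products of Klein forms `k(r, s)(L τ)`. Klein forms have weight -1, are permuted by `SL(2, ℤ)`
through the characteristic `(r, s)` (`kleinForm.slash`), have no zeros on the upper half plane for
nonintegral characteristics, and grow at each cusp at an explicit rate (`kleinAt.isTheta_slash`).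
Modularity of a product becomes a calculation with roots of unity, the conditions at the cusps
become finite checks modulo `N`, and the q-product gives integrality. At level 49 the cusp form
comes from a bracket of derivatives of three conjugate functions. -/

/-- The infinite `q`-Pochhammer symbol `(x; q)_∞`. -/
noncomputable def qPochhammer (x q : ℂ) : ℂ := ∏' n : ℕ, (1 - x * q ^ n)

namespace qPochhammer

lemma summable_norm (x : ℂ) {q : ℂ} (hq : ‖q‖ < 1) : Summable fun n : ℕ ↦ ‖-(x * q ^ n)‖ := by
  simpa [norm_mul, norm_pow] using
    (summable_geometric_of_lt_one (norm_nonneg q) hq).mul_left ‖x‖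

lemma multipliable (x : ℂ) {q : ℂ} (hq : ‖q‖ < 1) : Multipliable fun n : ℕ ↦ (1 - x * q ^ n) := by
  simpa [sub_eq_add_neg] using multipliable_one_add_of_summable (summable_norm x hq)

lemma eq_mul (x : ℂ) {q : ℂ} (hq : ‖q‖ < 1) :
    qPochhammer x q = (1 - x) * qPochhammer (x * q) q := by
  unfold qPochhammer
  rw [tprod_eq_zero_mul']
  · simp only [pow_zero, mul_one]
    congr 2
    ext n
    rw [pow_succ]
    ring
  · refine (multipliable (x * q) hq).congr fun n ↦ ?_
    rw [pow_succ]
    ring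

lemma ne_zero {x q : ℂ} (hq : ‖q‖ < 1) (h : ∀ n : ℕ, x * q ^ n ≠ 1) : qPochhammer x q ≠ 0 := by
  have := tprod_one_add_ne_zero_of_summable (f := fun n : ℕ ↦ -(x * q ^ n))
    (fun n ↦ by rw [← sub_eq_add_neg, sub_ne_zero]; exact (h n).symm) (summable_norm x hq)
  simpa [qPochhammer, sub_eq_add_neg] using this

lemma self_ne_zero {q : ℂ} (hq : ‖q‖ < 1) : qPochhammer q q ≠ 0 := by
  refine ne_zero hq fun n h ↦ ?_
  have h1 : ‖q * q ^ n‖ < 1 := by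
    rw [← pow_succ', norm_pow]
    exact pow_lt_one₀ (norm_nonneg _) hq (by simp)
  rw [h] at h1
  simp at h1

lemma differentiableAt {x q : ℂ → ℂ} {w₀ : ℂ} (hx : Differentiable ℂ x)
    (hq : Differentiable ℂ q) (h1 : ‖q w₀‖ < 1) :
    DifferentiableAt ℂ (fun w ↦ qPochhammer (x w) (q w)) w₀ := by
  obtain ⟨ρ, hρ, hρ1⟩ := exists_between h1
  have hρ0 : 0 ≤ ρ := (norm_nonneg _).trans hρ.le
  have hqc : ∀ᶠ w in 𝓝 w₀, ‖q w‖ < ρ :=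
    (hq w₀).continuousAt.norm.eventually_lt continuousAt_const hρ
  have hxc : ∀ᶠ w in 𝓝 w₀, ‖x w‖ < ‖x w₀‖ + 1 :=
    (hx w₀).continuousAt.norm.eventually_lt continuousAt_const (by linarith)
  obtain ⟨U, hU, hUo, hw⟩ := eventually_nhds_iff.mp (hqc.and hxc)
  have hd (n : ℕ) : DifferentiableOn ℂ (fun w ↦ -(x w * q w ^ n)) U := by
    fun_prop
  have key := Summable.hasProdLocallyUniformlyOn_nat_one_add (K := U)
    (f := fun n w ↦ -(x w * q w ^ n)) (u := fun n ↦ (‖x w₀‖ + 1) * ρ ^ n) hUo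
    ((summable_geometric_of_lt_one hρ0 hρ1).mul_left _)
    (.of_forall fun n w hwU ↦ by
      obtain ⟨hb, hc⟩ := hU w hwU
      rw [norm_neg, norm_mul, norm_pow]
      gcongr)
    (fun n ↦ (hd n).continuousOn)
  have hdiff : DifferentiableOn ℂ (fun w ↦ ∏' n : ℕ, (1 + -(x w * q w ^ n))) U :=
    key.differentiableOn (.of_forall fun s ↦ by
      simpa [Finset.prod_fn] using DifferentiableOn.finsetProd
        (fun i _ ↦ (hd i).const_add 1)) hUo
  simpa [qPochhammer, sub_eq_add_neg] using hdiff.differentiableAt (hUo.mem_nhds hw)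

lemma tendsto_one {α : Type*} {l : Filter α} {x q : α → ℂ} (hx : Tendsto x l (𝓝 0))
    (hq : Tendsto q l (𝓝 0)) : Tendsto (fun a ↦ qPochhammer (x a) (q a)) l (𝓝 1) := by
  have := tendsto_tprod_one_add_of_dominated_convergence (𝓕 := l) (g := 0)
    (f := fun a (n : ℕ) ↦ -(x a * q a ^ n)) (bound := fun n ↦ (1 / 2 : ℝ) ^ n)
    (summable_geometric_of_lt_one (by norm_num) (by norm_num))
    (fun k ↦ by simpa using (hx.mul (hq.pow k)).neg)
    (by
      have hx' : ∀ᶠ a in l, ‖x a‖ < 1 := hx.norm.eventually_lt_const (by simp)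
      have hq' : ∀ᶠ a in l, ‖q a‖ < 1 / 2 := hq.norm.eventually_lt_const (by simp)
      filter_upwards [hx', hq'] with a h1 h2 k
      rw [norm_neg, norm_mul, norm_pow]
      calc ‖x a‖ * ‖q a‖ ^ k ≤ 1 * (1 / 2) ^ k := by gcongr
        _ = _ := one_mul _)
  simpa [qPochhammer, sub_eq_add_neg] using this

end qPochhammer

end QPochhammer

/-! ### Rigidity of quasiperiodic functions. -/

section Elliptic

open Filter Topology Set

/-- An entire function whose zeros are simple and lie in the lattice `ℤ + ℤτ` is determined by its
multipliers and its derivative at `0`. -/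
theorem eq_of_quasiperiodic {P Q m n : ℂ → ℂ} {τ : ℂ} (hτ : 0 < τ.im)
    (hP : Differentiable ℂ P) (hQ : Differentiable ℂ Q)
    (hm : ∀ z, m z ≠ 0) (hn : ∀ z, n z ≠ 0)
    (hP1 : ∀ z, P (z + 1) = m z * P z) (hQ1 : ∀ z, Q (z + 1) = m z * Q z)
    (hPτ : ∀ z, P (z + τ) = n z * P z) (hQτ : ∀ z, Q (z + τ) = n z * Q z)
    (hP0 : P 0 = 0) (hQ0 : Q 0 = 0) (hP' : deriv P 0 = 1) (hQ' : deriv Q 0 = 1)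
    (hz : ∀ z, P z = 0 → ∃ a b : ℤ, z = a + b * τ) : Q = P := by
  classical
  -- The value 1 at the zeros of `P` is the limit of `Q / P` there: at `0` it is the ratio of the
  -- derivatives, and every other zero is a period translate of `0`. Hence `F` is entire and
  -- elliptic, so constant.
  set F : ℂ → ℂ := fun z ↦ if P z = 0 then 1 else Q z / P z with hF
  have hF1 : Function.Periodic F 1 := fun z ↦ by
    simp only [hF, hP1, hQ1, mul_eq_zero, hm z, false_or]
    rw [mul_div_mul_left _ _ (hm z)]
  have hFτ : Function.Periodic F τ := fun z ↦ by
    simp only [hF, hPτ, hQτ, mul_eq_zero, hn z, false_or]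
    rw [mul_div_mul_left _ _ (hn z)]
  have hFab (a b : ℤ) (z : ℂ) : F (z + (a + b * τ)) = F z := by
    rw [← add_assoc, hFτ.int_mul b]
    simpa using hF1.int_mul a z
  have hF0 : DifferentiableAt ℂ F 0 := by
    have hdP : DifferentiableAt ℂ (dslope P 0) 0 :=
      ((Complex.differentiableOn_dslope univ_mem).2 hP.differentiableOn).differentiableAt univ_mem
    have hdQ : DifferentiableAt ℂ (dslope Q 0) 0 :=
      ((Complex.differentiableOn_dslope univ_mem).2 hQ.differentiableOn).differentiableAt univ_mem
    have h1 : dslope P 0 0 ≠ 0 := by simp [hP']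
    refine (hdQ.div hdP h1).congr_of_eventuallyEq ?_
    filter_upwards [hdP.continuousAt.eventually_ne h1] with z hz1
    have e1 := sub_smul_dslope_of_zero hP0 z
    have e2 := sub_smul_dslope_of_zero hQ0 z
    rw [sub_zero, smul_eq_mul] at e1 e2
    rcases eq_or_ne z 0 with rfl | hz0
    · simp [hF, hP0, hP', hQ']
    · have : P z ≠ 0 := by rw [← e1]; exact mul_ne_zero hz0 hz1
      simp only [hF, if_neg this, Pi.div_apply]
      rw [← e1, ← e2, mul_div_mul_left _ _ hz0]
  have hFd : Differentiable ℂ F := fun z ↦ by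
    by_cases h : P z = 0
    · obtain ⟨a, b, rfl⟩ := hz z h
      have : F = F ∘ fun w ↦ w - (a + b * τ) := by
        ext w
        have := hFab a b (w - (a + b * τ))
        rw [sub_add_cancel] at this
        exact this
      rw [this]
      refine DifferentiableAt.comp _ ?_ (by fun_prop)
      simpa using hF0
    · refine ((hQ z).div (hP z) h).congr_of_eventuallyEq ?_
      filter_upwards [(hP z).continuousAt.eventually_ne h] with w hw
      simp [hF, hw]
  have hbdd : Bornology.IsBounded (range F) := by
    have hK : IsCompact ((fun p : ℝ × ℝ ↦ F (p.1 + p.2 * τ)) '' (Icc 0 1 ×ˢ Icc 0 1)) :=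
      (isCompact_Icc.prod isCompact_Icc).image
        (hFd.continuous.comp (by fun_prop))
    refine hK.isBounded.subset ?_
    rintro _ ⟨z, rfl⟩
    set t := z.im / τ.im
    set s := z.re - t * τ.re
    have hzst : z = s + t * τ := by
      apply Complex.ext
      · simp [s]
      · simp [t, hτ.ne']
    refine ⟨(Int.fract s, Int.fract t), ⟨⟨Int.fract_nonneg _, (Int.fract_lt_one _).le⟩,
      ⟨Int.fract_nonneg _, (Int.fract_lt_one _).le⟩⟩, ?_⟩
    dsimp only
    rw [← hFab ⌊s⌋ ⌊t⌋, hzst]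
    congr 1
    simp only [Int.fract]
    push_cast
    ring
  have hconst (z : ℂ) : F z = 1 := by
    rw [hFd.apply_eq_apply_of_bounded hbdd z 0]
    simp [hF, hP0]
  ext z
  by_cases h : P z = 0
  · obtain ⟨a, b, rfl⟩ := hz z h
    have haux (f m n : ℂ → ℂ) (hm : ∀ z, m z ≠ 0) (hn : ∀ z, n z ≠ 0)
        (h1 : ∀ z, f (z + 1) = m z * f z) (h2 : ∀ z, f (z + τ) = n z * f z) (h0 : f 0 = 0) :
        f (a + b * τ) = 0 := by
      have p1 : Function.Periodic (fun z ↦ f z = 0) 1 := fun z ↦ by simp [h1, hm]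
      have p2 : Function.Periodic (fun z ↦ f z = 0) τ := fun z ↦ by simp [h2, hn]
      have := p1.int_mul a 0
      have h3 := p2.int_mul b (0 + a * 1)
      simp only [mul_one, zero_add] at this h3
      rw [h3, this]
      exact h0
    rw [h, haux Q m n hm hn hQ1 hQτ hQ0]
  · have := hconst z
    simp only [hF, if_neg h] at this
    rwa [div_eq_one_iff_eq h] at this

end Elliptic

/-! ### The normalised sigma function and its inversion formula. -/

section KleinSigma

open Filter Topology Real

/-- The function `z ↦ exp (2 π i z)`. -/
noncomputable def expTwoPi (z : ℂ) : ℂ := Complex.exp (2 * π * Complex.I * z)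

namespace expTwoPi

lemma add (z w : ℂ) : expTwoPi (z + w) = expTwoPi z * expTwoPi w := by
  rw [expTwoPi, mul_add, Complex.exp_add, ← expTwoPi, ← expTwoPi]

lemma ne_zero (z : ℂ) : expTwoPi z ≠ 0 := Complex.exp_ne_zero _

lemma neg (z : ℂ) : expTwoPi (-z) = (expTwoPi z)⁻¹ := by
  rw [expTwoPi, mul_neg, Complex.exp_neg, ← expTwoPi]

lemma sub (z w : ℂ) : expTwoPi (z - w) = expTwoPi z / expTwoPi w := by
  rw [sub_eq_add_neg, add, neg, div_eq_mul_inv]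

@[simp] lemma zero : expTwoPi 0 = 1 := by simp [expTwoPi]

lemma nat_mul (n : ℕ) (z : ℂ) : expTwoPi (n * z) = expTwoPi z ^ n := by
  rw [expTwoPi, expTwoPi, ← Complex.exp_nat_mul]
  ring_nf

lemma int_mul (n : ℤ) (z : ℂ) : expTwoPi (n * z) = expTwoPi z ^ n := by
  rw [expTwoPi, expTwoPi, ← Complex.exp_int_mul]
  ring_nf

@[simp] lemma one : expTwoPi 1 = 1 := by simp [expTwoPi, Complex.exp_two_pi_mul_I]

lemma eq_one_iff {z : ℂ} : expTwoPi z = 1 ↔ ∃ n : ℤ, z = n := by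
  rw [expTwoPi, Complex.exp_eq_one_iff]
  refine exists_congr fun n ↦ ⟨fun h ↦ ?_, fun h ↦ by rw [h]; ring⟩
  have : (2 * π * Complex.I) ≠ 0 := Complex.two_pi_I_ne_zero
  exact mul_left_cancel₀ this (by rw [h]; ring)

lemma norm_eq (z : ℂ) : ‖expTwoPi z‖ = Real.exp (-(2 * π * z.im)) := by
  rw [expTwoPi, Complex.norm_exp]
  congr 1
  simp

lemma norm_lt_one {τ : ℂ} (hτ : 0 < τ.im) : ‖expTwoPi τ‖ < 1 := by
  rw [norm_eq, Real.exp_lt_one_iff, neg_lt_zero]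
  positivity

@[fun_prop] lemma differentiable : Differentiable ℂ expTwoPi := by
  unfold expTwoPi
  fun_prop

end expTwoPi

/-- The Weierstrass sigma function of the lattice `ℤ + ℤτ`, up to an exponential factor; it is
normalised by having derivative `1` at `0`. -/
noncomputable def kleinSigma (z τ : ℂ) : ℂ :=
  -(Complex.exp (-(π * Complex.I * z)) / (2 * π * Complex.I)) *
    (qPochhammer (expTwoPi z) (expTwoPi τ) * qPochhammer (expTwoPi (τ - z)) (expTwoPi τ)) /
    qPochhammer (expTwoPi τ) (expTwoPi τ) ^ 2

namespace kleinSigma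

lemma add_one (z τ : ℂ) : kleinSigma (z + 1) τ = -1 * kleinSigma z τ := by
  have h : Complex.exp (-(π * Complex.I * (z + 1))) = -Complex.exp (-(π * Complex.I * z)) := by
    rw [mul_add, neg_add, Complex.exp_add, mul_one, Complex.exp_neg (π * Complex.I),
      Complex.exp_pi_mul_I]
    norm_num
  have h2 : expTwoPi (τ - (z + 1)) = expTwoPi (τ - z) := by
    rw [← sub_sub, expTwoPi.sub _ 1]
    simp
  rw [kleinSigma, kleinSigma, h, h2, expTwoPi.add z 1]
  simp only [expTwoPi.one, mul_one]
  ring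

lemma qPochhammer_neg (z : ℂ) {τ : ℂ} (hτ : 0 < τ.im) :
    qPochhammer (expTwoPi (-z)) (expTwoPi τ) =
      -(expTwoPi z)⁻¹ * (1 - expTwoPi z) * qPochhammer (expTwoPi (τ - z)) (expTwoPi τ) := by
  rw [qPochhammer.eq_mul _ (expTwoPi.norm_lt_one hτ), ← expTwoPi.add, expTwoPi.neg,
    show -z + τ = τ - z by ring]
  field_simp [expTwoPi.ne_zero z]
  ring

lemma add_tau (z : ℂ) {τ : ℂ} (hτ : 0 < τ.im) :
    kleinSigma (z + τ) τ =
      -Complex.exp (-(2 * π * Complex.I * z) - π * Complex.I * τ) * kleinSigma z τ := by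
  have h : Complex.exp (-(π * Complex.I * (z + τ))) =
      Complex.exp (-(π * Complex.I * z)) * Complex.exp (-(π * Complex.I * τ)) := by
    rw [← Complex.exp_add]
    ring_nf
  have h2 : Complex.exp (-(2 * π * Complex.I * z) - π * Complex.I * τ) =
      (expTwoPi z)⁻¹ * Complex.exp (-(π * Complex.I * τ)) := by
    rw [expTwoPi, ← Complex.exp_neg, ← Complex.exp_add]
    ring_nf
  rw [kleinSigma, kleinSigma, h, h2, show τ - (z + τ) = -z by ring, qPochhammer_neg z hτ,
    qPochhammer.eq_mul (expTwoPi z) (expTwoPi.norm_lt_one hτ), ← expTwoPi.add]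
  ring

lemma neg (z : ℂ) {τ : ℂ} (hτ : 0 < τ.im) : kleinSigma (-z) τ = -kleinSigma z τ := by
  have h : Complex.exp (-(π * Complex.I * -z)) =
      Complex.exp (-(π * Complex.I * z)) * expTwoPi z := by
    rw [expTwoPi, ← Complex.exp_add]
    ring_nf
  rw [kleinSigma, kleinSigma, h, qPochhammer_neg z hτ,
    qPochhammer.eq_mul (expTwoPi z) (expTwoPi.norm_lt_one hτ), ← expTwoPi.add, sub_neg_eq_add,
    add_comm τ z]
  have := expTwoPi.ne_zero z
  field_simp

/-- Isolates the factor responsible for the simple zero at `z = 0`, from which the value and the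
derivative at `0` are read off. -/
lemma eq_one_sub_mul (z : ℂ) {τ : ℂ} (hτ : 0 < τ.im) :
    kleinSigma z τ = (1 - expTwoPi z) * (-(Complex.exp (-(π * Complex.I * z)) /
      (2 * π * Complex.I)) * (qPochhammer (expTwoPi (z + τ)) (expTwoPi τ) *
      qPochhammer (expTwoPi (τ - z)) (expTwoPi τ)) /
      qPochhammer (expTwoPi τ) (expTwoPi τ) ^ 2) := by
  rw [kleinSigma, qPochhammer.eq_mul (expTwoPi z) (expTwoPi.norm_lt_one hτ), ← expTwoPi.add]
  ring

lemma zero {τ : ℂ} (hτ : 0 < τ.im) : kleinSigma 0 τ = 0 := by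
  simp [eq_one_sub_mul 0 hτ]

lemma differentiableAt {z τ : ℂ → ℂ} {w : ℂ} (hz : Differentiable ℂ z) (hτ : Differentiable ℂ τ)
    (h : 0 < (τ w).im) : DifferentiableAt ℂ (fun w ↦ kleinSigma (z w) (τ w)) w := by
  have h1 := expTwoPi.norm_lt_one h
  unfold kleinSigma
  refine DifferentiableAt.div (DifferentiableAt.mul (by fun_prop) (DifferentiableAt.mul ?_ ?_))
    (DifferentiableAt.pow ?_ _) (pow_ne_zero _ (qPochhammer.self_ne_zero h1))
  all_goals
    exact qPochhammer.differentiableAt (by fun_prop) (by fun_prop) h1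

lemma differentiable {τ : ℂ} (hτ : 0 < τ.im) : Differentiable ℂ fun z ↦ kleinSigma z τ :=
  fun _ ↦ differentiableAt differentiable_id (differentiable_const τ) hτ

lemma hasDerivAt_zero {τ : ℂ} (hτ : 0 < τ.im) : HasDerivAt (fun z ↦ kleinSigma z τ) 1 0 := by
  have h1 := expTwoPi.norm_lt_one hτ
  set G : ℂ → ℂ := fun z ↦ -(Complex.exp (-(π * Complex.I * z)) /
      (2 * π * Complex.I)) * (qPochhammer (expTwoPi (z + τ)) (expTwoPi τ) *
      qPochhammer (expTwoPi (τ - z)) (expTwoPi τ)) /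
      qPochhammer (expTwoPi τ) (expTwoPi τ) ^ 2 with hG
  have hGd : DifferentiableAt ℂ G 0 := by
    refine DifferentiableAt.div_const (DifferentiableAt.mul (by fun_prop)
      (DifferentiableAt.mul ?_ ?_)) _
    all_goals
      exact qPochhammer.differentiableAt (by fun_prop) (by fun_prop) h1
  have hG0 : G 0 = -(1 / (2 * π * Complex.I)) := by
    have := qPochhammer.self_ne_zero h1
    simp only [hG, mul_zero, neg_zero, Complex.exp_zero, zero_add, sub_zero]
    field_simp
  have he : HasDerivAt (fun z ↦ 1 - expTwoPi z) (-(2 * π * Complex.I)) 0 := by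
    have : HasDerivAt expTwoPi (Complex.exp (2 * π * Complex.I * 0) * (2 * π * Complex.I * 1)) 0 :=
      ((hasDerivAt_id (0 : ℂ)).const_mul (2 * π * Complex.I)).cexp
    simpa using this.const_sub 1
  have := he.mul hGd.hasDerivAt
  refine (this.congr_of_eventuallyEq (.of_forall fun z ↦ eq_one_sub_mul z hτ)).congr_deriv ?_
  have := Complex.two_pi_I_ne_zero
  rw [hG0]
  simp only [expTwoPi.zero, sub_self, zero_mul, add_zero]
  field_simp

lemma exists_of_eq_zero {z τ : ℂ} (hτ : 0 < τ.im) (h : kleinSigma z τ = 0) :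
    ∃ a b : ℤ, z = a + b * τ := by
  have h1 := expTwoPi.norm_lt_one hτ
  by_contra! hcon
  refine absurd h (div_ne_zero (mul_ne_zero ?_ (mul_ne_zero ?_ ?_))
    (pow_ne_zero _ (qPochhammer.self_ne_zero h1)))
  · exact neg_ne_zero.2 (div_ne_zero (Complex.exp_ne_zero _) Complex.two_pi_I_ne_zero)
  · refine qPochhammer.ne_zero h1 fun n hn ↦ ?_
    rw [← expTwoPi.nat_mul, ← expTwoPi.add, expTwoPi.eq_one_iff] at hn
    obtain ⟨m, hm⟩ := hn
    exact hcon m (-n) (by push_cast; linear_combination hm)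
  · refine qPochhammer.ne_zero h1 fun n hn ↦ ?_
    rw [← expTwoPi.nat_mul, ← expTwoPi.add, expTwoPi.eq_one_iff] at hn
    obtain ⟨m, hm⟩ := hn
    exact hcon (-m) (n + 1) (by push_cast; linear_combination -hm)

/-- The behaviour of the normalised sigma function under `τ ↦ -1 / τ`. -/
theorem inv_neg {τ : ℂ} (hτ : 0 < τ.im) (z : ℂ) :
    kleinSigma (z / τ) (-1 / τ) =
      τ⁻¹ * Complex.exp (π * Complex.I * z ^ 2 / τ) * kleinSigma z τ := by
  have hτ0 : τ ≠ 0 := fun h ↦ by simp [h] at hτ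
  have hτ' : 0 < (-1 / τ).im := by
    rw [neg_div, one_div, Complex.neg_im, Complex.inv_im, neg_div, neg_neg]
    exact div_pos hτ (Complex.normSq_pos.2 hτ0)
  -- Division by `τ` interchanges, up to sign, the two generators of the lattices for `τ` and `-1 /
  -- τ`. The Gaussian factor turns the resulting multipliers into those of the sigma function of `ℤ
  -- + ℤτ`, and the factor `τ` restores derivative `1` at `0`.
  have key : (fun z ↦ τ * Complex.exp (-(π * Complex.I * z ^ 2 / τ)) *
      kleinSigma (z / τ) (-1 / τ)) = fun z ↦ kleinSigma z τ := by
    refine eq_of_quasiperiodic (m := fun _ ↦ -1)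
      (n := fun z ↦ -Complex.exp (-(2 * π * Complex.I * z) - π * Complex.I * τ)) hτ
      (differentiable hτ) ?_ (by simp) (by simp [Complex.exp_ne_zero])
      (fun z ↦ add_one z τ) ?_ (fun z ↦ add_tau z hτ) ?_ (zero hτ) ?_
      (hasDerivAt_zero hτ).deriv ?_ (fun z ↦ exists_of_eq_zero hτ)
    · exact Differentiable.mul (by fun_prop) ((differentiable hτ').comp (by fun_prop))
    · intro z
      have e1 : (z + 1) / τ = (z + 1) / τ + -1 / τ + 1 / τ := by ring
      have h1 := add_tau ((z + 1) / τ) hτ'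
      have h2 : (z + 1) / τ + -1 / τ = z / τ := by ring
      rw [h2] at h1
      rw [h1]
      have h3 : Complex.exp (-(π * Complex.I * (z + 1) ^ 2 / τ)) =
          Complex.exp (-(π * Complex.I * z ^ 2 / τ)) *
          Complex.exp (-(2 * π * Complex.I * ((z + 1) / τ)) - π * Complex.I * (-1 / τ)) := by
        rw [← Complex.exp_add]
        congr 1
        field_simp
        ring
      rw [h3]
      ring
    · intro z
      have h1 : (z + τ) / τ = z / τ + 1 := by field_simp
      have h3 : Complex.exp (-(π * Complex.I * (z + τ) ^ 2 / τ)) =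
          Complex.exp (-(π * Complex.I * z ^ 2 / τ)) *
          Complex.exp (-(2 * π * Complex.I * z) - π * Complex.I * τ) := by
        rw [← Complex.exp_add]
        congr 1
        field_simp
        ring
      rw [h1, add_one, h3]
      ring
    · simp [zero hτ']
    · refine HasDerivAt.deriv ?_
      have hs : HasDerivAt (fun z ↦ kleinSigma (z / τ) (-1 / τ)) (1 * (1 / τ)) 0 := by
        refine HasDerivAt.comp (h₂ := fun z ↦ kleinSigma z (-1 / τ)) (0 : ℂ) ?_
          ((hasDerivAt_id (0 : ℂ)).div_const τ)
        simpa using hasDerivAt_zero hτ'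
      have he : DifferentiableAt ℂ (fun z ↦ τ * Complex.exp (-(π * Complex.I * z ^ 2 / τ))) 0 := by
        fun_prop
      refine (he.hasDerivAt.mul hs).congr_deriv ?_
      simp [zero hτ', hτ0]
  have := congrFun key z
  rw [← this, Complex.exp_neg]
  have h := Complex.exp_ne_zero (π * Complex.I * z ^ 2 / τ)
  field_simp

end kleinSigma

end KleinSigma

/-! ### Klein forms: transformation laws, zeros and growth at the cusps. -/

section KleinForm

open Filter Topology Real Asymptotics

/-- The Klein form with real characteristic `(r, s)`. -/
noncomputable def kleinForm (r s : ℝ) (w : ℂ) : ℂ :=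
  Complex.exp (π * Complex.I * (r * (r * w + s))) * kleinSigma (r * w + s) w

namespace kleinForm

lemma add_one_right (r s : ℝ) (w : ℂ) :
    kleinForm r (s + 1) w = Complex.exp (π * Complex.I * (1 + r)) * kleinForm r s w := by
  have h : Complex.exp (π * Complex.I * (1 + r)) = -Complex.exp (π * Complex.I * r) := by
    rw [mul_add, Complex.exp_add, mul_one, Complex.exp_pi_mul_I]
    ring
  have h2 : Complex.exp (π * Complex.I * (r * (r * w + (s + 1 : ℝ)))) =
      Complex.exp (π * Complex.I * r) * Complex.exp (π * Complex.I * (r * (r * w + s))) := by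
    rw [← Complex.exp_add]
    push_cast
    ring_nf
  rw [kleinForm, kleinForm, h, h2, Complex.ofReal_add, Complex.ofReal_one, ← add_assoc,
    kleinSigma.add_one]
  ring

lemma add_one_left (r s : ℝ) {w : ℂ} (hw : 0 < w.im) :
    kleinForm (r + 1) s w = Complex.exp (π * Complex.I * (1 - s)) * kleinForm r s w := by
  have h : Complex.exp (π * Complex.I * (1 - s)) = -Complex.exp (-(π * Complex.I * s)) := by
    rw [mul_sub, sub_eq_add_neg, Complex.exp_add, mul_one, Complex.exp_pi_mul_I]
    ring
  have h2 : Complex.exp (π * Complex.I * ((r + 1 : ℝ) * ((r + 1 : ℝ) * w + s))) *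
      Complex.exp (-(2 * π * Complex.I * (r * w + s)) - π * Complex.I * w) =
      Complex.exp (-(π * Complex.I * s)) * Complex.exp (π * Complex.I * (r * (r * w + s))) := by
    rw [← Complex.exp_add, ← Complex.exp_add]
    push_cast
    ring_nf
  have h3 : ((r + 1 : ℝ) : ℂ) * w + s = (r * w + s) + w := by
    push_cast
    ring
  have h4 := kleinSigma.add_tau (r * w + s) hw
  rw [← h3] at h4
  rw [kleinForm, kleinForm, h, h4]
  linear_combination -kleinSigma (r * w + s) w * h2

lemma add_int_right (r s : ℝ) (n : ℤ) (w : ℂ) :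
    kleinForm r (s + n) w = Complex.exp (π * Complex.I * (n * (1 + r))) * kleinForm r s w := by
  induction n using Int.induction_on with
  | zero => simp
  | succ i ih =>
    rw [Int.cast_add, Int.cast_one, ← add_assoc, add_one_right, ih, ← mul_assoc, ← Complex.exp_add]
    push_cast
    ring_nf
  | pred i ih =>
    have h := add_one_right r (s + ((-i - 1 : ℤ) : ℝ)) w
    rw [show s + ((-i - 1 : ℤ) : ℝ) + 1 = s + ((-i : ℤ) : ℝ) by push_cast; ring, ih] at h
    refine mul_left_cancel₀ (Complex.exp_ne_zero (π * Complex.I * (1 + r))) ?_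
    rw [← h, ← mul_assoc (Complex.exp (π * Complex.I * (1 + r))), ← Complex.exp_add]
    push_cast
    ring_nf

lemma add_int_left (r s : ℝ) (n : ℤ) {w : ℂ} (hw : 0 < w.im) :
    kleinForm (r + n) s w = Complex.exp (π * Complex.I * (n * (1 - s))) * kleinForm r s w := by
  induction n using Int.induction_on with
  | zero => simp
  | succ i ih =>
    rw [Int.cast_add, Int.cast_one, ← add_assoc, add_one_left _ _ hw, ih, ← mul_assoc,
      ← Complex.exp_add]
    push_cast
    ring_nf
  | pred i ih =>
    have h := add_one_left (r + ((-i - 1 : ℤ) : ℝ)) s hw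
    rw [show r + ((-i - 1 : ℤ) : ℝ) + 1 = r + ((-i : ℤ) : ℝ) by push_cast; ring, ih] at h
    refine mul_left_cancel₀ (Complex.exp_ne_zero (π * Complex.I * (1 - s))) ?_
    rw [← h, ← mul_assoc (Complex.exp (π * Complex.I * (1 - s))), ← Complex.exp_add]
    push_cast
    ring_nf

lemma neg (r s : ℝ) {w : ℂ} (hw : 0 < w.im) : kleinForm (-r) (-s) w = -kleinForm r s w := by
  rw [kleinForm, kleinForm, ← mul_neg, ← kleinSigma.neg _ hw]
  push_cast
  ring_nf

lemma translate (r s : ℝ) (w : ℂ) : kleinForm r s (w + 1) = kleinForm r (r + s) w := by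
  have h (z : ℂ) : kleinSigma z (w + 1) = kleinSigma z w := by
    rw [kleinSigma, kleinSigma, show w + 1 - z = w - z + 1 by ring, expTwoPi.add w 1,
      expTwoPi.add (w - z) 1]
    simp
  rw [kleinForm, kleinForm, h]
  push_cast
  ring_nf

lemma inversion (r s : ℝ) {w : ℂ} (hw : 0 < w.im) :
    kleinForm r s (-1 / w) * w = kleinForm s (-r) w := by
  have hw0 : w ≠ 0 := fun h ↦ by simp [h] at hw
  have h1 : (r : ℂ) * (-1 / w) + s = (s * w + (-r : ℝ)) / w := by
    push_cast
    field_simp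
    ring
  rw [kleinForm, kleinForm, h1, kleinSigma.inv_neg hw]
  have h2 : Complex.exp (π * Complex.I * (r * ((s * w + (-r : ℝ)) / w))) *
      Complex.exp (π * Complex.I * (s * w + (-r : ℝ)) ^ 2 / w) =
      Complex.exp (π * Complex.I * (s * (s * w + (-r : ℝ)))) := by
    rw [← Complex.exp_add]
    congr 1
    push_cast
    field_simp
    ring
  rw [← h2]
  field_simp

/-- Klein forms are permuted by the weight `-1` action of `SL(2, ℤ)`. -/
theorem slash (v : Fin 2 → ℝ) (γ : SL(2, ℤ)) :
    (fun τ : ℍ ↦ kleinForm (v 0) (v 1) τ) ∣[(-1 : ℤ)] γ =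
      fun τ : ℍ ↦ kleinForm (Matrix.vecMul v ((γ : Matrix (Fin 2) (Fin 2) ℤ).map (↑)) 0)
        (Matrix.vecMul v ((γ : Matrix (Fin 2) (Fin 2) ℤ).map (↑)) 1) τ := by
  have hγ : γ ∈ Subgroup.closure {ModularGroup.S, ModularGroup.T} := by
    rw [SpecialLinearGroup.SL2Z_generators]
    trivial
  -- The generator `S` is the inversion formula and `T` the translation formula. The characteristic
  -- is generalised because the second factor of a product acts on a characteristic already moved by
  -- the first.
  induction hγ using Subgroup.closure_induction generalizing v with
  | mem x hx =>
    rcases hx with rfl | rfl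
    · ext τ
      rw [SL_slash_apply, modular_S_smul, ModularGroup.denom_S]
      have := inversion (v 0) (v 1) τ.im_pos
      simp [Matrix.vecMul, dotProduct, Fin.sum_univ_two, ModularGroup.S, ← this, neg_div]
    · ext τ
      rw [SL_slash_apply, modular_T_smul, ModularGroup.denom_apply]
      have := translate (v 0) (v 1) τ
      simp [Matrix.vecMul, dotProduct, Fin.sum_univ_two, ModularGroup.T, ← this, add_comm]
  | one => simp [SlashAction.slash_one]
  | mul x y _ _ hx hy =>
    rw [SlashAction.slash_mul, hx, hy, Matrix.vecMul_vecMul]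
    have : ((x * y : SL(2, ℤ)) : Matrix (Fin 2) (Fin 2) ℤ).map ((↑) : ℤ → ℝ) =
        (x : Matrix (Fin 2) (Fin 2) ℤ).map (↑) * (y : Matrix (Fin 2) (Fin 2) ℤ).map (↑) := by
      rw [Matrix.SpecialLinearGroup.coe_mul]
      exact Matrix.map_mul (f := Int.castRingHom ℝ)
    rw [this]
  | inv x _ hx =>
    have h1 : ((x⁻¹ : SL(2, ℤ)) : Matrix (Fin 2) (Fin 2) ℤ).map ((↑) : ℤ → ℝ) *
        (x : Matrix (Fin 2) (Fin 2) ℤ).map (↑) = 1 := by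
      have := congrArg (fun m : Matrix (Fin 2) (Fin 2) ℤ ↦ m.map (Int.castRingHom ℝ))
        (congrArg Subtype.val (inv_mul_cancel x))
      rw [Matrix.SpecialLinearGroup.coe_mul] at this
      simp only [Matrix.map_mul] at this
      simpa using this
    set u := Matrix.vecMul v (((x⁻¹ : SL(2, ℤ)) : Matrix (Fin 2) (Fin 2) ℤ).map ((↑) : ℤ → ℝ))
    have h2 := hx u
    rw [Matrix.vecMul_vecMul, h1, Matrix.vecMul_one] at h2
    rw [← h2, ← SlashAction.slash_mul, mul_inv_cancel, SlashAction.slash_one]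

theorem smul_eq (r s : ℝ) (γ : SL(2, ℤ)) (τ : ℍ) :
    kleinForm r s (γ • τ : ℍ) = (denom γ τ)⁻¹ *
      kleinForm (r * γ 0 0 + s * γ 1 0) (r * γ 0 1 + s * γ 1 1) τ := by
  have h := congrFun (slash ![r, s] γ) τ
  rw [SL_slash_apply] at h
  simp only [Matrix.cons_val_zero, Matrix.cons_val_one, neg_neg, zpow_one] at h
  have h0 := denom_ne_zero γ τ
  have : (kleinForm r s (γ • τ : ℍ)) * denom γ τ =
      kleinForm (r * γ 0 0 + s * γ 1 0) (r * γ 0 1 + s * γ 1 1) τ := by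
    rw [h]
    simp [Matrix.vecMul, dotProduct, Fin.sum_univ_two]
  rw [← this]
  field_simp

lemma ne_zero {r s : ℝ} (h : ∀ m n : ℤ, r = m → s ≠ n) {w : ℂ} (hw : 0 < w.im) :
    kleinForm r s w ≠ 0 := by
  refine mul_ne_zero (Complex.exp_ne_zero _) fun h0 ↦ ?_
  obtain ⟨a, b, hab⟩ := kleinSigma.exists_of_eq_zero hw h0
  have h1 : r = b := by
    have := congrArg Complex.im hab
    simp only [Complex.add_im, Complex.mul_im, Complex.ofReal_re, Complex.ofReal_im, zero_mul,
      add_zero, Complex.intCast_re, Complex.intCast_im, zero_add] at this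
    exact mul_right_cancel₀ hw.ne' this
  refine h b a h1 ?_
  have := congrArg Complex.re hab
  rw [h1] at this
  simp only [Complex.add_re, Complex.mul_re, Complex.ofReal_re, Complex.ofReal_im, zero_mul,
    sub_zero, Complex.intCast_re, Complex.intCast_im] at this
  linarith

lemma differentiableAt (r s : ℝ) {z : ℂ → ℂ} {w : ℂ} (hz : Differentiable ℂ z)
    (hw : 0 < (z w).im) : DifferentiableAt ℂ (fun w ↦ kleinForm r s (z w)) w := by
  unfold kleinForm
  refine DifferentiableAt.mul (by fun_prop) (kleinSigma.differentiableAt (by fun_prop) hz hw)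

lemma tendsto_expTwoPi {t : ℝ} (ht : 0 < t) (s : ℝ) :
    Tendsto (fun τ : ℍ ↦ expTwoPi (t * τ + s)) atImInfty (𝓝 0) := by
  rw [tendsto_zero_iff_norm_tendsto_zero]
  have h : (fun τ : ℍ ↦ ‖expTwoPi (t * τ + s)‖) =
      (fun y : ℝ ↦ Real.exp (-(2 * π * t * y))) ∘ UpperHalfPlane.im := by
    ext τ
    rw [expTwoPi.norm_eq]
    simp [mul_assoc]
  rw [h]
  refine Tendsto.comp ?_ tendsto_comap
  refine Real.tendsto_exp_neg_atTop_nhds_zero.comp ?_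
  exact tendsto_id.const_mul_atTop (by positivity)

/-- For `0 ≤ r < 1` all the q-products tend to nonzero constants, so the exponential prefactor alone
determines the growth. Only for `r = 0` is one of the limits different from 1, namely `1 - exp (2 π
i s)`, which is why `s` must then be nonintegral. -/
lemma isTheta_of_fract {r s : ℝ} (hr0 : 0 ≤ r) (hr1 : r < 1) (h : r = 0 → ∀ n : ℤ, s ≠ n) :
    (fun τ : ℍ ↦ kleinForm r s τ) =Θ[atImInfty] fun τ ↦ Real.exp (π * (r * (1 - r)) * τ.im) := by
  have hq : Tendsto (fun τ : ℍ ↦ expTwoPi τ) atImInfty (𝓝 0) := by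
    simpa using tendsto_expTwoPi one_pos 0
  have h1 : Tendsto (fun τ : ℍ ↦ qPochhammer (expTwoPi τ) (expTwoPi τ)) atImInfty (𝓝 1) :=
    qPochhammer.tendsto_one hq hq
  have h2 : Tendsto (fun τ : ℍ ↦ qPochhammer (expTwoPi (τ - (r * τ + s))) (expTwoPi τ))
      atImInfty (𝓝 1) := by
    refine qPochhammer.tendsto_one ?_ hq
    refine (tendsto_expTwoPi (sub_pos.2 hr1) (-s)).congr fun τ ↦ ?_
    push_cast
    ring_nf
  obtain ⟨c, hc, h3⟩ : ∃ c : ℂ, c ≠ 0 ∧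
      Tendsto (fun τ : ℍ ↦ qPochhammer (expTwoPi (r * τ + s)) (expTwoPi τ)) atImInfty (𝓝 c) := by
    rcases hr0.eq_or_lt with rfl | hr0
    · refine ⟨1 - expTwoPi s, ?_, ?_⟩
      · rw [sub_ne_zero]
        intro h0
        obtain ⟨n, hn⟩ := expTwoPi.eq_one_iff.1 h0.symm
        exact h rfl n (by exact_mod_cast hn)
      · have : Tendsto (fun τ : ℍ ↦ (1 - expTwoPi s) *
            qPochhammer (expTwoPi s * expTwoPi τ) (expTwoPi τ)) atImInfty
            (𝓝 ((1 - expTwoPi s) * 1)) := by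
          refine (qPochhammer.tendsto_one ?_ hq).const_mul _
          simpa using hq.const_mul (expTwoPi s)
        rw [mul_one] at this
        refine this.congr fun τ ↦ ?_
        rw [Complex.ofReal_zero, zero_mul, zero_add,
          qPochhammer.eq_mul (expTwoPi s) (expTwoPi.norm_lt_one τ.im_pos)]
    · exact ⟨1, one_ne_zero, qPochhammer.tendsto_one (tendsto_expTwoPi hr0 s) hq⟩
  have h4 : (fun τ : ℍ ↦ qPochhammer (expTwoPi (r * τ + s)) (expTwoPi τ) *
      qPochhammer (expTwoPi (τ - (r * τ + s))) (expTwoPi τ) /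
      qPochhammer (expTwoPi τ) (expTwoPi τ) ^ 2) =Θ[atImInfty] fun _ ↦ (1 : ℝ) := by
    have := ((h3.mul h2).div (h1.pow 2) (by simp)).norm
    rw [mul_one, one_pow, div_one] at this
    refine isTheta_norm_left.1
      (isTheta_of_div_tendsto_nhds_ne_zero (c := ‖c‖) ?_ (by simpa using hc)).symm
    simpa using this
  have h5 : (fun τ : ℍ ↦ Complex.exp (π * Complex.I * (r * (r * τ + s))) *
      -(Complex.exp (-(π * Complex.I * (r * τ + s))) / (2 * π * Complex.I))) =Θ[atImInfty]
      fun τ ↦ Real.exp (π * (r * (1 - r)) * τ.im) := by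
    have h6 : (fun τ : ℍ ↦ Real.exp (π * (r * (1 - r)) * τ.im)) =Θ[atImInfty]
        fun τ ↦ ‖(2 * π * Complex.I)⁻¹‖ * Real.exp (π * (r * (1 - r)) * τ.im) :=
      (isTheta_const_mul_left (by simp [Real.pi_ne_zero])).2 (isTheta_refl _ _) |>.symm
    refine IsTheta.trans (IsTheta.of_norm_eventuallyEq (.of_forall fun τ ↦ ?_)) h6.symm
    dsimp only
    rw [norm_mul, norm_neg, norm_div, Complex.norm_exp, Complex.norm_exp, mul_div_assoc',
      ← Real.exp_add, div_eq_mul_inv, mul_comm, norm_inv]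
    congr 2
    simp
    ring
  have := h5.mul h4
  simp only [mul_one] at this
  refine (IsTheta.of_norm_eventuallyEq_norm (.of_forall fun τ ↦ ?_)).trans this
  dsimp only
  rw [kleinForm, kleinSigma]
  congr 1
  ring

/-- The growth of a Klein form at `i∞`. -/
theorem isTheta {r s : ℝ} (h : ∀ m n : ℤ, r = m → s ≠ n) :
    (fun τ : ℍ ↦ kleinForm r s τ) =Θ[atImInfty]
      fun τ ↦ Real.exp (π * (Int.fract r * (1 - Int.fract r)) * τ.im) := by
  have h1 : (fun τ : ℍ ↦ kleinForm r s τ) = fun τ : ℍ ↦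
      Complex.exp (π * Complex.I * (⌊r⌋ * (1 - s))) * kleinForm (Int.fract r) s τ := by
    ext τ
    rw [← add_int_left _ _ _ τ.im_pos, Int.fract_add_floor]
  rw [h1, isTheta_const_mul_left (Complex.exp_ne_zero _)]
  refine isTheta_of_fract (Int.fract_nonneg r) (Int.fract_lt_one r) fun h0 n ↦ h ⌊r⌋ n ?_
  rw [Int.fract, sub_eq_zero] at h0
  exact h0

end kleinForm

/-- The Klein form of characteristic `(r, s)`, with argument multiplied by `L`. -/
noncomputable def kleinAt (r s : ℝ) (L : ℕ) (τ : ℍ) : ℂ := kleinForm r s (L * τ)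

namespace kleinAt

lemma im_pos {L : ℕ} (hL : 0 < L) (τ : ℍ) : 0 < ((L : ℂ) * τ).im := by
  have := τ.im_pos
  simp only [Complex.mul_im, Complex.natCast_re, Complex.natCast_im, zero_mul, add_zero, coe_im]
  positivity

lemma ne_zero {r s : ℝ} {L : ℕ} (hL : 0 < L) (h : ∀ m n : ℤ, r = m → s ≠ n) (τ : ℍ) :
    kleinAt r s L τ ≠ 0 :=
  kleinForm.ne_zero h (im_pos hL τ)

lemma mdifferentiable (r s : ℝ) {L : ℕ} (hL : 0 < L) :
    MDifferentiable 𝓘(ℂ) 𝓘(ℂ) (kleinAt r s L) := by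
  rw [UpperHalfPlane.mdifferentiable_iff]
  intro w hw
  have h := kleinForm.differentiableAt r s (z := fun w ↦ (L : ℂ) * w) (by fun_prop)
    (im_pos hL ⟨w, hw⟩)
  refine (h.congr_of_eventuallyEq ?_).differentiableWithinAt
  filter_upwards [isOpen_upperHalfPlaneSet.mem_nhds hw] with z hz
  simp [kleinAt, ofComplex_apply_of_im_pos hz]

/-- The action of an element of `Γ₀(L)`. -/
theorem smul_eq (r s : ℝ) {L : ℕ} (hL : 0 < L) (γ : SL(2, ℤ)) {c : ℤ} (hc : γ 1 0 = L * c)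
    (τ : ℍ) : kleinAt r s L (γ • τ) = (denom γ τ)⁻¹ *
      kleinAt (r * γ 0 0 + s * c) (r * (L * γ 0 1) + s * γ 1 1) L τ := by
  have hdet := γ.det_coe
  rw [Matrix.det_fin_two, hc] at hdet
  -- This is the conjugate of `γ` by `diag(L, 1)`; it is integral because `L` divides the lower left
  -- entry of `γ`.
  set γ' : SL(2, ℤ) := ⟨!![γ 0 0, L * γ 0 1; c, γ 1 1], by
    rw [Matrix.det_fin_two_of]; linear_combination hdet⟩ with hγ'
  set w : ℍ := ⟨L * τ, im_pos hL τ⟩ with hw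
  have h := kleinForm.smul_eq r s γ' w
  have h1 : denom γ' w = denom γ τ := by
    rw [ModularGroup.denom_apply, ModularGroup.denom_apply, hc]
    simp [hγ', hw]
    ring
  have h2 : ((γ' • w : ℍ) : ℂ) = L * (γ • τ : ℍ) := by
    have h3 := h1
    rw [ModularGroup.denom_apply, ModularGroup.denom_apply] at h3
    rw [coe_specialLinearGroup_apply, coe_specialLinearGroup_apply]
    simp only [algebraMap_int_eq, eq_intCast, Complex.ofReal_intCast]
    rw [h3]
    simp [hγ', hw]
    ring
  rw [h1, h2] at h
  rw [kleinAt, h]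
  simp [kleinAt, hγ', hw]

/-- The growth of the translates of a Klein form at `i∞`. -/
theorem isTheta_slash {r s : ℝ} (h : ∀ m n : ℤ, r = m → s ≠ n) {L : ℕ} (hL : 0 < L)
    (γ : SL(2, ℤ)) : (kleinAt r s L ∣[(-1 : ℤ)] γ) =Θ[atImInfty] fun τ ↦
      Real.exp (π * (Int.fract ((r * L * γ 0 0 + s * γ 1 0) / Int.gcd L (γ 1 0)) *
        (1 - Int.fract ((r * L * γ 0 0 + s * γ 1 0) / Int.gcd L (γ 1 0)))) *
        ((Int.gcd L (γ 1 0) : ℝ) ^ 2 / L * τ.im)) := by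
  have hdet := γ.det_coe
  rw [Matrix.det_fin_two] at hdet
  set a := γ 0 0
  set b := γ 0 1
  set c := γ 1 0
  set d := γ 1 1
  set g := Int.gcd L c with hg
  have hg0 : 0 < g := Int.gcd_pos_of_ne_zero_left _ (by positivity)
  have hgc : Int.gcd (L * a) c = g := by
    have : IsCoprime a c := ⟨d, -b, by linear_combination hdet⟩
    exact Int.gcd_mul_left_left_of_gcd_eq_one (Int.isCoprime_iff_gcd_eq_one.1 this)
  obtain ⟨L', hL'⟩ : (g : ℤ) ∣ L := Int.gcd_dvd_left ..
  obtain ⟨c', hc'⟩ : (g : ℤ) ∣ c := Int.gcd_dvd_right ..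
  have hgz : (g : ℤ) ≠ 0 := by positivity
  obtain ⟨v, u, huv⟩ : ∃ v u : ℤ, L' * a * v - c' * u = 1 := by
    have h1 := Int.gcd_eq_gcd_ab (L * a) c
    rw [hgc] at h1
    refine ⟨Int.gcdA (L * a) c, -Int.gcdB (L * a) c, mul_left_cancel₀ hgz ?_⟩
    linear_combination -h1 - hL' * a * Int.gcdA (L * a) c - hc' * Int.gcdB (L * a) c
  -- Factors `diag(L, 1) γ` as `γ'` times the upper triangular matrix with rows `(g, B)` and `(0,
  -- L')`. The slash of `k(r, s)(L τ)` by `γ` is then a constant multiple of a Klein form at `w τ =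
  -- (g τ + B) / L'`, whose imaginary part is `g ^ 2 / L` times that of `τ`.
  set γ' : SL(2, ℤ) := ⟨!![L' * a, u; c', v], by
    rw [Matrix.det_fin_two_of]; linear_combination huv⟩ with hγ'
  have hL'0 : 0 < L' := by
    have : (0 : ℤ) < g * L' := by rw [← hL']; positivity
    exact pos_of_mul_pos_right this (by positivity)
  have hL'c : ((L' : ℤ) : ℂ) ≠ 0 := by exact_mod_cast hL'0.ne'
  have hgcc : ((g : ℕ) : ℂ) ≠ 0 := by exact_mod_cast hg0.ne'
  set B : ℤ := v * (L * b) - u * d with hB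
  have him (τ : ℍ) : (((g : ℂ) * τ + B) / L').im = (g : ℝ) ^ 2 / L * τ.im := by
    rw [show ((L' : ℤ) : ℂ) = ((L' : ℝ) : ℂ) by simp, Complex.div_ofReal_im]
    have e : (L : ℝ) = g * L' := by exact_mod_cast hL'
    have : (0 : ℝ) < L' := by exact_mod_cast hL'0
    have : (0 : ℝ) < g := by exact_mod_cast hg0
    rw [e]
    simp
    field_simp
  have hLpos : (0 : ℝ) < (g : ℝ) ^ 2 / L := by positivity
  set w : ℍ → ℍ := fun τ ↦ ⟨((g : ℂ) * τ + B) / L', by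
    rw [him]; exact mul_pos hLpos τ.im_pos⟩ with hw
  have hwim (τ : ℍ) : (w τ).im = (g : ℝ) ^ 2 / L * τ.im := him τ
  have hwt : Tendsto w atImInfty atImInfty := by
    rw [atImInfty, tendsto_comap_iff]
    have : UpperHalfPlane.im ∘ w = (fun y ↦ (g : ℝ) ^ 2 / L * y) ∘ UpperHalfPlane.im := by
      ext τ
      exact hwim τ
    rw [this]
    exact (tendsto_id.const_mul_atTop hLpos).comp tendsto_comap
  have hden (τ : ℍ) : denom γ τ = L' * denom γ' (w τ) := by
    rw [ModularGroup.denom_apply, ModularGroup.denom_apply]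
    simp only [hγ', hw, Matrix.SpecialLinearGroup.coe_mk, Matrix.of_apply, Matrix.cons_val',
      Matrix.cons_val_zero, Matrix.cons_val_one, Matrix.cons_val_fin_one]
    have e1 : (c : ℂ) = g * c' := by exact_mod_cast hc'
    have e2 : (L' : ℂ) * v + c' * B = d := by
      have : (L' : ℤ) * v + c' * B = d := by
        rw [hB]
        linear_combination d * huv + c' * v * b * hL' - L' * v * b * hc' - L' * v * hdet
      exact_mod_cast this
    change (c : ℂ) * τ + d = _
    rw [e1, ← e2]
    field_simp
    ring
  have hmob (τ : ℍ) : ((γ' • w τ : ℍ) : ℂ) = L * (γ • τ : ℍ) := by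
    have h3 := hden τ
    rw [ModularGroup.denom_apply, ModularGroup.denom_apply] at h3
    have h4 := denom_ne_zero γ' (w τ)
    rw [ModularGroup.denom_apply] at h4
    rw [coe_specialLinearGroup_apply, coe_specialLinearGroup_apply]
    simp only [algebraMap_int_eq, eq_intCast, Complex.ofReal_intCast]
    rw [h3, ← mul_div_assoc (L : ℂ), div_eq_div_iff h4 (mul_ne_zero hL'c h4)]
    rw [← mul_assoc]
    congr 1
    simp only [hγ', hw, Matrix.SpecialLinearGroup.coe_mk, Matrix.of_apply, Matrix.cons_val',
      Matrix.cons_val_zero, Matrix.cons_val_one, Matrix.cons_val_fin_one]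
    have e1 : (L : ℂ) = g * L' := by exact_mod_cast hL'
    have e2 : (L' : ℂ) * a * B + L' * u = L * b := by
      have : L' * a * B + L' * u = L * b := by
        rw [hB]
        linear_combination L * b * huv + u * b * c' * hL' - u * b * L' * hc' - u * L' * hdet
      exact_mod_cast this
    change _ = (L : ℂ) * (a * τ + b)
    rw [mul_add (L : ℂ), ← e2, e1]
    push_cast
    field_simp
    ring
  have key : (kleinAt r s L ∣[(-1 : ℤ)] γ) = fun τ ↦ (L' : ℂ) *
      kleinForm (r * γ' 0 0 + s * γ' 1 0) (r * γ' 0 1 + s * γ' 1 1) (w τ) := by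
    ext τ
    have h4 := denom_ne_zero γ' (w τ)
    rw [SL_slash_apply, kleinAt, ← hmob, kleinForm.smul_eq, hden]
    simp only [neg_neg, zpow_one]
    field_simp
  rw [key, isTheta_const_mul_left hL'c]
  -- `γ'` is invertible over the integers, so it preserves nonintegrality of the characteristic.
  have h0 : ∀ m n : ℤ, r * γ' 0 0 + s * γ' 1 0 = m → r * γ' 0 1 + s * γ' 1 1 ≠ n := by
    intro m n h1 h2
    have hd : ((γ' 0 0 : ℤ) : ℝ) * γ' 1 1 - γ' 0 1 * γ' 1 0 = 1 := by
      have := γ'.det_coe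
      rw [Matrix.det_fin_two] at this
      exact_mod_cast this
    refine h (m * γ' 1 1 - n * γ' 1 0) (n * γ' 0 0 - m * γ' 0 1) ?_ ?_
    · push_cast
      rw [← h1, ← h2]
      linear_combination -r * hd
    · push_cast
      rw [← h1, ← h2]
      linear_combination -s * hd
  have hΘ := kleinForm.isTheta h0
  have e3 : r * ((γ' 0 0 : ℤ) : ℝ) + s * (γ' 1 0 : ℤ) = (r * L * a + s * c) / g := by
    have e1 : (L : ℝ) = g * L' := by exact_mod_cast hL'
    have e2 : (c : ℝ) = g * c' := by exact_mod_cast hc'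
    have : (0 : ℝ) < g := by exact_mod_cast hg0
    rw [e1, e2]
    simp [hγ']
    field_simp
  rw [e3] at hΘ
  have := And.intro (hΘ.1.comp_tendsto hwt) (hΘ.2.comp_tendsto hwt)
  simp only [Function.comp_def, hwim] at this
  rw [e3]
  exact this

end kleinAt

end KleinForm

/-! ### Power series on the unit disc and integrality of their coefficients. -/

section PowerSeries

open Filter Topology

/-- The function `u` is the sum of the power series `P` on the open unit disc. -/
def HasPowerSeries (u : ℂ → ℂ) (P : PowerSeries ℂ) : Prop :=
  ∀ q : ℂ, ‖q‖ < 1 → HasSum (fun n ↦ P.coeff n * q ^ n) (u q)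

namespace HasPowerSeries

variable {u v : ℂ → ℂ} {P Q : PowerSeries ℂ}

lemma congr (h : HasPowerSeries u P) (huv : ∀ q, ‖q‖ < 1 → u q = v q) : HasPowerSeries v P :=
  fun q hq ↦ huv q hq ▸ h q hq

lemma add (hu : HasPowerSeries u P) (hv : HasPowerSeries v Q) :
    HasPowerSeries (fun q ↦ u q + v q) (P + Q) := fun q hq ↦ by
  simpa [add_mul] using (hu q hq).add (hv q hq)

lemma const_mul (hu : HasPowerSeries u P) (c : ℂ) :
    HasPowerSeries (fun q ↦ c * u q) (PowerSeries.C c * P) := fun q hq ↦ by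
  simpa [mul_assoc] using (hu q hq).mul_left c

lemma mul (hu : HasPowerSeries u P) (hv : HasPowerSeries v Q) :
    HasPowerSeries (fun q ↦ u q * v q) (P * Q) := fun q hq ↦ by
  have h1 := (hu q hq).summable.norm
  have h2 := (hv q hq).summable.norm
  have h := tsum_mul_tsum_eq_tsum_sum_antidiagonal_of_summable_norm h1 h2
  rw [(hu q hq).tsum_eq, (hv q hq).tsum_eq] at h
  dsimp only
  rw [h]
  have hs := (summable_norm_sum_mul_antidiagonal_of_summable_norm h1 h2).of_norm.hasSum
  refine hs.congr_fun fun n ↦ ?_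
  rw [PowerSeries.coeff_mul, Finset.sum_mul]
  refine Finset.sum_congr rfl fun p hp ↦ ?_
  rw [← Finset.HasAntidiagonal.mem_antidiagonal.1 hp, pow_add]
  ring

lemma of_polynomial (p : Polynomial ℂ) : HasPowerSeries (fun q ↦ p.eval q) p := fun q _ ↦ by
  dsimp only
  rw [Polynomial.eval_eq_sum_range]
  simp only [Polynomial.coeff_coe]
  refine hasSum_sum_of_ne_finset_zero fun n hn ↦ ?_
  rw [Polynomial.coeff_eq_zero_of_natDegree_lt (by simpa [Nat.lt_succ_iff] using hn), zero_mul]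

lemma one : HasPowerSeries (fun _ ↦ 1) 1 := by
  simpa using of_polynomial 1

lemma hasFPowerSeriesAt (h : HasPowerSeries u P) :
    HasFPowerSeriesAt u (.ofScalars ℂ fun n ↦ P.coeff n) 0 := by
  rw [hasFPowerSeriesAt_iff]
  filter_upwards [Metric.ball_mem_nhds (0 : ℂ) one_pos] with z hz
  simpa [FormalMultilinearSeries.coeff_ofScalars, mul_comm] using h z (by simpa using hz)

lemma unique (h : HasPowerSeries u P) (h' : HasPowerSeries u Q) : P = Q := by
  have := h.hasFPowerSeriesAt.eq_formalMultilinearSeries h'.hasFPowerSeriesAt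
  ext n
  simpa [FormalMultilinearSeries.coeff_ofScalars] using
    congrArg (fun p : FormalMultilinearSeries ℂ ℂ ℂ ↦ p.coeff n) this

lemma continuousAt (h : HasPowerSeries u P) : ContinuousAt u 0 :=
  h.hasFPowerSeriesAt.continuousAt

lemma apply_zero (h : HasPowerSeries u P) : u 0 = P.constantCoeff := by
  have h1 := h 0 (by simp)
  have h2 : HasSum (fun n ↦ P.coeff n * (0 : ℂ) ^ n) (P.coeff 0 * 0 ^ 0) :=
    hasSum_single 0 fun n hn ↦ by simp [hn]
  simpa using h1.unique h2

lemma of_differentiableOn (hu : DifferentiableOn ℂ u (Metric.ball 0 1)) :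
    HasPowerSeries u (.mk fun n ↦ (n.factorial : ℂ)⁻¹ * iteratedDeriv n u 0) := fun q hq ↦ by
  have := Complex.hasSum_taylorSeries_on_ball hu (z := q) (by simpa using hq)
  simpa [mul_assoc, mul_comm, mul_left_comm] using this

lemma coeff_eq (h : HasPowerSeries u P) (hu : DifferentiableOn ℂ u (Metric.ball 0 1)) (n : ℕ) :
    P.coeff n = (n.factorial : ℂ)⁻¹ * iteratedDeriv n u 0 := by
  rw [h.unique (of_differentiableOn hu), PowerSeries.coeff_mk]

end HasPowerSeries

/-- The function `u` is the sum on the unit disc of a power series with integer coefficients. -/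
def HasIntegralSeries (u : ℂ → ℂ) : Prop :=
  ∃ P : PowerSeries ℤ, HasPowerSeries u (P.map (Int.castRingHom ℂ))

namespace HasIntegralSeries

variable {u v : ℂ → ℂ}

lemma mul (hu : HasIntegralSeries u) (hv : HasIntegralSeries v) :
    HasIntegralSeries fun q ↦ u q * v q := by
  obtain ⟨P, hP⟩ := hu
  obtain ⟨Q, hQ⟩ := hv
  exact ⟨P * Q, by simpa using hP.mul hQ⟩

lemma of_polynomial (p : Polynomial ℤ) :
    HasIntegralSeries fun q ↦ (p.map (Int.castRingHom ℂ)).eval q :=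
  ⟨p, by
    rw [← Polynomial.polynomial_map_coe]
    exact HasPowerSeries.of_polynomial _⟩

lemma one : HasIntegralSeries fun _ ↦ 1 := by
  simpa using of_polynomial 1

lemma prod {ι : Type*} (s : Finset ι) {u : ι → ℂ → ℂ} (h : ∀ i ∈ s, HasIntegralSeries (u i)) :
    HasIntegralSeries fun q ↦ ∏ i ∈ s, u i q := by
  classical
  induction s using Finset.induction_on with
  | empty => simpa using one
  | insert a s ha ih =>
    simp only [Finset.prod_insert ha]
    exact (h a (by simp)).mul (ih fun i hi ↦ h i (by simp [hi]))

/-- The reciprocal of a nonvanishing function with integral power series and constant coefficient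
`1` has an integral power series. -/
lemma inv (hu : HasIntegralSeries u) (hd : DifferentiableOn ℂ u (Metric.ball 0 1))
    (h0 : ∀ q, ‖q‖ < 1 → u q ≠ 0) (h1 : u 0 = 1) : HasIntegralSeries fun q ↦ (u q)⁻¹ := by
  obtain ⟨P, hP⟩ := hu
  have hQ := HasPowerSeries.of_differentiableOn (hd.inv fun q hq ↦ h0 q (by simpa using hq))
  set Q := PowerSeries.mk fun n ↦ (n.factorial : ℂ)⁻¹ * iteratedDeriv n u⁻¹ 0
  have hPQ : P.map (Int.castRingHom ℂ) * Q = 1 :=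
    ((hP.mul hQ).congr (v := fun _ ↦ 1) fun q hq ↦ by simp [h0 q hq]).unique HasPowerSeries.one
  have hc : P.constantCoeff = ((1 : ℤˣ) : ℤ) := by
    have := hP.apply_zero
    rw [h1, ← PowerSeries.coeff_zero_eq_constantCoeff_apply, PowerSeries.coeff_map] at this
    simp only [PowerSeries.coeff_zero_eq_constantCoeff, eq_intCast] at this
    exact_mod_cast this.symm
  have hP1 := PowerSeries.mul_invOfUnit P 1 hc
  refine ⟨P.invOfUnit 1, ?_⟩
  -- The Taylor series of the reciprocal and the formal inverse over the integers are both inverse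
  -- to `P`.
  have : Q = (P.invOfUnit 1).map (Int.castRingHom ℂ) := by
    have h2 := congrArg (PowerSeries.map (Int.castRingHom ℂ)) hP1
    rw [map_mul, map_one] at h2
    calc Q = (P.map (Int.castRingHom ℂ) * (P.invOfUnit 1).map (Int.castRingHom ℂ)) * Q := by
          rw [h2, one_mul]
      _ = (P.map (Int.castRingHom ℂ) * Q) * (P.invOfUnit 1).map (Int.castRingHom ℂ) := by ring
      _ = _ := by rw [hPQ, one_mul]
  rw [← this]
  exact hQ.congr fun q _ ↦ rfl

/-- A locally uniform limit of functions with integral power series has an integral power series. -/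
lemma of_tendsto {ι : Type*} {l : Filter ι} [l.NeBot] {F : ι → ℂ → ℂ} {r : ℝ} (hr : 0 < r)
    (hF : ∀ i, HasIntegralSeries (F i)) (hFd : ∀ i, Differentiable ℂ (F i))
    (hu : DifferentiableOn ℂ u (Metric.ball 0 1))
    (h : TendstoLocallyUniformlyOn F u l (Metric.ball 0 r)) : HasIntegralSeries u := by
  have hk (k : ℕ) : TendstoLocallyUniformlyOn (fun i ↦ iteratedDeriv k (F i)) (iteratedDeriv k u) l
      (Metric.ball 0 r) ∧ ∀ i, Differentiable ℂ (iteratedDeriv k (F i)) := by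
    induction k with
    | zero => simpa using ⟨h, hFd⟩
    | succ k ih =>
      simp only [iteratedDeriv_succ]
      exact ⟨ih.1.deriv (.of_forall fun i ↦ (ih.2 i).differentiableOn) Metric.isOpen_ball,
        fun i ↦ by
          have := (ih.2 i).differentiableOn.deriv isOpen_univ
          exact fun x ↦ (this x trivial).differentiableAt (by simp)⟩
  -- Locally uniform convergence passes to all derivatives, so each Taylor coefficient of `u` is a
  -- limit of integers, and the integers are closed in `ℂ`.
  have hint (k : ℕ) : ∃ m : ℤ, (m : ℂ) = (k.factorial : ℂ)⁻¹ * iteratedDeriv k u 0 := by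
    have ht : Tendsto (fun i ↦ (k.factorial : ℂ)⁻¹ * iteratedDeriv k (F i) 0) l
        (𝓝 ((k.factorial : ℂ)⁻¹ * iteratedDeriv k u 0)) :=
      ((hk k).1.tendsto_at (Metric.mem_ball_self hr)).const_mul _
    refine Complex.isClosed_range_intCast.mem_of_tendsto ht (.of_forall fun i ↦ ?_)
    obtain ⟨P, hP⟩ := hF i
    rw [← hP.coeff_eq (hFd i).differentiableOn]
    exact ⟨P.coeff k, by simp⟩
  choose m hm using hint
  refine ⟨.mk m, ?_⟩
  convert HasPowerSeries.of_differentiableOn hu using 1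
  ext n
  simp [hm]

end HasIntegralSeries

lemma qPochhammer.differentiableOn_pow (e : ℕ) {L : ℕ} (hL : 0 < L) :
    DifferentiableOn ℂ (fun q ↦ qPochhammer (q ^ e) (q ^ L)) (Metric.ball 0 1) := fun q hq ↦ by
  refine (qPochhammer.differentiableAt (by fun_prop) (by fun_prop) ?_).differentiableWithinAt
  rw [norm_pow]
  exact pow_lt_one₀ (norm_nonneg _) (by simpa using hq) hL.ne'

/-- The finite partial products are polynomials in `q` with integer coefficients, and they converge
locally uniformly on a disc around `0`. -/
lemma qPochhammer.hasIntegralSeries (e : ℕ) {L : ℕ} (hL : 0 < L) :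
    HasIntegralSeries fun q ↦ qPochhammer (q ^ e) (q ^ L) := by
  have hd (n : ℕ) : Differentiable ℂ fun q : ℂ ↦ 1 + -(q ^ e * (q ^ L) ^ n) := by fun_prop
  have key := Summable.hasProdLocallyUniformlyOn_nat_one_add (K := Metric.ball (0 : ℂ) (1 / 2))
    (f := fun n q ↦ -(q ^ e * (q ^ L) ^ n)) (u := fun n ↦ (1 / 2 : ℝ) ^ n) Metric.isOpen_ball
    (summable_geometric_of_lt_one (by norm_num) (by norm_num))
    (.of_forall fun n q hq ↦ by
      have hq' : ‖q‖ < 1 / 2 := by simpa using hq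
      rw [norm_neg, norm_mul, norm_pow, norm_pow, norm_pow]
      calc ‖q‖ ^ e * (‖q‖ ^ L) ^ n ≤ 1 * ((1 / 2) ^ 1) ^ n := by
            gcongr
            · exact pow_le_one₀ (norm_nonneg _) (by linarith)
            · calc ‖q‖ ^ L ≤ ‖q‖ ^ 1 :=
                    pow_le_pow_of_le_one (norm_nonneg _) (by linarith) hL
                _ ≤ (1 / 2) ^ 1 := by gcongr
        _ = _ := by simp)
    (fun n ↦ by fun_prop)
  refine HasIntegralSeries.of_tendsto (l := atTop) (r := 1 / 2) (by norm_num)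
    (F := fun (s : Finset ℕ) q ↦ ∏ n ∈ s, (1 + -(q ^ e * (q ^ L) ^ n))) (fun s ↦ ?_)
    (fun s ↦ ?_) (differentiableOn_pow e hL) ?_
  · refine HasIntegralSeries.prod s fun n _ ↦ ?_
    have := HasIntegralSeries.of_polynomial (1 + -(.X ^ e * (.X ^ L) ^ n))
    simpa using this
  · exact Differentiable.fun_finsetProd fun n _ ↦ hd n
  · have h2 : (fun q : ℂ ↦ qPochhammer (q ^ e) (q ^ L)) =
        fun q ↦ ∏' n : ℕ, (1 + -(q ^ e * (q ^ L) ^ n)) := by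
      ext q
      simp [qPochhammer, sub_eq_add_neg]
    rw [h2]
    exact key

end PowerSeries

/-! ### Differentiation, and units among integral power series. -/

section PowerSeriesDeriv

open Filter Topology
open scoped ENNReal

namespace HasPowerSeries

variable {u : ℂ → ℂ} {P : PowerSeries ℂ}

lemma differentiableOn (h : HasPowerSeries u P) : DifferentiableOn ℂ u (Metric.ball 0 1) := by
  have hb : HasFPowerSeriesOnBall u (.ofScalars ℂ fun n ↦ P.coeff n) 0 1 := by
    refine ⟨ENNReal.le_of_forall_nnreal_lt fun r hr ↦ ?_, one_pos, fun {y} hy ↦ ?_⟩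
    · refine FormalMultilinearSeries.le_radius_of_tendsto (l := 0) _ ?_
      have hr1 : (r : ℝ) < 1 := by exact_mod_cast hr
      have := (h (r : ℝ) (by simpa using hr1)).summable.tendsto_atTop_zero.norm
      simpa [FormalMultilinearSeries.ofScalars_norm] using this
    · have hy' : ‖y‖ < 1 := by
        rw [Metric.mem_eball, edist_zero_right] at hy
        rw [enorm_eq_nnnorm] at hy
        exact_mod_cast hy
      simpa [FormalMultilinearSeries.ofScalars_apply_eq, mul_comm] using h y hy'
  have := hb.differentiableOn
  rwa [show (1 : ℝ≥0∞) = ENNReal.ofReal 1 by simp, Metric.eball_ofReal] at this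

lemma id_mul_deriv (h : HasPowerSeries u P) :
    HasPowerSeries (fun q ↦ q * deriv u q) (.mk fun n ↦ n * P.coeff n) := by
  have hd : DifferentiableOn ℂ (deriv u) (Metric.ball 0 1) :=
    h.differentiableOn.deriv Metric.isOpen_ball
  have h1 : HasPowerSeries (fun q ↦ q) PowerSeries.X := by
    simpa using of_polynomial .X
  convert h1.mul (of_differentiableOn hd) using 1
  ext n
  cases n with
  | zero => simp
  | succ n =>
    rw [PowerSeries.coeff_succ_X_mul, PowerSeries.coeff_mk, PowerSeries.coeff_mk,
      h.coeff_eq h.differentiableOn, iteratedDeriv_succ', Nat.factorial_succ]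
    have : ((n.factorial : ℕ) : ℂ) ≠ 0 := by exact_mod_cast n.factorial_ne_zero
    have : ((n : ℂ) + 1) ≠ 0 := by exact_mod_cast n.succ_ne_zero
    push_cast
    field_simp

end HasPowerSeries

/-- The function `u` is nonvanishing on the unit disc, takes the value `1` at `0` and has an integral
power series. -/
structure IsUnitSeries (u : ℂ → ℂ) : Prop where
  series : HasIntegralSeries u
  differentiableOn : DifferentiableOn ℂ u (Metric.ball 0 1)
  ne_zero : ∀ q, ‖q‖ < 1 → u q ≠ 0
  apply_zero : u 0 = 1

namespace IsUnitSeries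

variable {u v : ℂ → ℂ}

lemma one : IsUnitSeries fun _ ↦ 1 :=
  ⟨HasIntegralSeries.one, differentiableOn_const 1, by simp, rfl⟩

lemma mul (hu : IsUnitSeries u) (hv : IsUnitSeries v) : IsUnitSeries fun q ↦ u q * v q :=
  ⟨hu.series.mul hv.series, hu.differentiableOn.mul hv.differentiableOn,
    fun q hq ↦ mul_ne_zero (hu.ne_zero q hq) (hv.ne_zero q hq),
    by rw [hu.apply_zero, hv.apply_zero, one_mul]⟩

lemma inv (hu : IsUnitSeries u) : IsUnitSeries fun q ↦ (u q)⁻¹ :=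
  ⟨hu.series.inv hu.differentiableOn hu.ne_zero hu.apply_zero,
    hu.differentiableOn.inv fun q hq ↦ hu.ne_zero q (by simpa using hq),
    fun q hq ↦ inv_ne_zero (hu.ne_zero q hq), by simp [hu.apply_zero]⟩

lemma pow (hu : IsUnitSeries u) (n : ℕ) : IsUnitSeries fun q ↦ u q ^ n := by
  induction n with
  | zero => simpa using one
  | succ n ih => simpa only [pow_succ] using ih.mul hu

lemma zpow (hu : IsUnitSeries u) (n : ℤ) : IsUnitSeries fun q ↦ u q ^ n := by
  cases n with
  | ofNat n => simpa using hu.pow n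
  | negSucc n => simpa only [zpow_negSucc] using (hu.pow (n + 1)).inv

lemma qPochhammer {e L : ℕ} (he : 0 < e) (hL : 0 < L) :
    IsUnitSeries fun q ↦ qPochhammer (q ^ e) (q ^ L) := by
  refine ⟨qPochhammer.hasIntegralSeries e hL, qPochhammer.differentiableOn_pow e hL,
    fun q hq ↦ ?_, ?_⟩
  · have h1 : ‖q ^ L‖ < 1 := by
      rw [norm_pow]
      exact pow_lt_one₀ (norm_nonneg _) hq hL.ne'
    refine qPochhammer.ne_zero h1 fun n hn ↦ ?_
    have : ‖q ^ e * (q ^ L) ^ n‖ < 1 := by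
      rw [← pow_mul, ← pow_add, norm_pow]
      exact pow_lt_one₀ (norm_nonneg _) hq (by omega)
    rw [hn] at this
    simp at this
  · simp [_root_.qPochhammer, he.ne']

end IsUnitSeries

end PowerSeriesDeriv

/-! ### Fourier expansions as Laurent series in `q`. -/

section QExpansion

open Filter Topology WeaklyHolomorphic Asymptotics

lemma expTwoPi.exists_eq {q : ℂ} (hq : q ≠ 0) (h1 : ‖q‖ < 1) : ∃ τ : ℍ, expTwoPi τ = q := by
  have h2 : expTwoPi (Complex.log q / (2 * Real.pi * Complex.I)) = q := by
    rw [expTwoPi, mul_div_cancel₀ _ Complex.two_pi_I_ne_zero, Complex.exp_log hq]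
  have h3 : 0 < (Complex.log q / (2 * Real.pi * Complex.I)).im := by
    have h4 := h1
    rw [← h2, expTwoPi.norm_eq, Real.exp_lt_one_iff, neg_lt_zero] at h4
    exact pos_of_mul_pos_right h4 Real.two_pi_pos.le
  exact ⟨⟨_, h3⟩, h2⟩

namespace WeaklyHolomorphic.HasQExpansion

variable {f g : ℍ → ℂ} {a b : ℤ → ℂ}

lemma hasSum (h : HasQExpansion f a) (τ : ℍ) :
    HasSum (fun n : ℤ ↦ a n * expTwoPi τ ^ n) (f τ) := h.2 τ

lemma add (hf : HasQExpansion f a) (hg : HasQExpansion g b) :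
    HasQExpansion (fun τ ↦ f τ + g τ) (fun n ↦ a n + b n) := by
  obtain ⟨⟨m, hm⟩, hf⟩ := hf
  obtain ⟨⟨m', hm'⟩, hg⟩ := hg
  refine ⟨⟨min m m', fun n hn ↦ ?_⟩, fun τ ↦ ?_⟩
  · simp [hm n (by omega), hm' n (by omega)]
  · simpa only [add_mul] using (hf τ).add (hg τ)

lemma const_mul (hf : HasQExpansion f a) (c : ℂ) :
    HasQExpansion (fun τ ↦ c * f τ) (fun n ↦ c * a n) := by
  obtain ⟨⟨m, hm⟩, hf⟩ := hf
  refine ⟨⟨m, fun n hn ↦ by simp [hm n hn]⟩, fun τ ↦ ?_⟩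
  simpa only [mul_assoc] using (hf τ).mul_left c

lemma sub (hf : HasQExpansion f a) (hg : HasQExpansion g b) :
    HasQExpansion (fun τ ↦ f τ - g τ) (fun n ↦ a n - b n) := by
  simpa [sub_eq_add_neg] using hf.add (hg.const_mul (-1))

lemma congr (hf : HasQExpansion f a) (h : ∀ n, a n = b n) : HasQExpansion f b :=
  funext h ▸ hf

lemma of_hasPowerSeries {u : ℂ → ℂ} {P : PowerSeries ℂ} (h : HasPowerSeries u P) {m : ℤ}
    (hf : ∀ τ : ℍ, f τ = expTwoPi τ ^ m * u (expTwoPi τ)) :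
    HasQExpansion f fun n ↦ if m ≤ n then P.coeff (n - m).toNat else 0 := by
  refine ⟨⟨m, fun n hn ↦ if_neg (not_le.2 hn)⟩, fun τ ↦ ?_⟩
  change HasSum (fun n : ℤ ↦ (if m ≤ n then P.coeff (n - m).toNat else 0) * expTwoPi τ ^ n) _
  have hinj : Function.Injective fun n : ℕ ↦ (n : ℤ) + m := fun x y hxy ↦ by simpa using hxy
  rw [hf, ← hinj.hasSum_iff]
  · refine ((h _ (expTwoPi.norm_lt_one τ.im_pos)).mul_left (expTwoPi τ ^ m)).congr_fun fun n ↦ ?_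
    simp [zpow_add₀ (expTwoPi.ne_zero τ)]
    ring
  · intro n hn
    rw [if_neg, zero_mul]
    intro hmn
    exact hn ⟨(n - m).toNat, by simp [hmn]⟩

/-- Dividing by `q ^ m` moves an expansion from the upper half plane to a power series on the whole
disc: every nonzero `q` in the disc is some `exp (2 π i τ)`, so convergence at all `τ` is
convergence there. -/
lemma exists_hasPowerSeries (hf : HasQExpansion f a) {m : ℤ} (hm : ∀ n < m, a n = 0) :
    ∃ u : ℂ → ℂ, HasPowerSeries u (.mk fun n ↦ a (n + m)) ∧
      ∀ τ : ℍ, f τ = expTwoPi τ ^ m * u (expTwoPi τ) := by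
  have hinj : Function.Injective fun n : ℕ ↦ (n : ℤ) + m := fun x y hxy ↦ by simpa using hxy
  have key (τ : ℍ) :
      HasSum (fun n : ℕ ↦ a (n + m) * expTwoPi τ ^ n) ((expTwoPi τ ^ m)⁻¹ * f τ) := by
    have h1 := hf.hasSum τ
    rw [← hinj.hasSum_iff] at h1
    · refine (h1.mul_left (expTwoPi τ ^ m)⁻¹).congr_fun fun n ↦ ?_
      have := zpow_ne_zero m (expTwoPi.ne_zero τ)
      simp only [Function.comp_apply, zpow_add₀ (expTwoPi.ne_zero τ), zpow_natCast]
      field_simp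
    · intro n hn
      rw [hm n, zero_mul]
      by_contra! hmn
      exact hn ⟨(n - m).toNat, by simp [hmn]⟩
  refine ⟨fun q ↦ ∑' n : ℕ, a (n + m) * q ^ n, fun q hq ↦ ?_, fun τ ↦ ?_⟩
  · simp only [PowerSeries.coeff_mk]
    refine Summable.hasSum ?_
    rcases eq_or_ne q 0 with rfl | hq0
    · exact summable_of_ne_finset_zero (s := {0}) fun n hn ↦ by
        simp [show n ≠ 0 by simpa using hn]
    · obtain ⟨τ, rfl⟩ := expTwoPi.exists_eq hq0 hq
      exact (key τ).summable
  · dsimp only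
    rw [(key τ).tsum_eq, mul_inv_cancel_left₀ (zpow_ne_zero m (expTwoPi.ne_zero τ))]

/-- The product of two Fourier expansions, with its leading coefficient. -/
lemma exists_mul (hf : HasQExpansion f a) (hg : HasQExpansion g b) {m m' : ℤ}
    (hm : ∀ n < m, a n = 0) (hm' : ∀ n < m', b n = 0) :
    ∃ c, HasQExpansion (fun τ ↦ f τ * g τ) c ∧ (∀ n < m + m', c n = 0) ∧
      c (m + m') = a m * b m' ∧
      ∀ S : Subring ℂ, (∀ n, a n ∈ S) → (∀ n, b n ∈ S) → ∀ n, c n ∈ S := by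
  obtain ⟨u, hu, hfu⟩ := hf.exists_hasPowerSeries hm
  obtain ⟨v, hv, hgv⟩ := hg.exists_hasPowerSeries hm'
  refine ⟨_, of_hasPowerSeries (m := m + m') (hu.mul hv) fun τ ↦ ?_,
    fun n hn ↦ if_neg (not_le.2 hn), ?_, fun S ha hb n ↦ ?_⟩
  · rw [hfu, hgv, zpow_add₀ (expTwoPi.ne_zero τ)]
    ring
  · simp [PowerSeries.coeff_mul]
  · split_ifs
    · rw [PowerSeries.coeff_mul]
      refine S.sum_mem fun p _ ↦ S.mul_mem ?_ ?_
      · simpa using ha _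
      · simpa using hb _
    · exact S.zero_mem

/-- Uniqueness of Fourier coefficients: the associated power series vanishes on the punctured disc,
hence at `0` by continuity. -/
lemma eq_zero (h : HasQExpansion (fun _ ↦ 0) a) (n : ℤ) : a n = 0 := by
  obtain ⟨m, hm⟩ := h.1
  obtain ⟨u, hu, hfu⟩ := h.exists_hasPowerSeries hm
  have h1 (q : ℂ) (hq0 : q ≠ 0) (hq : ‖q‖ < 1) : u q = 0 := by
    obtain ⟨τ, rfl⟩ := expTwoPi.exists_eq hq0 hq
    exact (mul_eq_zero.1 (hfu τ).symm).resolve_left (zpow_ne_zero m (expTwoPi.ne_zero τ))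
  have h2 : ∀ᶠ q in 𝓝[≠] (0 : ℂ), u q = 0 := by
    filter_upwards [self_mem_nhdsWithin,
      mem_nhdsWithin_of_mem_nhds (Metric.ball_mem_nhds (0 : ℂ) one_pos)] with q h1' h2'
    exact h1 q h1' (by simpa using h2')
  have h3 : u 0 = 0 := tendsto_nhds_unique
    (hu.continuousAt.tendsto.mono_left nhdsWithin_le_nhds)
    (tendsto_const_nhds.congr' (h2.mono fun q hq ↦ hq.symm))
  have h4 : HasPowerSeries (fun _ ↦ 0) (.mk fun n ↦ a (n + m)) := hu.congr fun q hq ↦ by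
    rcases eq_or_ne q 0 with rfl | hq0
    · exact h3
    · exact h1 q hq0 hq
  have h5 : HasPowerSeries (fun _ ↦ 0) 0 := by simpa using HasPowerSeries.of_polynomial 0
  by_cases hn : n < m
  · exact hm n hn
  · have := congrArg (PowerSeries.coeff (n - m).toNat) (h4.unique h5)
    simpa [not_lt.1 hn] using this

lemma eq_zero_of_forall (h : HasQExpansion f a) (h0 : ∀ n, a n = 0) (τ : ℍ) : f τ = 0 := by
  have := h.hasSum τ
  simp only [h0, zero_mul] at this
  exact this.unique hasSum_zero

lemma tendsto_expTwoPi : Tendsto (fun τ : ℍ ↦ expTwoPi τ) atImInfty (𝓝 0) := by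
  simpa using kleinForm.tendsto_expTwoPi one_pos 0

lemma isBigO (h : HasQExpansion f a) {m : ℤ} (hm : ∀ n < m, a n = 0) :
    f =O[atImInfty] fun τ ↦ Real.exp (-(2 * Real.pi * m * τ.im)) := by
  obtain ⟨u, hu, hfu⟩ := h.exists_hasPowerSeries hm
  have h1 : (fun τ : ℍ ↦ u (expTwoPi τ)) =O[atImInfty] fun _ ↦ (1 : ℝ) :=
    (hu.continuousAt.tendsto.comp tendsto_expTwoPi).isBigO_one ℝ
  have h2 : (fun τ : ℍ ↦ expTwoPi τ ^ m) =O[atImInfty]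
      fun τ ↦ Real.exp (-(2 * Real.pi * m * τ.im)) := by
    refine IsBigO.of_bound 1 (.of_forall fun τ ↦ ?_)
    rw [norm_zpow, expTwoPi.norm_eq, ← Real.rpow_intCast, ← Real.exp_mul, one_mul, Real.norm_eq_abs,
      Real.abs_exp]
    refine Real.exp_le_exp.2 (le_of_eq ?_)
    simp
    ring
  have := h2.mul h1
  simp only [mul_one] at this
  exact this.congr_left fun τ ↦ (hfu τ).symm

lemma tendsto (h : HasQExpansion f a) (hm : ∀ n < 0, a n = 0) :
    Tendsto f atImInfty (𝓝 (a 0)) := by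
  obtain ⟨u, hu, hfu⟩ := h.exists_hasPowerSeries hm
  have := hu.continuousAt.tendsto.comp tendsto_expTwoPi
  rw [hu.apply_zero] at this
  simp only [zpow_zero, one_mul] at hfu
  simpa [Function.comp_def, ← hfu] using this

/-- A `1`-periodic holomorphic function of moderate growth has a Fourier expansion. -/
lemma exists_of_isBigO (hf : MDifferentiable 𝓘(ℂ) 𝓘(ℂ) f)
    (hper : ∀ τ : ℍ, f ((1 : ℝ) +ᵥ τ) = f τ) {n : ℕ}
    (hO : f =O[atImInfty] fun τ ↦ Real.exp (2 * Real.pi * n * τ.im)) :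
    ∃ a, HasQExpansion f a ∧ ∀ j < -(n : ℤ), a j = 0 := by
  -- The factor `q ^ n` cancels the permitted growth, so `F` is bounded at `i∞` and extends
  -- holomorphically over `q = 0`; removing it shifts the exponents by `n`.
  set F : ℍ → ℂ := fun τ ↦ expTwoPi τ ^ n * f τ with hF
  have hFd : MDifferentiable 𝓘(ℂ) 𝓘(ℂ) F := by
    rw [UpperHalfPlane.mdifferentiable_iff] at hf ⊢
    have : DifferentiableOn ℂ (fun w ↦ expTwoPi w ^ n * (f ∘ ofComplex) w) {w | 0 < w.im} :=
      (expTwoPi.differentiable.pow n).differentiableOn.mul hf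
    refine this.congr fun w hw ↦ ?_
    simp [hF, ofComplex_apply_of_im_pos hw]
  have hFp : Function.Periodic (F ∘ ofComplex) (1 : ℝ) := by
    intro w
    by_cases hw : 0 < w.im
    · have hw' : 0 < (w + (1 : ℝ)).im := by simpa using hw
      have h1 : (⟨w + (1 : ℝ), hw'⟩ : ℍ) = (1 : ℝ) +ᵥ ⟨w, hw⟩ := by
        ext
        simp [add_comm]
      simp only [Function.comp_apply, ofComplex_apply_of_im_pos hw, ofComplex_apply_of_im_pos hw']
      rw [h1, hF]
      simp only [hper]
      congr 2
      simp [expTwoPi.add]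
    · have hw' : ¬ 0 < (w + (1 : ℝ)).im := by simpa using hw
      simp only [Function.comp_apply, ofComplex_apply_of_im_nonpos (not_lt.1 hw),
        ofComplex_apply_of_im_nonpos (not_lt.1 hw')]
  have hFb : IsBoundedAtImInfty F := by
    have h2 : (fun τ : ℍ ↦ expTwoPi τ ^ n) =O[atImInfty]
        fun τ ↦ Real.exp (-(2 * Real.pi * n * τ.im)) := by
      refine IsBigO.of_bound 1 (.of_forall fun τ ↦ ?_)
      rw [norm_pow, expTwoPi.norm_eq, ← Real.exp_nat_mul, one_mul, Real.norm_eq_abs,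
        Real.abs_exp]
      refine Real.exp_le_exp.2 (le_of_eq ?_)
      simp
      ring
    refine (h2.mul hO).congr_right fun τ ↦ ?_
    rw [← Real.exp_add, neg_add_cancel, Real.exp_zero]
    rfl
  have hs : HasPowerSeries (UpperHalfPlane.cuspFunction 1 F) (UpperHalfPlane.qExpansion 1 F) :=
    fun q hq ↦ UpperHalfPlane.hasSum_qExpansion_of_norm_lt one_pos hFp hFd hFb hq
  refine ⟨_, of_hasPowerSeries (m := -n) hs fun τ ↦ ?_, fun j hj ↦ if_neg (not_le.2 hj)⟩
  have h1 := UpperHalfPlane.eq_cuspFunction τ one_ne_zero hFp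
  have h2 : Function.Periodic.qParam 1 (τ : ℂ) = expTwoPi τ := by
    simp [Function.Periodic.qParam, expTwoPi]
  rw [h2] at h1
  rw [h1, hF, zpow_neg, zpow_natCast, inv_mul_cancel_left₀ (pow_ne_zero n (expTwoPi.ne_zero τ))]

end WeaklyHolomorphic.HasQExpansion

end QExpansion

/-! ### Conditions at the cusps in terms of slash translates. -/

section Cusps

open Filter Topology WeaklyHolomorphic Asymptotics

/-- `f` is a weakly holomorphic modular form of weight `k` on `Γ₀(N)`, all of whose expansions at
cusps other than `∞` have the property `B`. -/
structure IsModularWith (B : (ℍ → ℂ) → Prop) (k : ℤ) (N : ℕ) (f : ℍ → ℂ) : Prop where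
  holo : MDifferentiable 𝓘(ℂ) 𝓘(ℂ) f
  slash : ∀ γ : SL(2, ℤ), (N : ℤ) ∣ γ 1 0 → f ∣[k] γ = f
  growth : ∃ n : ℕ, f =O[atImInfty] fun τ ↦ Real.exp (2 * Real.pi * n * τ.im)
  other : ∀ γ : SL(2, ℤ), ¬ (N : ℤ) ∣ γ 1 0 → B (f ∣[k] γ)

lemma mem_Gamma0_iff_dvd {N : ℕ} {γ : SL(2, ℤ)} : γ ∈ Gamma0 N ↔ (N : ℤ) ∣ γ 1 0 := by
  rw [Gamma0_mem, ZMod.intCast_zmod_eq_zero_iff_dvd]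

lemma exp_growth_mono {n m : ℕ} (h : n ≤ m) :
    (fun τ : ℍ ↦ Real.exp (2 * Real.pi * n * τ.im)) =O[atImInfty]
      fun τ ↦ Real.exp (2 * Real.pi * m * τ.im) := by
  refine IsBigO.of_bound 1 (.of_forall fun τ ↦ ?_)
  rw [Real.norm_eq_abs, Real.norm_eq_abs, Real.abs_exp, Real.abs_exp, one_mul]
  have := τ.im_pos
  have : (n : ℝ) ≤ m := by exact_mod_cast h
  exact Real.exp_le_exp.2 (by gcongr)

namespace IsModularWith

variable {B : (ℍ → ℂ) → Prop} {k k' : ℤ} {N : ℕ} {f g : ℍ → ℂ}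

lemma vadd_one (h : IsModularWith B k N f) (τ : ℍ) : f ((1 : ℝ) +ᵥ τ) = f τ := by
  have h1 := congrFun (h.slash ModularGroup.T (by simp [ModularGroup.T])) τ
  rw [SL_slash_apply, modular_T_smul, ModularGroup.denom_apply] at h1
  simpa [ModularGroup.T] using h1

lemma exists_hasQExpansion (h : IsModularWith B k N f) : ∃ a, HasQExpansion f a := by
  obtain ⟨n, hn⟩ := h.growth
  obtain ⟨a, ha, -⟩ := HasQExpansion.exists_of_isBigO h.holo h.vadd_one hn
  exact ⟨a, ha⟩

lemma const_mul (hB : ∀ (c : ℂ) u, B u → B (c • u)) (h : IsModularWith B k N f) (c : ℂ) :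
    IsModularWith B k N fun τ ↦ c * f τ := by
  have e : (fun τ ↦ c * f τ) = c • f := rfl
  rw [e]
  refine ⟨h.holo.const_smul c, fun γ hγ ↦ ?_, ?_, fun γ hγ ↦ ?_⟩
  · rw [SL_smul_slash, h.slash γ hγ]
  · obtain ⟨n, hn⟩ := h.growth
    exact ⟨n, hn.const_smul_left c⟩
  · rw [SL_smul_slash]
    exact hB c _ (h.other γ hγ)

lemma add (hB : ∀ u v, B u → B v → B (u + v)) (hf : IsModularWith B k N f)
    (hg : IsModularWith B k N g) : IsModularWith B k N fun τ ↦ f τ + g τ := by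
  have e : (fun τ ↦ f τ + g τ) = f + g := rfl
  rw [e]
  refine ⟨hf.holo.add hg.holo, fun γ hγ ↦ ?_, ?_, fun γ hγ ↦ ?_⟩
  · rw [SlashAction.add_slash, hf.slash γ hγ, hg.slash γ hγ]
  · obtain ⟨n, hn⟩ := hf.growth
    obtain ⟨m, hm⟩ := hg.growth
    exact ⟨max n m, (hn.trans (exp_growth_mono (le_max_left n m))).add
      (hm.trans (exp_growth_mono (le_max_right n m)))⟩
  · rw [SlashAction.add_slash]
    exact hB _ _ (hf.other γ hγ) (hg.other γ hγ)

lemma mul {B' B'' : (ℍ → ℂ) → Prop} (hB : ∀ u v, B u → B' v → B'' (u * v))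
    (hf : IsModularWith B k N f) (hg : IsModularWith B' k' N g) :
    IsModularWith B'' (k + k') N fun τ ↦ f τ * g τ := by
  have e : (fun τ ↦ f τ * g τ) = f * g := rfl
  rw [e]
  refine ⟨hf.holo.mul hg.holo, fun γ hγ ↦ ?_, ?_, fun γ hγ ↦ ?_⟩
  · rw [mul_slash_SL2, hf.slash γ hγ, hg.slash γ hγ]
  · obtain ⟨n, hn⟩ := hf.growth
    obtain ⟨m, hm⟩ := hg.growth
    refine ⟨n + m, (hn.mul hm).congr_right fun τ ↦ ?_⟩
    rw [← Real.exp_add]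
    push_cast
    ring_nf
  · rw [mul_slash_SL2]
    exact hB _ _ (hf.other γ hγ) (hg.other γ hγ)

lemma mono {B' : (ℍ → ℂ) → Prop} (hB : ∀ u, B u → B' u) (h : IsModularWith B k N f) :
    IsModularWith B' k N f :=
  ⟨h.holo, h.slash, h.growth, fun γ hγ ↦ hB _ (h.other γ hγ)⟩

end IsModularWith

lemma UpperHalfPlane.IsZeroAtImInfty.isBounded {u : ℍ → ℂ} (h : IsZeroAtImInfty u) :
    IsBoundedAtImInfty u := by
  have : Tendsto u atImInfty (𝓝 0) := h
  exact this.isBigO_one ℝ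

lemma UpperHalfPlane.IsZeroAtImInfty.mul_isBounded {u v : ℍ → ℂ} (hu : IsZeroAtImInfty u)
    (hv : IsBoundedAtImInfty v) : IsZeroAtImInfty (u * v) := by
  have h1 : Tendsto u atImInfty (𝓝 0) := hu
  have h2 : v =O[atImInfty] (1 : ℍ → ℝ) := hv
  have h3 : u =o[atImInfty] (1 : ℍ → ℝ) := (isLittleO_one_iff ℝ).2 h1
  have h4 := h3.mul_isBigO h2
  simp only [Pi.one_apply, mul_one] at h4
  exact (isLittleO_one_iff ℝ).1 h4

/-- Holomorphy at all cusps but `∞`. -/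
abbrev IsMForm (k : ℤ) (N : ℕ) (f : ℍ → ℂ) : Prop := IsModularWith IsBoundedAtImInfty k N f

/-- Vanishing at all cusps but `∞`. -/
abbrev IsSForm (k : ℤ) (N : ℕ) (f : ℍ → ℂ) : Prop := IsModularWith IsZeroAtImInfty k N f

variable {k k' : ℤ} {N : ℕ} {f g : ℍ → ℂ}

lemma IsMForm.mul (hf : IsMForm k N f) (hg : IsMForm k' N g) :
    IsMForm (k + k') N fun τ ↦ f τ * g τ :=
  IsModularWith.mul (fun _ _ hu hv ↦ Filter.BoundedAtFilter.mul hu hv) hf hg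

lemma IsMForm.add (hf : IsMForm k N f) (hg : IsMForm k N g) :
    IsMForm k N fun τ ↦ f τ + g τ :=
  IsModularWith.add (fun _ _ hu hv ↦ Filter.BoundedAtFilter.add hu hv) hf hg

lemma IsMForm.const_mul (hf : IsMForm k N f) (c : ℂ) : IsMForm k N fun τ ↦ c * f τ :=
  IsModularWith.const_mul (fun c u (hu : u =O[atImInfty] (1 : ℍ → ℝ)) ↦ hu.const_smul_left c) hf c

lemma IsMForm.const (c : ℂ) : IsMForm 0 N fun _ ↦ c := by
  have h1 : (fun _ : ℍ ↦ c) =O[atImInfty] (1 : ℍ → ℝ) :=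
    isBigO_const_const c (one_ne_zero (α := ℝ)) atImInfty
  refine ⟨mdifferentiable_const, fun γ _ ↦ is_invariant_const γ c,
    ⟨0, h1.congr_right fun τ ↦ by simp⟩, fun γ _ ↦ ?_⟩
  rw [show (fun _ : ℍ ↦ c) ∣[(0 : ℤ)] γ = fun _ ↦ c from is_invariant_const γ c]
  exact h1

lemma IsMForm.pow (hf : IsMForm 0 N f) (n : ℕ) : IsMForm 0 N fun τ ↦ f τ ^ n := by
  induction n with
  | zero => simpa using IsMForm.const (N := N) 1
  | succ n ih => simpa only [pow_succ, add_zero] using ih.mul hf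

lemma IsSForm.isMForm (hf : IsSForm k N f) : IsMForm k N f :=
  IsModularWith.mono (fun _ hu ↦ hu.isBounded) hf

lemma IsSForm.mul (hf : IsSForm k N f) (hg : IsMForm k' N g) :
    IsSForm (k + k') N fun τ ↦ f τ * g τ :=
  IsModularWith.mul (fun _ _ hu hv ↦ hu.mul_isBounded hv) hf hg

lemma IsSForm.add (hf : IsSForm k N f) (hg : IsSForm k N g) : IsSForm k N fun τ ↦ f τ + g τ :=
  IsModularWith.add (fun _ _ hu hv ↦ Filter.ZeroAtFilter.add hu hv) hf hg

lemma IsSForm.const_mul (hf : IsSForm k N f) (c : ℂ) : IsSForm k N fun τ ↦ c * f τ :=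
  IsModularWith.const_mul (fun c _ hu ↦ Filter.ZeroAtFilter.smul c hu) hf c

lemma IsSForm.sub (hf : IsSForm k N f) (hg : IsSForm k N g) : IsSForm k N fun τ ↦ f τ - g τ := by
  simpa [sub_eq_add_neg] using hf.add (hg.const_mul (-1))

section

variable [NeZero N]

lemma WeaklyHolomorphic.IsOtherCusp.exists_smul {c : OnePoint ℝ} (hc : IsOtherCusp N c) :
    ∃ γ : SL(2, ℤ), ¬ (N : ℤ) ∣ γ 1 0 ∧ mapGL ℝ γ • (OnePoint.infty : OnePoint ℝ) = c := by
  have h1 := hc.1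
  rw [Subgroup.IsArithmetic.isCusp_iff_isCusp_SL2Z, isCusp_SL2Z_iff'] at h1
  obtain ⟨γ, rfl⟩ := h1
  exact ⟨γ, fun h ↦ hc.2 γ (mem_Gamma0_iff_dvd.2 h) rfl, rfl⟩

lemma isOtherCusp_smul {γ : SL(2, ℤ)} (hγ : ¬ (N : ℤ) ∣ γ 1 0) :
    IsOtherCusp N (mapGL ℝ γ • (OnePoint.infty : OnePoint ℝ)) := by
  refine ⟨?_, fun δ hδ h ↦ hγ ?_⟩
  · rw [Subgroup.IsArithmetic.isCusp_iff_isCusp_SL2Z, isCusp_SL2Z_iff']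
    exact ⟨γ, rfl⟩
  -- If `δ ∈ Γ₀(N)` and `γ` send `∞` to the same cusp, `δ⁻¹ γ` is upper triangular, and then `N`
  -- divides the lower left entry of `γ`.
  · have h1 : mapGL ℝ (δ⁻¹ * γ) • (OnePoint.infty : OnePoint ℝ) = OnePoint.infty := by
      rw [map_mul, mul_smul, ← h, ← mul_smul, ← map_mul, inv_mul_cancel, map_one, one_smul]
    rw [OnePoint.smul_infty_eq_self_iff] at h1
    have h2' : (((δ⁻¹ * γ) 1 0 : ℤ) : ℝ) = 0 := h1
    have h2 : (δ⁻¹ * γ) 1 0 = 0 := by exact_mod_cast h2'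
    have h3 : γ = δ * (δ⁻¹ * γ) := by group
    have h4 : γ 1 0 = δ 1 0 * (δ⁻¹ * γ) 0 0 + δ 1 1 * (δ⁻¹ * γ) 1 0 := by
      conv_lhs => rw [h3]
      rw [Matrix.SpecialLinearGroup.coe_mul, Matrix.mul_apply, Fin.sum_univ_two]
    rw [h4, h2, mul_zero, add_zero]
    exact Dvd.dvd.mul_right (mem_Gamma0_iff_dvd.1 hδ) _

/-- Cusps other than `∞` are exactly the `γ ∞` with `N ∤ γ 1 0`. Meromorphy at the remaining
translates is the growth of `f` itself, by invariance. -/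
lemma isMForm_iff_memMInfty : IsMForm k N f ↔ MemMInfty k N f := by
  constructor
  · intro h
    refine ⟨⟨h.holo, fun γ hγ ↦ h.slash γ (mem_Gamma0_iff_dvd.1 hγ), fun γ ↦ ?_⟩, fun c hc ↦ ?_⟩
    · by_cases hγ : (N : ℤ) ∣ γ 1 0
      · rw [h.slash γ hγ]
        exact h.growth
      · exact ⟨0, IsBigO.congr_right (g₁ := (1 : ℍ → ℝ)) (h.other γ hγ) fun τ ↦ by simp⟩
    · obtain ⟨γ, hγ, hc⟩ := IsOtherCusp.exists_smul hc
      rw [OnePoint.isBoundedAt_iff hc]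
      exact h.other γ hγ
  · intro h
    refine ⟨h.1.holo, fun γ hγ ↦ h.1.slash γ (mem_Gamma0_iff_dvd.2 hγ), ?_, fun γ hγ ↦ ?_⟩
    · simpa using h.1.mero 1
    · exact (OnePoint.isBoundedAt_iff rfl).1 (h.2 _ (isOtherCusp_smul hγ))

lemma isSForm_iff_memSInfty : IsSForm k N f ↔ MemSInfty k N f := by
  constructor
  · intro h
    refine ⟨(isMForm_iff_memMInfty.1 h.isMForm).1, fun c hc ↦ ?_⟩
    obtain ⟨γ, hγ, hc⟩ := IsOtherCusp.exists_smul hc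
    rw [OnePoint.isZeroAt_iff hc]
    exact h.other γ hγ
  · intro h
    refine ⟨h.1.holo, fun γ hγ ↦ h.1.slash γ (mem_Gamma0_iff_dvd.2 hγ), ?_, fun γ hγ ↦ ?_⟩
    · simpa using h.1.mero 1
    · exact (OnePoint.isZeroAt_iff rfl).1 (h.2 _ (isOtherCusp_smul hγ))

lemma CuspForm.isSForm (h : CuspForm ((Gamma0 N).map (mapGL ℝ)) k) : IsSForm k N h := by
  refine ⟨h.holo', fun γ hγ ↦ ?_, ⟨0, ?_⟩, fun γ _ ↦ CuspFormClass.zero_at_infty_slash h γ⟩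
  · exact h.slash_action_eq' _ ⟨γ, mem_Gamma0_iff_dvd.2 hγ, rfl⟩
  · have := (CuspFormClass.zero_at_infty_slash h 1).isBounded
    rw [SlashAction.slash_one] at this
    exact IsBigO.congr_right (g₁ := (1 : ℍ → ℝ)) this fun τ ↦ by simp

/-- A form in `S_k^∞(Γ₀(N))` which also vanishes at `∞`, as a cusp form. -/
noncomputable def IsSForm.toCuspForm (hf : IsSForm k N f) (h0 : IsZeroAtImInfty f) :
    CuspForm ((Gamma0 N).map (mapGL ℝ)) k where
  toFun := f
  slash_action_eq' := by
    rintro _ ⟨γ, hγ, rfl⟩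
    exact hf.slash γ (mem_Gamma0_iff_dvd.1 hγ)
  holo' := hf.holo
  zero_at_cusps' {c} hc := by
    rw [Subgroup.IsArithmetic.isCusp_iff_isCusp_SL2Z] at hc
    rw [OnePoint.isZeroAt_iff_forall_SL2Z hc]
    intro γ _
    by_cases hγ : (N : ℤ) ∣ γ 1 0
    · rw [hf.slash γ hγ]
      exact h0
    · exact hf.other γ hγ

end

namespace WeaklyHolomorphic.HasQExpansion

variable {a : ℤ → ℂ}

lemma exists_leading (h : HasQExpansion f a) {n : ℤ} (hn : a n ≠ 0) :
    ∃ m ≤ n, a m ≠ 0 ∧ ∀ j < m, a j = 0 := by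
  obtain ⟨n₀, hn₀⟩ := h.1
  obtain ⟨m, hm, hmin⟩ := Int.exists_least_of_bdd (P := fun j ↦ a j ≠ 0)
    ⟨n₀, fun z hz ↦ by by_contra! hlt; exact hz (hn₀ z hlt)⟩ ⟨n, hn⟩
  exact ⟨m, hmin n hn, hm, fun j hj ↦ by by_contra! hne; exact absurd (hmin j hne) (by omega)⟩

lemma tendsto_zpow_mul (h : HasQExpansion f a) {m : ℤ} (hm : ∀ n < m, a n = 0) :
    Tendsto (fun τ : ℍ ↦ expTwoPi τ ^ (-m) * f τ) atImInfty (𝓝 (a m)) := by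
  obtain ⟨u, hu, hfu⟩ := h.exists_hasPowerSeries hm
  have h1 := hu.continuousAt.tendsto.comp tendsto_expTwoPi
  rw [hu.apply_zero] at h1
  simp only [← PowerSeries.coeff_zero_eq_constantCoeff_apply, PowerSeries.coeff_mk,
    Nat.cast_zero, zero_add] at h1
  refine h1.congr fun τ ↦ ?_
  rw [hfu, zpow_neg, inv_mul_cancel_left₀ (zpow_ne_zero m (expTwoPi.ne_zero τ)),
    Function.comp_apply]

lemma tendsto_zpow {m : ℤ} (hm : 0 < m) :
    Tendsto (fun τ : ℍ ↦ expTwoPi τ ^ m) atImInfty (𝓝 0) := by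
  lift m to ℕ using hm.le
  have := tendsto_expTwoPi.pow m
  rw [zero_pow (by omega)] at this
  simpa using this

/-- If the leading exponent `m` were negative, `q ^ (-m) f` would tend both to the leading
coefficient and, as `f` is bounded, to `0`. -/
lemma coeff_eq_zero_of_isBounded (h : HasQExpansion f a) (h0 : IsBoundedAtImInfty f) {n : ℤ}
    (hn : n < 0) : a n = 0 := by
  by_contra hne
  obtain ⟨m, hmn, hm, hlt⟩ := h.exists_leading hne
  have h1 := h.tendsto_zpow_mul hlt
  have h2 : IsZeroAtImInfty ((fun τ : ℍ ↦ expTwoPi τ ^ (-m)) * f) :=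
    IsZeroAtImInfty.mul_isBounded (tendsto_zpow (by omega)) h0
  exact hm (tendsto_nhds_unique h1 h2)

lemma coeff_eq_zero_of_isZero (h : HasQExpansion f a) (h0 : IsZeroAtImInfty f) {n : ℤ}
    (hn : n ≤ 0) : a n = 0 := by
  rcases hn.lt_or_eq with hn | rfl
  · exact h.coeff_eq_zero_of_isBounded h0.isBounded hn
  · exact tendsto_nhds_unique
      (h.tendsto fun n hn ↦ h.coeff_eq_zero_of_isBounded h0.isBounded hn) h0

lemma isZeroAtImInfty (h : HasQExpansion f a) (h0 : ∀ n ≤ 0, a n = 0) : IsZeroAtImInfty f := by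
  have := h.tendsto fun n hn ↦ h0 n hn.le
  rwa [h0 0 le_rfl] at this

/-- The Fourier expansion of the derivative. -/
lemma normalizedDeriv (h : HasQExpansion f a) :
    HasQExpansion (Derivative.normalizedDerivOfComplex f) fun n ↦ n * a n := by
  obtain ⟨m, hm⟩ := h.1
  obtain ⟨u, hu, hfu⟩ := h.exists_hasPowerSeries hm
  have hser := (hu.const_mul m).add hu.id_mul_deriv
  refine (of_hasPowerSeries (f := Derivative.normalizedDerivOfComplex f) hser (m := m)
    fun τ ↦ ?_).congr fun n ↦ ?_
  · have hud : DifferentiableAt ℂ u (expTwoPi τ) :=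
      hu.differentiableOn.differentiableAt
        (Metric.isOpen_ball.mem_nhds (by simpa using expTwoPi.norm_lt_one τ.im_pos))
    have he : HasDerivAt expTwoPi (2 * Real.pi * Complex.I * expTwoPi τ) (τ : ℂ) := by
      have : HasDerivAt expTwoPi (expTwoPi τ * (2 * Real.pi * Complex.I * 1)) (τ : ℂ) :=
        ((hasDerivAt_id (τ : ℂ)).const_mul (2 * Real.pi * Complex.I)).cexp
      exact this.congr_deriv (by ring)
    have hz : HasDerivAt (fun w ↦ expTwoPi w ^ m)
        (m * expTwoPi τ ^ (m - 1) * (2 * Real.pi * Complex.I * expTwoPi τ)) (τ : ℂ) :=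
      (hasDerivAt_zpow m (expTwoPi τ) (.inl (expTwoPi.ne_zero τ))).comp (τ : ℂ) he
    have hc : HasDerivAt (fun w ↦ u (expTwoPi w))
        (deriv u (expTwoPi τ) * (2 * Real.pi * Complex.I * expTwoPi τ)) (τ : ℂ) :=
      hud.hasDerivAt.comp (τ : ℂ) he
    have key : HasDerivAt (f ∘ ofComplex) _ (τ : ℂ) :=
      (hz.mul hc).congr_of_eventuallyEq (by
        filter_upwards [isOpen_upperHalfPlaneSet.mem_nhds τ.im_pos] with w hw
        simp only [Function.comp_apply, ofComplex_apply_of_im_pos hw, hfu, Pi.mul_apply])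
    rw [Derivative.normalizedDerivOfComplex, key.deriv, zpow_sub_one₀ (expTwoPi.ne_zero τ)]
    have := expTwoPi.ne_zero τ
    have := Complex.two_pi_I_ne_zero
    field_simp
  · split_ifs with hmn
    · obtain ⟨j, rfl⟩ : ∃ j : ℕ, n = j + m := ⟨(n - m).toNat, by omega⟩
      rw [map_add, PowerSeries.coeff_C_mul, add_sub_cancel_right]
      simp only [PowerSeries.coeff_mk, Int.toNat_natCast]
      push_cast
      ring
    · rw [hm n (by omega), mul_zero]

end WeaklyHolomorphic.HasQExpansion

end Cusps

/-! ### The residue theorem in weight 2, by reduction to level one. -/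

section Residue

open Filter Topology WeaklyHolomorphic Asymptotics

lemma WeaklyHolomorphic.HasQExpansion.const (c : ℂ) :
    HasQExpansion (fun _ ↦ c) fun n ↦ if n = 0 then c else 0 := by
  refine ⟨⟨0, fun n hn ↦ if_neg hn.ne⟩, fun τ ↦ ?_⟩
  have := hasSum_single (f := fun n : ℤ ↦ (if n = 0 then c else 0) *
    Complex.exp (2 * Real.pi * Complex.I * τ) ^ n) 0 fun n hn ↦ by simp [hn]
  simpa using this

lemma ModularFormClass.isMForm_one {F : Type*} [FunLike F ℍ ℂ] {k : ℤ} [ModularFormClass F 𝒮ℒ k]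
    (f : F) : IsMForm k 1 f := by
  refine ⟨ModularFormClass.holo f, fun γ _ ↦ SlashInvariantFormClass.slash_action_eq f _ ⟨γ, rfl⟩,
    ⟨0, ?_⟩, fun γ hγ ↦ absurd (by simp) hγ⟩
  have := ModularFormClass.bdd_at_infty_slash f 1
  rw [SlashAction.slash_one] at this
  exact IsBigO.congr_right (g₁ := (1 : ℍ → ℝ)) this fun τ ↦ by simp

lemma inv_discriminant_isBigO : (fun τ : ℍ ↦ (ModularForm.discriminant τ)⁻¹) =O[atImInfty]
    fun τ ↦ Real.exp (2 * Real.pi * (1 : ℕ) * τ.im) := by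
  have := ModularForm.exp_isBigO_discriminant.inv_rev
    (.of_forall fun τ h ↦ absurd h (Real.exp_pos _).ne')
  refine this.congr_right fun τ ↦ ?_
  rw [← Real.exp_neg]
  simp

/-- The reciprocal of the modular discriminant. -/
lemma isMForm_inv_discriminant : IsMForm (-12) 1 fun τ ↦ (ModularForm.discriminant τ)⁻¹ := by
  have hΔ := ModularFormClass.isMForm_one CuspForm.discriminant
  refine ⟨?_, fun γ hγ ↦ ?_, ⟨1, inv_discriminant_isBigO⟩, fun γ hγ ↦ absurd (by simp) hγ⟩
  · have := hΔ.holo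
    rw [UpperHalfPlane.mdifferentiable_iff] at this ⊢
    exact this.inv fun w _ ↦ ModularForm.discriminant_ne_zero _
  · ext τ
    have h1 := congrFun (hΔ.slash γ hγ) τ
    rw [SL_slash_apply] at h1 ⊢
    have h2 : ModularForm.discriminant (γ • τ) * denom γ τ ^ (-12 : ℤ) =
      ModularForm.discriminant τ := h1
    rw [← h2, mul_inv, ← zpow_neg]

/-- Powers of `E₄ ^ 3 / Δ`, that is, of the modular invariant. -/
lemma exists_isMForm_zero_one (m : ℕ) : ∃ (f : ℍ → ℂ) (a : ℤ → ℂ), IsMForm 0 1 f ∧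
    HasQExpansion f a ∧ (∀ n < -(m : ℤ), a n = 0) ∧ a (-m) ≠ 0 := by
  have hj : ∃ (f : ℍ → ℂ) (a : ℤ → ℂ), IsMForm 0 1 f ∧
      HasQExpansion f a ∧ (∀ n < -1, a n = 0) ∧ a (-1) ≠ 0 := by
    have hE := ModularFormClass.isMForm_one E₄
    have hEb : IsBoundedAtImInfty E₄ := by
      have := ModularFormClass.bdd_at_infty_slash E₄ 1
      rwa [SlashAction.slash_one] at this
    obtain ⟨e, he⟩ := hE.exists_hasQExpansion
    have het := he.tendsto fun n hn ↦ he.coeff_eq_zero_of_isBounded hEb hn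
    have he0 : e 0 = 1 := by
      rw [← het.limUnder_eq, ← EisensteinSeries.E_qExpansion_coeff_zero (k := 4) (by norm_num)
        (by decide)]
      exact (UpperHalfPlane.qExpansion_coeff_zero one_pos
        (ModularFormClass.analyticAt_cuspFunction_zero E₄ one_pos one_mem_strictPeriods_SL)
        (SlashInvariantFormClass.periodic_comp_ofComplex E₄ one_mem_strictPeriods_SL)).symm
    rw [he0] at het
    set J : ℍ → ℂ := fun τ ↦ E₄ τ * E₄ τ * E₄ τ * (ModularForm.discriminant τ)⁻¹ with hJ
    have hJm : IsMForm 0 1 J := ((hE.mul hE).mul hE).mul isMForm_inv_discriminant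
    have hJO : J =O[atImInfty] fun τ ↦ Real.exp (2 * Real.pi * (1 : ℕ) * τ.im) := by
      have hEO : (E₄ : ℍ → ℂ) =O[atImInfty] (1 : ℍ → ℝ) := hEb
      refine (((hEO.mul hEO).mul hEO).mul inv_discriminant_isBigO).congr_right fun τ ↦ ?_
      simp
    obtain ⟨a, ha, ha0⟩ := HasQExpansion.exists_of_isBigO hJm.holo hJm.vadd_one hJO
    -- Without a pole, `J` would have a finite limit at `i∞`, so `Δ J` would tend to `0`; but `Δ J =
    -- E₄ ^ 3` tends to `1`.
    refine ⟨J, a, hJm, ha, ha0, fun h1 ↦ ?_⟩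
    have h2 := ha.tendsto fun n hn ↦ by
      rcases (show n ≤ -1 by omega).lt_or_eq with h | rfl
      · exact ha0 n h
      · exact h1
    have h3 := (show Tendsto ModularForm.discriminant atImInfty (𝓝 0) from
      ModularForm.discriminant_isZeroAtImInfty).mul h2
    have h4 := (het.mul het).mul het
    have h5 : (fun τ ↦ ModularForm.discriminant τ * J τ) = fun τ ↦ E₄ τ * E₄ τ * E₄ τ := by
      ext τ
      have := ModularForm.discriminant_ne_zero τ
      simp only [hJ]
      field_simp
    rw [h5] at h3
    have := tendsto_nhds_unique h3 h4
    simp at this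
  obtain ⟨J, j, hJ, hj, hj0, hj1⟩ := hj
  induction m with
  | zero => exact ⟨fun _ ↦ 1, _, IsMForm.const 1, HasQExpansion.const 1,
      fun n hn ↦ if_neg (by simp at hn; omega), by simp⟩
  | succ m ih =>
    obtain ⟨f, a, hf, ha, ha0, ha1⟩ := ih
    obtain ⟨c, hc, hc0, hc1, -⟩ := ha.exists_mul hj ha0 hj0
    have e : -((m + 1 : ℕ) : ℤ) = -(m : ℤ) + -1 := by push_cast; ring
    rw [e]
    exact ⟨_, c, by simpa using hf.mul hJ, hc, hc0, by rw [hc1]; exact mul_ne_zero ha1 hj1⟩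

/-- In the transformation law of a derivative the correction term is proportional to the weight, so
it disappears in weight 0. -/
lemma IsMForm.normalizedDeriv {N : ℕ} {f : ℍ → ℂ} (hf : IsMForm 0 N f) (γ : SL(2, ℤ))
    (hγ : (N : ℤ) ∣ γ 1 0) : (Derivative.normalizedDerivOfComplex f) ∣[(2 : ℤ)] γ =
      Derivative.normalizedDerivOfComplex f := by
  have h := Derivative.normalizedDerivOfComplex_SL_slash (k := 0) hf.holo (γ := γ)
  rw [hf.slash γ hγ] at h
  conv_rhs => rw [h]
  ext τ
  simp

/-- A weakly holomorphic modular form of weight `2` and level one has vanishing constant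
coefficient. -/
lemma IsMForm.coeff_zero_level_one {f : ℍ → ℂ} (hf : IsMForm 2 1 f) {a : ℤ → ℂ}
    (ha : HasQExpansion f a) : a 0 = 0 := by
  obtain ⟨n₀, hn₀⟩ := ha.1
  obtain ⟨m, hm⟩ : ∃ m : ℕ, ∀ n < -(m : ℤ), a n = 0 :=
    ⟨n₀.natAbs, fun n hn ↦ hn₀ n (by omega)⟩
  clear hn₀ n₀
  induction m generalizing f a with
  | zero =>
    have hb : IsBoundedAtImInfty f :=
      (ha.tendsto fun n hn ↦ hm n (by simpa using hn)).isBigO_one ℝ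
    let F : ModularForm 𝒮ℒ 2 :=
      { toFun := f
        slash_action_eq' := by
          rintro _ ⟨γ, rfl⟩
          exact hf.slash γ (by simp)
        holo' := hf.holo
        bdd_at_cusps' := fun {c} hc ↦ by
          rw [OnePoint.isBoundedAt_iff_forall_SL2Z hc]
          intro γ _
          rw [hf.slash γ (by simp)]
          exact hb }
    have hF : F = 0 := rank_zero_iff_forall_zero.1 levelOne_weight_two_rank_zero F
    have hf0 : f = fun _ ↦ 0 := congrArg (fun G : ModularForm 𝒮ℒ 2 ↦ (G : ℍ → ℂ)) hF
    rw [hf0] at ha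
    exact ha.eq_zero 0
  | succ m ih =>
    -- The derivative of `J` has weight 2, a pole of order exactly `m + 1` and no constant
    -- coefficient. Subtracting the multiple `c` of it lowers the pole order of `f` without changing
    -- `a 0`.
    obtain ⟨J, j, hJ, hj, hj0, hj1⟩ := exists_isMForm_zero_one (m + 1)
    have hd := hj.normalizedDeriv
    set c : ℂ := a (-((m + 1 : ℕ) : ℤ)) / ((-((m + 1 : ℕ) : ℤ) : ℤ) * j (-((m + 1 : ℕ) : ℤ))) with hc
    have hdO := hd.isBigO (m := -((m + 1 : ℕ) : ℤ)) fun n hn ↦ by simp only [hj0 n hn, mul_zero]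
    have hD : IsMForm 2 1 (Derivative.normalizedDerivOfComplex J) :=
      ⟨Derivative.normalizedDerivOfComplex_mdifferentiable hJ.holo, hJ.normalizedDeriv,
        ⟨m + 1, hdO.congr_right fun τ ↦ by push_cast; ring_nf⟩, fun γ hγ ↦ absurd (by simp) hγ⟩
    have key := ih (hf.add (hD.const_mul (-c))) (ha.add (hd.const_mul (-c))) fun n hn ↦ ?_
    · simpa using key
    · have hne : (((-((m + 1 : ℕ) : ℤ) : ℤ) : ℂ)) ≠ 0 := by
        rw [Int.cast_ne_zero]
        omega
      rcases (show n ≤ -((m + 1 : ℕ) : ℤ) by push_cast; omega).lt_or_eq with h | rfl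
      · simp [hm n h, hj0 n h]
      · rw [hc]
        field_simp
        ring

/-- The residue theorem: a form in `S_2^∞(Γ₀(N))` has vanishing constant coefficient. -/
theorem IsSForm.coeff_zero {N : ℕ} [NeZero N] {f : ℍ → ℂ} (hf : IsSForm 2 N f) {a : ℤ → ℂ}
    (ha : HasQExpansion f a) : a 0 = 0 := by
  classical
  have : Fintype (SL(2, ℤ) ⧸ Gamma0 N) := Fintype.ofFinite _
  have hinv (γ δ : SL(2, ℤ)) (h : (γ : SL(2, ℤ) ⧸ Gamma0 N) = δ) :
      f ∣[(2 : ℤ)] γ⁻¹ = f ∣[(2 : ℤ)] δ⁻¹ := by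
    rw [QuotientGroup.eq] at h
    have h1 : γ⁻¹ = (γ⁻¹ * δ) * δ⁻¹ := by group
    rw [h1, SlashAction.slash_mul, hf.slash _ (mem_Gamma0_iff_dvd.1 h)]
  -- The terms of the trace to level one. Inverses appear because the quotient is by left cosets,
  -- while `f` is invariant on the other side. The trivial coset contributes `f`, and all other
  -- terms vanish at `i∞`.
  set t : SL(2, ℤ) ⧸ Gamma0 N → ℍ → ℂ := fun x ↦ f ∣[(2 : ℤ)] x.out⁻¹ with ht
  have ht1 : t ((1 : SL(2, ℤ)) : SL(2, ℤ) ⧸ Gamma0 N) = f := by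
    rw [ht]
    dsimp only
    rw [hinv _ 1 (QuotientGroup.out_eq' _), inv_one, SlashAction.slash_one]
  have ht0 (x : SL(2, ℤ) ⧸ Gamma0 N) (hx : x ≠ ((1 : SL(2, ℤ)) : SL(2, ℤ) ⧸ Gamma0 N)) :
      IsZeroAtImInfty (t x) := by
    refine hf.other _ fun h ↦ hx ?_
    rw [← QuotientGroup.out_eq' x, eq_comm, QuotientGroup.eq, inv_one, one_mul]
    exact inv_mem_iff.1 (mem_Gamma0_iff_dvd.2 h)
  have htd (x : SL(2, ℤ) ⧸ Gamma0 N) : MDifferentiable 𝓘(ℂ) 𝓘(ℂ) (t x) := hf.holo.slash 2 _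
  set T : ℍ → ℂ := ∑ x, t x with hT
  have hTs (γ : SL(2, ℤ)) : T ∣[(2 : ℤ)] γ = T := by
    rw [hT, SlashAction.sum_slash]
    refine Fintype.sum_equiv (MulAction.toPerm γ⁻¹) _ _ fun x ↦ ?_
    simp only [ht, MulAction.toPerm_apply]
    rw [← SlashAction.slash_mul, ← hinv (γ⁻¹ * x.out) _ ?_, mul_inv_rev, inv_inv]
    rw [QuotientGroup.out_eq', ← smul_eq_mul, ← MulAction.Quotient.smul_mk, QuotientGroup.out_eq']
  set E : ℍ → ℂ := ∑ x ∈ Finset.univ.erase ((1 : SL(2, ℤ)) : SL(2, ℤ) ⧸ Gamma0 N), t x with hE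
  have hTE : T = f + E := by
    rw [hT, hE, ← Finset.add_sum_erase _ _ (Finset.mem_univ ((1 : SL(2, ℤ)) : SL(2, ℤ) ⧸ Gamma0 N)),
      ht1]
  have hE0 : IsZeroAtImInfty E := by
    have : Tendsto (fun τ ↦ ∑ x ∈ Finset.univ.erase ((1 : SL(2, ℤ)) : SL(2, ℤ) ⧸ Gamma0 N), t x τ)
        atImInfty (𝓝 (∑ x ∈ Finset.univ.erase ((1 : SL(2, ℤ)) : SL(2, ℤ) ⧸ Gamma0 N), 0)) :=
      tendsto_finsetSum _ fun x hx ↦ ht0 x (Finset.ne_of_mem_erase hx)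
    rw [Finset.sum_const_zero] at this
    refine this.congr fun τ ↦ ?_
    rw [hE, Finset.sum_apply]
  have hTm : IsMForm 2 1 T := by
    refine ⟨MDifferentiable.sum fun x _ ↦ htd x, fun γ _ ↦ hTs γ, ?_,
      fun γ hγ ↦ absurd (by simp) hγ⟩
    obtain ⟨n, hn⟩ := hf.growth
    have h1 : E =O[atImInfty] (1 : ℍ → ℝ) := hE0.isBounded
    have h2 : E =O[atImInfty] fun τ ↦ Real.exp (2 * Real.pi * (0 : ℕ) * τ.im) :=
      h1.congr_right fun τ ↦ by simp
    rw [hTE]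
    exact ⟨n, hn.add (h2.trans (exp_growth_mono n.zero_le))⟩
  obtain ⟨b, hb⟩ := hTm.exists_hasQExpansion
  have h1 := hTm.coeff_zero_level_one hb
  -- The trace and `f` differ by a function vanishing at `i∞`, so they have the same constant
  -- coefficient.
  have h2 := hb.sub ha
  have h3 : (fun τ ↦ T τ - f τ) = E := by
    ext τ
    simp [hTE]
  rw [h3] at h2
  have h4 := h2.coeff_eq_zero_of_isZero hE0 le_rfl
  rw [h1] at h4
  simpa using h4

end Residue

/-! ### Recursions for `T_k(p ^ n)` on coefficients. -/

section HeckeCoefficients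

open WeaklyHolomorphic

variable {k : ℤ} {p : ℕ} {a : ℤ → ℂ}

lemma heckeT_prime_pow (hp : p.Prime) (n : ℕ) (m : ℤ) : heckeT k (p ^ n) a m =
    ∑ i ∈ Finset.range (n + 1), if (p : ℤ) ^ i ∣ m then
      ((p : ℂ) ^ i) ^ (k - 1) * a ((p : ℤ) ^ n * m / ((p : ℤ) ^ i) ^ 2) else 0 := by
  rw [heckeT, ← Finset.sum_filter]
  have h : (Int.gcd ((p ^ n : ℕ) : ℤ) m).divisors =
      ((Finset.range (n + 1)).filter fun i ↦ (p : ℤ) ^ i ∣ m).image (p ^ ·) := by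
    ext d
    have h0 : Int.gcd ((p ^ n : ℕ) : ℤ) m ≠ 0 := by
      rw [Ne, Int.gcd_eq_zero_iff]
      have := pow_pos hp.pos n
      omega
    rw [Nat.mem_divisors, Finset.mem_image, and_iff_left h0, Int.gcd, Int.natAbs_natCast,
      Nat.dvd_gcd_iff, Nat.dvd_prime_pow hp]
    simp only [Finset.mem_filter, Finset.mem_range, Nat.lt_succ_iff]
    constructor
    · rintro ⟨⟨i, hi, rfl⟩, hd⟩
      exact ⟨i, ⟨hi, by exact_mod_cast Int.natCast_dvd.2 hd⟩, rfl⟩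
    · rintro ⟨i, ⟨hi, hd⟩, rfl⟩
      exact ⟨⟨i, hi, rfl⟩, Int.natCast_dvd.1 (by exact_mod_cast hd)⟩
  rw [h, Finset.sum_image fun i _ j _ hij ↦ Nat.pow_right_injective hp.two_le hij]
  push_cast
  rfl

/-- The divisor 1 gives the first term; all other common divisors are multiples of `p`, and dividing
them by `p` gives the sum for `p ^ n` at `m / p`. -/
lemma heckeT_succ (hp : p.Prime) (n : ℕ) (m : ℤ) : heckeT k (p ^ (n + 1)) a m =
    a ((p : ℤ) ^ (n + 1) * m) +
      if (p : ℤ) ∣ m then (p : ℂ) ^ (k - 1) * heckeT k (p ^ n) a (m / p) else 0 := by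
  have hp0 : (p : ℤ) ≠ 0 := by exact_mod_cast hp.ne_zero
  rw [heckeT_prime_pow hp, Finset.sum_range_succ']
  simp only [pow_zero, one_dvd, if_true, one_zpow, one_mul, one_pow, Int.ediv_one]
  rw [add_comm]
  congr 1
  split_ifs with h
  · obtain ⟨m, rfl⟩ := h
    rw [Int.mul_ediv_cancel_left _ hp0, heckeT_prime_pow hp, Finset.mul_sum]
    refine Finset.sum_congr rfl fun i _ ↦ ?_
    rw [mul_ite, mul_zero]
    refine if_congr (by rw [pow_succ', mul_dvd_mul_iff_left hp0]) ?_ rfl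
    rw [pow_succ' (p : ℂ), mul_zpow, show (p : ℤ) ^ (n + 1) * (p * m) = p ^ 2 * (p ^ n * m) by ring,
      show ((p : ℤ) ^ (i + 1)) ^ 2 = p ^ 2 * (p ^ i) ^ 2 by ring,
      Int.mul_ediv_mul_of_pos _ _ (by positivity), mul_assoc]
  · exact Finset.sum_eq_zero fun i _ ↦ if_neg fun hd ↦
      h ((dvd_pow_self _ i.succ_ne_zero).trans hd)

/-- Together with `heckeT_succ` this gives the relation `T(p) T(p ^ (n + 1)) = T(p ^ (n + 2)) + p ^
(k - 1) T(p ^ n)`. -/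
lemma heckeT_succ_mul (hp : p.Prime) (n : ℕ) (m : ℤ) : heckeT k (p ^ (n + 1)) a (p * m) =
    a ((p : ℤ) ^ (n + 2) * m) + (p : ℂ) ^ (k - 1) * heckeT k (p ^ n) a m := by
  have hp0 : (p : ℤ) ≠ 0 := by exact_mod_cast hp.ne_zero
  rw [heckeT_succ hp, if_pos (dvd_mul_right _ _), Int.mul_ediv_cancel_left _ hp0]
  ring_nf

lemma heckeT_one (m : ℤ) : heckeT k 1 a m = a m := by
  simp [heckeT]

end HeckeCoefficients

/-! ### Hecke operators on functions, and their stability on `S_k^∞(Γ₀(N))`. -/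

section HeckeOperator

open Filter Topology WeaklyHolomorphic Asymptotics

/-- Representatives for the integral matrices of determinant `p` modulo `SL(2, ℤ)`. -/
def heckeMatrix (p : ℕ) : Option (Fin p) → Matrix (Fin 2) (Fin 2) ℤ
  | none => !![p, 0; 0, 1]
  | some j => !![1, j; 0, p]

namespace heckeMatrix

variable {p : ℕ}

lemma det (i : Option (Fin p)) : (heckeMatrix p i).det = p := by
  cases i <;> simp [heckeMatrix, Matrix.det_fin_two_of]

/-- The gcd of the first column divides the determinant. If it is `p`, factor it out of that column;
if it is 1, a Bézout relation completes the column to a matrix in `SL(2, ℤ)`, and the remaining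
freedom reduces `j` modulo `p`. -/
lemma exists_mul_eq (hp : p.Prime) {M : Matrix (Fin 2) (Fin 2) ℤ} (hM : M.det = p) :
    ∃ (γ : SL(2, ℤ)) (i : Option (Fin p)), M = γ * heckeMatrix p i := by
  have hp0 : (p : ℤ) ≠ 0 := by exact_mod_cast hp.ne_zero
  rw [Matrix.det_fin_two] at hM
  have hg : Int.gcd (M 0 0) (M 1 0) ∣ p := by
    rw [← Int.natCast_dvd_natCast, ← hM]
    exact dvd_sub ((Int.gcd_dvd_left ..).mul_right _) ((Int.gcd_dvd_right ..).mul_left _)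
  rcases (Nat.dvd_prime hp).1 hg with h1 | h1
  · obtain ⟨u, v, huv⟩ := Int.isCoprime_iff_gcd_eq_one.2 h1
    set j : ℤ := u * M 0 1 + v * M 1 1 with hj
    have hjp : 0 ≤ j % p := Int.emod_nonneg _ hp0
    have hjlt : j % p < p := Int.emod_lt_of_pos _ (by positivity)
    have e : (((j % p).toNat : ℕ) : ℤ) = j - p * (j / p) := by
      rw [Int.toNat_of_nonneg hjp, Int.emod_def]
    refine ⟨⟨!![M 0 0, -v + j / p * M 0 0; M 1 0, u + j / p * M 1 0], ?_⟩,
      some ⟨(j % p).toNat, by omega⟩, ?_⟩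
    · rw [Matrix.det_fin_two_of]
      linear_combination huv
    · ext x y
      fin_cases x <;> fin_cases y <;>
        simp only [Fin.zero_eta, Fin.mk_one, heckeMatrix, Matrix.mul_apply, Fin.sum_univ_two,
          Matrix.of_apply, Matrix.cons_val', Matrix.cons_val_zero, Matrix.cons_val_one,
          Matrix.cons_val_fin_one, mul_one, mul_zero, add_zero, e]
      · linear_combination -M 0 1 * huv - v * hM + M 0 0 * hj
      · linear_combination -M 1 1 * huv + u * hM + M 1 0 * hj
  · obtain ⟨a, ha⟩ : (p : ℤ) ∣ M 0 0 := h1 ▸ Int.gcd_dvd_left ..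
    obtain ⟨c, hc⟩ : (p : ℤ) ∣ M 1 0 := h1 ▸ Int.gcd_dvd_right ..
    refine ⟨⟨!![a, M 0 1; c, M 1 1], ?_⟩, none, ?_⟩
    · rw [Matrix.det_fin_two_of]
      refine mul_left_cancel₀ hp0 ?_
      linear_combination hM - M 1 1 * ha + M 0 1 * hc
    · ext x y
      fin_cases x <;> fin_cases y <;> simp [heckeMatrix, Matrix.mul_apply, ha, hc, mul_comm]

lemma eq_of_mul_eq (hp : p.Prime) {i j : Option (Fin p)} {δ : Matrix (Fin 2) (Fin 2) ℤ}
    (h : heckeMatrix p i = δ * heckeMatrix p j) : i = j := by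
  have hp1 : ¬ (p : ℤ) ∣ 1 := fun h ↦ hp.one_lt.ne' (by
    have := Int.eq_one_of_dvd_one (by positivity) h
    exact_mod_cast this)
  have h00 := congrFun (congrFun h 0) 0
  have h01 := congrFun (congrFun h 0) 1
  have h10 := congrFun (congrFun h 1) 0
  have h11 := congrFun (congrFun h 1) 1
  match i, j with
  | none, none => rfl
  | some i, none =>
    simp [heckeMatrix, Matrix.mul_apply] at h00
    exact absurd ⟨δ 0 0, by rw [h00, mul_comm]⟩ hp1
  | none, some j =>
    simp [heckeMatrix, Matrix.mul_apply] at h10 h11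
    rw [← h10] at h11
    exact absurd ⟨δ 1 1, by rw [h11]; ring⟩ hp1
  | some i, some j =>
    simp [heckeMatrix, Matrix.mul_apply] at h00 h01
    rw [← h00] at h01
    have hij : (i : ℤ) = j := by
      have h1 : (i : ℤ) % p = (j : ℤ) % p := by
        rw [h01]
        simp
      rwa [Int.emod_eq_of_lt (by positivity) (by exact_mod_cast i.2),
        Int.emod_eq_of_lt (by positivity) (by exact_mod_cast j.2)] at h1
    congr 1
    exact Fin.ext (by exact_mod_cast hij)

/-- Right multiplication by an element of `SL(2, ℤ)` permutes the cosets of the representatives. -/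
lemma exists_perm (hp : p.Prime) {N : ℕ} (hN : p.Coprime N) (γ : SL(2, ℤ)) :
    ∃ (e : Equiv.Perm (Option (Fin p))) (δ : Option (Fin p) → SL(2, ℤ)),
      ∀ i, heckeMatrix p i * γ = δ i * heckeMatrix p (e i) ∧
        ((N : ℤ) ∣ δ i 1 0 ↔ (N : ℤ) ∣ γ 1 0) := by
  have hex (i : Option (Fin p)) : ∃ (δ : SL(2, ℤ)) (j : Option (Fin p)),
      heckeMatrix p i * γ = δ * heckeMatrix p j :=
    exists_mul_eq hp (by rw [Matrix.det_mul, det, γ.det_coe, mul_one])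
  choose δ e he using hex
  have hinv (σ : SL(2, ℤ)) : ((σ⁻¹ : SL(2, ℤ)) : Matrix (Fin 2) (Fin 2) ℤ) * σ = 1 := by
    rw [← Matrix.SpecialLinearGroup.coe_mul, inv_mul_cancel, Matrix.SpecialLinearGroup.coe_one]
  have hinv' (σ : SL(2, ℤ)) : (σ : Matrix (Fin 2) (Fin 2) ℤ) * (σ⁻¹ : SL(2, ℤ)) = 1 := by
    rw [← Matrix.SpecialLinearGroup.coe_mul, mul_inv_cancel, Matrix.SpecialLinearGroup.coe_one]
  have hinj : Function.Injective e := by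
    intro i j hij
    refine eq_of_mul_eq hp (δ := (δ i : Matrix (Fin 2) (Fin 2) ℤ) * (δ j)⁻¹) ?_
    have h1 := he i
    rw [hij] at h1
    have h2 : heckeMatrix p (e j) = ((δ j)⁻¹ : SL(2, ℤ)) * (heckeMatrix p j * γ) := by
      rw [he j, ← mul_assoc, hinv, one_mul]
    have h3 : heckeMatrix p i * γ = (δ i : Matrix (Fin 2) (Fin 2) ℤ) * ((δ j)⁻¹ : SL(2, ℤ)) *
        heckeMatrix p j * γ := by
      rw [h1, h2]
      simp only [mul_assoc]
    have h4 := congrArg (· * ((γ⁻¹ : SL(2, ℤ)) : Matrix (Fin 2) (Fin 2) ℤ)) h3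
    simp only [mul_assoc, hinv', mul_one] at h4
    rw [mul_assoc]
    exact h4
  refine ⟨Equiv.ofBijective e (Finite.injective_iff_bijective.1 hinj), δ, fun i ↦ ⟨he i, ?_⟩⟩
  -- The lower left entries of `δ i` and `γ` agree up to factors `p`, which are invertible modulo
  -- `N`. So `δ i` and `γ` both send `∞` to an equivalent cusp, or neither does.
  have hc : IsCoprime (N : ℤ) p := (Nat.isCoprime_iff_coprime.2 hN).symm
  have h10 := congrFun (congrFun (he i) 1) 0
  simp only [Matrix.mul_apply, Fin.sum_univ_two] at h10
  have e1 : (N : ℤ) ∣ δ i 1 0 ↔ (N : ℤ) ∣ δ i 1 0 * p :=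
    ⟨fun h ↦ h.mul_right _, fun h ↦ hc.dvd_of_dvd_mul_right h⟩
  have e2 : (N : ℤ) ∣ γ 1 0 ↔ (N : ℤ) ∣ p * γ 1 0 :=
    ⟨fun h ↦ h.mul_left _, fun h ↦ hc.dvd_of_dvd_mul_left h⟩
  rcases i with _ | i <;> rcases h : e _ with _ | j <;> rw [h] at h10 <;>
    simp [heckeMatrix] at h10
  · rw [e1, h10]
  · rw [h10]
  · rw [e1, e2, h10]
  · rw [e2, h10]

end heckeMatrix

/-- The representatives as elements of `GL(2, ℝ)`. -/
noncomputable def heckeGL (p : ℕ) [NeZero p] (i : Option (Fin p)) : GL (Fin 2) ℝ :=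
  Matrix.GeneralLinearGroup.mkOfDetNeZero ((heckeMatrix p i).map (↑)) (by
    have : (heckeMatrix p i).map ((↑) : ℤ → ℝ) = (Int.castRingHom ℝ).mapMatrix (heckeMatrix p i) :=
      rfl
    rw [this, ← RingHom.map_det, heckeMatrix.det]
    simpa using NeZero.ne p)

/-- The Hecke operator `T_k(p)` on functions. -/
noncomputable def heckeOp (k : ℤ) (p : ℕ) [NeZero p] (f : ℍ → ℂ) : ℍ → ℂ :=
  ∑ i, f ∣[k] heckeGL p i

variable {k : ℤ} {p N : ℕ} [NeZero p] {f : ℍ → ℂ} {a : ℤ → ℂ}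

lemma heckeGL_mul {i j : Option (Fin p)} {γ δ : SL(2, ℤ)}
    (h : heckeMatrix p i * γ = δ * heckeMatrix p j) :
    heckeGL p i * (γ : GL (Fin 2) ℝ) = (δ : GL (Fin 2) ℝ) * heckeGL p j := by
  have h1 := congrArg (Int.castRingHom ℝ).mapMatrix h
  rw [map_mul, map_mul] at h1
  ext x y
  exact congrFun (congrFun h1 x) y

lemma heckeGL_one_zero (i : Option (Fin p)) : heckeGL p i 1 0 = 0 := by
  cases i <;> simp [heckeGL, heckeMatrix, Matrix.GeneralLinearGroup.mkOfDetNeZero]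

lemma heckeOp_slash (hp : p.Prime) (hN : p.Coprime N) (hf : IsSForm k N f) (γ : SL(2, ℤ))
    (hγ : (N : ℤ) ∣ γ 1 0) : heckeOp k p f ∣[k] γ = heckeOp k p f := by
  obtain ⟨e, δ, h⟩ := heckeMatrix.exists_perm hp hN γ
  rw [heckeOp, SlashAction.sum_slash]
  refine Fintype.sum_equiv e _ _ fun i ↦ ?_
  rw [SL_slash, ← SlashAction.slash_mul, heckeGL_mul (h i).1, SlashAction.slash_mul, ← SL_slash,
    hf.slash _ ((h i).2.2 hγ)]

/-- Moving `γ` past a representative replaces it by a `δ i` that again does not lie in `Γ₀(N)`,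
where `f` vanishes; the upper triangular factor left over preserves vanishing at `i∞`. -/
lemma heckeOp_other (hp : p.Prime) (hN : p.Coprime N) (hf : IsSForm k N f) (γ : SL(2, ℤ))
    (hγ : ¬ (N : ℤ) ∣ γ 1 0) : IsZeroAtImInfty (heckeOp k p f ∣[k] γ) := by
  obtain ⟨e, δ, h⟩ := heckeMatrix.exists_perm hp hN γ
  rw [heckeOp, SlashAction.sum_slash]
  have : Tendsto (fun τ ↦ ∑ i, ((f ∣[k] heckeGL p i) ∣[k] γ) τ) atImInfty
      (𝓝 (∑ i : Option (Fin p), 0)) := by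
    refine tendsto_finsetSum _ fun i _ ↦ ?_
    rw [SL_slash, ← SlashAction.slash_mul, heckeGL_mul (h i).1, SlashAction.slash_mul, ← SL_slash]
    exact IsZeroAtImInfty.slash k (heckeGL_one_zero _) (hf.other _ (mt (h i).2.1 hγ))
  rw [Finset.sum_const_zero] at this
  refine this.congr fun τ ↦ ?_
  rw [Finset.sum_apply]

lemma slash_heckeGL_apply (i : Option (Fin p)) (τ : ℍ) : (f ∣[k] heckeGL p i) τ =
    f (heckeGL p i • τ) * (p : ℂ) ^ (k - 1) * denom (heckeGL p i) τ ^ (-k) ∧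
      ((heckeGL p i • τ : ℍ) : ℂ) = num (heckeGL p i) τ / denom (heckeGL p i) τ := by
  have hdet : (heckeGL p i).det.val = p := by
    have : (heckeMatrix p i).map ((↑) : ℤ → ℝ) = (Int.castRingHom ℝ).mapMatrix (heckeMatrix p i) :=
      rfl
    change ((heckeMatrix p i).map ((↑) : ℤ → ℝ)).det = p
    rw [this, ← RingHom.map_det, heckeMatrix.det]
    simp
  have hp : (0 : ℝ) < p := by exact_mod_cast NeZero.pos p
  have hpos : 0 < (heckeGL p i).det.val := by rwa [hdet]
  refine ⟨?_, coe_smul_of_det_pos hpos τ⟩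
  rw [slash_apply, hdet, abs_of_pos hp, UpperHalfPlane.σ, if_pos hpos]
  simp

lemma hasSum_slash_heckeGL_none (hf : HasQExpansion f a) (τ : ℍ) :
    HasSum (fun n : ℤ ↦ (p : ℂ) ^ (k - 1) * (a n * expTwoPi τ ^ (p * n)))
      ((f ∣[k] heckeGL p none) τ) := by
  obtain ⟨h1, h2⟩ := slash_heckeGL_apply (k := k) (f := f) (p := p) none τ
  have hd : denom (heckeGL p none) τ = 1 := by
    simp [denom, heckeGL, heckeMatrix, Matrix.GeneralLinearGroup.mkOfDetNeZero]
  have hn : num (heckeGL p none) τ = p * τ := by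
    simp [num, heckeGL, heckeMatrix, Matrix.GeneralLinearGroup.mkOfDetNeZero]
  rw [hd, hn, div_one] at h2
  rw [h1, hd, one_zpow, mul_one, mul_comm]
  have := (hf.hasSum (heckeGL p none • τ)).mul_left ((p : ℂ) ^ (k - 1))
  rw [h2, expTwoPi.nat_mul] at this
  refine this.congr_fun fun n ↦ ?_
  rw [zpow_mul, zpow_natCast]

lemma hasSum_slash_heckeGL_some (hf : HasQExpansion f a) (j : Fin p) (τ : ℍ) :
    HasSum (fun n : ℤ ↦ (p : ℂ)⁻¹ * (a n * expTwoPi ((τ + j) / p) ^ n))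
      ((f ∣[k] heckeGL p (some j)) τ) := by
  obtain ⟨h1, h2⟩ := slash_heckeGL_apply (k := k) (f := f) (some j) τ
  have hd : denom (heckeGL p (some j)) τ = p := by
    simp [denom, heckeGL, heckeMatrix, Matrix.GeneralLinearGroup.mkOfDetNeZero]
  have hn : num (heckeGL p (some j)) τ = τ + j := by
    simp [num, heckeGL, heckeMatrix, Matrix.GeneralLinearGroup.mkOfDetNeZero]
  have hp : (p : ℂ) ≠ 0 := NeZero.ne _
  rw [hd, hn] at h2
  rw [h1, hd, mul_assoc, ← zpow_add₀ hp, show k - 1 + -k = -1 by ring, zpow_neg_one, mul_comm]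
  have := (hf.hasSum (heckeGL p (some j) • τ)).mul_left (p : ℂ)⁻¹
  rwa [h2] at this

lemma sum_expTwoPi_div (p : ℕ) [NeZero p] (n : ℤ) :
    ∑ j : Fin p, (expTwoPi ((j : ℕ) / p) : ℂ) ^ n = if (p : ℤ) ∣ n then (p : ℂ) else 0 := by
  have hp : (p : ℂ) ≠ 0 := NeZero.ne _
  have hpz : (p : ℤ) ≠ 0 := NeZero.ne _
  have h1 (j : Fin p) : (expTwoPi ((j : ℕ) / p) : ℂ) ^ n = (expTwoPi (n / p)) ^ (j : ℕ) := by
    rw [← expTwoPi.int_mul, ← expTwoPi.nat_mul]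
    congr 1
    ring
  simp only [h1]
  rw [Fin.sum_univ_eq_sum_range (fun j ↦ expTwoPi (n / p) ^ j)]
  split_ifs with h
  · obtain ⟨m, rfl⟩ := h
    have : expTwoPi (((p * m : ℤ) : ℂ) / p) = 1 := by
      rw [expTwoPi.eq_one_iff]
      exact ⟨m, by push_cast; field_simp⟩
    simp only [this, one_pow]
    simp
  · have hne : expTwoPi (n / p) ≠ 1 := by
      rw [Ne, expTwoPi.eq_one_iff]
      rintro ⟨m, hm⟩
      refine h ⟨m, ?_⟩
      rw [div_eq_iff hp] at hm
      have : (n : ℂ) = ((p * m : ℤ) : ℂ) := by push_cast; rw [hm]; ring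
      exact_mod_cast this
    rw [geom_sum_eq hne, ← expTwoPi.nat_mul, mul_div_cancel₀ _ hp,
      expTwoPi.eq_one_iff.2 ⟨n, rfl⟩, sub_self, zero_div]

/-- The Fourier expansion of `f ∣ T_k(p)`. -/
lemma heckeOp_hasQExpansion (hp : p.Prime) (hf : HasQExpansion f a) :
    HasQExpansion (heckeOp k p f) (heckeT k p a) := by
  have hpz : (p : ℤ) ≠ 0 := NeZero.ne _
  have hpc : (p : ℂ) ≠ 0 := NeZero.ne _
  have hinj : Function.Injective fun n : ℤ ↦ (p : ℤ) * n := mul_right_injective₀ hpz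
  have hT (m : ℤ) : heckeT k p a m = (if (p : ℤ) ∣ m then (p : ℂ) ^ (k - 1) * a (m / p) else 0) +
      a (p * m) := by
    have := heckeT_succ (k := k) (a := a) hp 0 m
    simp only [zero_add, pow_one, pow_zero, heckeT_one] at this
    rw [this, add_comm]
  refine ⟨?_, fun τ ↦ ?_⟩
  · obtain ⟨n₀, hn₀⟩ := hf.1
    refine ⟨p * -|n₀|, fun n hn ↦ ?_⟩
    have hp1 : (1 : ℤ) ≤ p := by exact_mod_cast hp.one_le
    have h0 : -|n₀| ≤ n₀ := neg_abs_le n₀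
    have h3 := abs_nonneg n₀
    have h4 : (p : ℤ) * -|n₀| ≤ -|n₀| := by nlinarith
    have hA : p * n < n₀ := by nlinarith
    rw [hT, hn₀ _ hA, add_zero]
    split_ifs with hd
    · obtain ⟨m, rfl⟩ := hd
      rw [Int.mul_ediv_cancel_left _ hpz, hn₀ m ((lt_of_mul_lt_mul_left hn (by omega)).trans_le h0), mul_zero]
    · rfl
  · change HasSum (fun n ↦ heckeT k p a n * expTwoPi τ ^ n) _
    rw [heckeOp, Finset.sum_apply, Fintype.sum_option]
    simp only [hT, add_mul]
    -- The matrix `diag(p, 1)` yields the terms with divisor `p`. In the sum over the other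
    -- representatives the roots of unity cancel except at exponents divisible by `p`, which yields
    -- the coefficients `a (p n)`.
    refine HasSum.add ?_ ?_
    · rw [← hinj.hasSum_iff]
      · refine (hasSum_slash_heckeGL_none hf τ).congr_fun fun n ↦ ?_
        simp only [Function.comp_apply, dvd_mul_right, if_true, Int.mul_ediv_cancel_left _ hpz]
        ring
      · intro n hn
        rw [if_neg, zero_mul]
        rintro ⟨m, rfl⟩
        exact hn ⟨m, rfl⟩
    · have h1 := hasSum_sum (s := Finset.univ) fun j (_ : j ∈ (Finset.univ : Finset (Fin p))) ↦
        hasSum_slash_heckeGL_some (k := k) hf j τ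
      have h2 (n : ℤ) : ∑ j : Fin p, (p : ℂ)⁻¹ * (a n * expTwoPi ((τ + (j : ℕ)) / p) ^ n) =
          if (p : ℤ) ∣ n then a n * expTwoPi (τ / p) ^ n else 0 := by
        have : ∀ j : Fin p, (p : ℂ)⁻¹ * (a n * expTwoPi ((τ + (j : ℕ)) / p) ^ n) =
            (p : ℂ)⁻¹ * a n * expTwoPi (τ / p) ^ n * expTwoPi ((j : ℕ) / p) ^ n := fun j ↦ by
          rw [add_div, expTwoPi.add, mul_zpow]
          ring
        rw [Finset.sum_congr rfl fun j _ ↦ this j, ← Finset.mul_sum, sum_expTwoPi_div]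
        split_ifs
        · field_simp
        · simp
      simp only [h2] at h1
      rw [← hinj.hasSum_iff] at h1
      · refine h1.congr_fun fun n ↦ ?_
        simp only [Function.comp_apply, dvd_mul_right, if_true]
        rw [zpow_mul, zpow_natCast, ← expTwoPi.nat_mul, mul_div_cancel₀ _ hpc]
      · intro n hn
        rw [if_neg]
        rintro ⟨m, rfl⟩
        exact hn ⟨m, rfl⟩

lemma WeaklyHolomorphic.HasQExpansion.growth (ha : HasQExpansion f a) :
    ∃ n : ℕ, f =O[atImInfty] fun τ ↦ Real.exp (2 * Real.pi * n * τ.im) := by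
  obtain ⟨n₀, hn₀⟩ := ha.1
  refine ⟨n₀.natAbs, (ha.isBigO (m := -n₀.natAbs) fun n hn ↦ hn₀ n (by omega)).congr_right
    fun τ ↦ ?_⟩
  rw [Int.cast_neg, Int.cast_natCast]
  ring_nf

/-- Hecke operators preserve the space `S_k^∞(Γ₀(N))`. -/
theorem IsSForm.heckeOp (hp : p.Prime) (hN : p.Coprime N) (hf : IsSForm k N f) :
    IsSForm k N (heckeOp k p f) := by
  obtain ⟨a, ha⟩ := hf.exists_hasQExpansion
  have hT := heckeOp_hasQExpansion (k := k) hp ha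
  exact ⟨MDifferentiable.sum fun i _ ↦ hf.holo.slash k _, heckeOp_slash hp hN hf, hT.growth,
    heckeOp_other hp hN hf⟩

/-- All the Fourier expansions `f ∣ T_k(p ^ n)` come from forms in `S_k^∞(Γ₀(N))`. -/
theorem IsSForm.exists_heckeT (hp : p.Prime) (hN : p.Coprime N) (hf : IsSForm k N f)
    (ha : HasQExpansion f a) (n : ℕ) :
    ∃ h : ℍ → ℂ, IsSForm k N h ∧ HasQExpansion h (heckeT k (p ^ n) a) := by
  have hpz : (p : ℤ) ≠ 0 := NeZero.ne _
  -- The recursion for `T(p ^ n)` has two terms, so two consecutive powers are carried along.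
  have key (n : ℕ) : (∃ h : ℍ → ℂ, IsSForm k N h ∧ HasQExpansion h (heckeT k (p ^ n) a)) ∧
      ∃ h : ℍ → ℂ, IsSForm k N h ∧ HasQExpansion h (heckeT k (p ^ (n + 1)) a) := by
    induction n with
    | zero =>
      refine ⟨⟨f, hf, ?_⟩, ⟨_, hf.heckeOp hp hN, ?_⟩⟩
      · exact ha.congr fun n ↦ by rw [pow_zero, heckeT_one]
      · simpa using heckeOp_hasQExpansion (k := k) hp ha
    | succ n ih =>
      refine ⟨ih.2, ?_⟩
      obtain ⟨⟨h, hh, hha⟩, h', hh', hha'⟩ := ih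
      refine ⟨_, (hh'.heckeOp hp hN).sub (hh.const_mul ((p : ℂ) ^ (k - 1))),
        ((heckeOp_hasQExpansion hp hha').sub (hha.const_mul _)).congr fun m ↦ ?_⟩
      have e := heckeT_succ (k := k) (a := heckeT k (p ^ (n + 1)) a) hp 0 m
      simp only [zero_add, pow_one, pow_zero, heckeT_one] at e
      rw [e, heckeT_succ_mul hp, heckeT_succ hp (n + 1)]
      ring
  exact (key n).1

end HeckeOperator

/-! ### Integral Gaussian elimination on orders at `∞`. -/

section Elimination

open WeaklyHolomorphic

/-- The function `f` has the integral Fourier expansion `q ^ m + ∑_{n > m} A(n) q ^ n`. -/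
structure HasIntegralLeading (f : ℍ → ℂ) (m : ℤ) (A : ℤ → ℤ) : Prop where
  hasQExpansion : HasQExpansion f fun n ↦ (A n : ℂ)
  eq_zero : ∀ n < m, A n = 0
  eq_one : A m = 1

namespace HasIntegralLeading

variable {f g : ℍ → ℂ} {m m' : ℤ} {A B : ℤ → ℤ}

lemma mul (hf : HasIntegralLeading f m A) (hg : HasIntegralLeading g m' B) :
    ∃ C, HasIntegralLeading (fun τ ↦ f τ * g τ) (m + m') C := by
  obtain ⟨c, hc, h0, h1, hS⟩ := hf.hasQExpansion.exists_mul hg.hasQExpansion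
    (m := m) (m' := m') (fun n hn ↦ by simp [hf.eq_zero n hn]) fun n hn ↦ by simp [hg.eq_zero n hn]
  have hint := hS (Int.castRingHom ℂ).range (fun n ↦ ⟨A n, rfl⟩) fun n ↦ ⟨B n, rfl⟩
  choose C hC using hint
  simp only [eq_intCast] at hC
  refine ⟨C, hc.congr fun n ↦ (hC n).symm, fun n hn ↦ ?_, ?_⟩
  · exact_mod_cast (hC n).trans (h0 n hn)
  · have := (hC _).trans h1
    rw [hf.eq_one, hg.eq_one] at this
    exact_mod_cast this

lemma one : HasIntegralLeading (fun _ ↦ 1) 0 fun n ↦ if n = 0 then 1 else 0 := by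
  refine ⟨(HasQExpansion.const 1).congr fun n ↦ ?_, fun n hn ↦ if_neg hn.ne, if_pos rfl⟩
  split_ifs <;> simp_all

lemma pow (hf : HasIntegralLeading f m A) (n : ℕ) :
    ∃ C, HasIntegralLeading (fun τ ↦ f τ ^ n) (n * m) C := by
  induction n with
  | zero => exact ⟨_, by simpa using one⟩
  | succ n ih =>
    obtain ⟨C, hC⟩ := ih
    obtain ⟨D, hD⟩ := hC.mul hf
    refine ⟨D, ?_⟩
    have e : ((n + 1 : ℕ) : ℤ) * m = n * m + m := by push_cast; ring
    simpa only [pow_succ, e] using hD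

end HasIntegralLeading

lemma WeaklyHolomorphic.HasQExpansion.sum {ι : Type*} (s : Finset ι) {f : ι → ℍ → ℂ}
    {a : ι → ℤ → ℂ} (h : ∀ i ∈ s, HasQExpansion (f i) (a i)) :
    HasQExpansion (∑ i ∈ s, f i) fun n ↦ ∑ i ∈ s, a i n := by
  classical
  induction s using Finset.induction_on with
  | empty => exact (HasQExpansion.const 0).congr fun n ↦ by simp
  | insert i s hi ih =>
    have h1 := (h i (s.mem_insert_self i)).add (ih fun j hj ↦ h j (Finset.mem_insert_of_mem hj))
    rw [Finset.sum_insert hi]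
    exact h1.congr fun n ↦ by rw [Finset.sum_insert hi]

/-- Gaussian elimination: a family of functions with integral Fourier expansions and prescribed orders
may be replaced by a family in reduced echelon form. -/
theorem exists_reduced (V : Submodule ℂ (ℍ → ℂ)) (I : Set ℤ) {b : ℤ} (hb : ∀ n ∈ I, b ≤ n)
    (h : ∀ n ∈ I, ∃ f ∈ V, ∃ A, HasIntegralLeading f (-n) A) (n : ℤ) (hn : n ∈ I) :
    ∃ f ∈ V, ∃ A, HasIntegralLeading f (-n) A ∧ ∀ i ∈ I, i ≠ n → A (-i) = 0 := by
  classical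
  suffices H : ∀ d : ℕ, ∀ n ∈ I, n = b + d →
      ∃ f ∈ V, ∃ A, HasIntegralLeading f (-n) A ∧ ∀ i ∈ I, i ≠ n → A (-i) = 0 from
    H (n - b).toNat n hn (by have := hb n hn; omega)
  intro d
  induction d using Nat.strong_induction_on with
  | _ d ih =>
  intro n hn hnd
  obtain ⟨f, hf, A, hA⟩ := h n hn
  -- The reduced forms of smaller pole order; the zero function stands in at irrelevant indices so
  -- that a choice can be made for every integer.
  have ih' (j : ℤ) : ∃ φ ∈ V, ∃ B : ℤ → ℤ, HasQExpansion φ (fun n ↦ (B n : ℂ)) ∧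
      (j ∈ I → j < n → HasIntegralLeading φ (-j) B ∧ ∀ i ∈ I, i ≠ j → B (-i) = 0) := by
    by_cases hj : j ∈ I ∧ j < n
    · have := hb j hj.1
      obtain ⟨φ, hφ, B, hB, hB'⟩ := ih (j - b).toNat (by omega) j hj.1 (by omega)
      exact ⟨φ, hφ, B, hB.hasQExpansion, fun _ _ ↦ ⟨hB, hB'⟩⟩
    · exact ⟨0, V.zero_mem, 0, (HasQExpansion.const 0).congr fun n ↦ by simp,
        fun h1 h2 ↦ absurd ⟨h1, h2⟩ hj⟩
  choose φ hφ B hBq hB using ih'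
  set s := (Finset.Ico b n).filter (· ∈ I) with hs
  have hmem {j : ℤ} : j ∈ s ↔ j ∈ I ∧ j < n := by
    rw [hs, Finset.mem_filter, Finset.mem_Ico]
    exact ⟨fun h ↦ ⟨h.2, h.1.2⟩, fun h ↦ ⟨⟨hb j h.1, h.2⟩, h.1⟩⟩
  have hlow {j : ℤ} (hj : j ∈ s) {m : ℤ} (hm : m ≤ -n) : B j m = 0 := by
    obtain ⟨h1, h2⟩ := hmem.1 hj
    exact (hB j h1 h2).1.eq_zero m (by omega)
  -- Since the `φ j` are already reduced and have leading coefficient 1, a single subtraction clears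
  -- all prescribed coefficients, and no denominators arise.
  refine ⟨f - ∑ j ∈ s, (A (-j) : ℂ) • φ j,
    V.sub_mem hf (V.sum_mem fun j _ ↦ V.smul_mem _ (hφ j)),
    fun m ↦ A m - ∑ j ∈ s, A (-j) * B j m, ⟨?_, fun m hm ↦ ?_, ?_⟩, fun i hi hin ↦ ?_⟩
  · refine (hA.hasQExpansion.sub (HasQExpansion.sum s fun j _ ↦
      (hBq j).const_mul (A (-j) : ℂ))).congr fun m ↦ ?_
    push_cast
    rfl
  · rw [hA.eq_zero m hm, Finset.sum_eq_zero fun j hj ↦ by rw [hlow hj hm.le, mul_zero], sub_zero]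
  · rw [hA.eq_one, Finset.sum_eq_zero fun j hj ↦ by rw [hlow hj le_rfl, mul_zero], sub_zero]
  · dsimp only
    rcases lt_or_gt_of_ne hin with hlt | hgt
    · rw [Finset.sum_eq_single_of_mem i (hmem.2 ⟨hi, hlt⟩), (hB i hi hlt).1.eq_one, mul_one, sub_self]
      intro j hj hji
      obtain ⟨h1, h2⟩ := hmem.1 hj
      rw [(hB j h1 h2).2 i hi hji.symm, mul_zero]
    · rw [hA.eq_zero _ (by omega), Finset.sum_eq_zero fun j hj ↦ by rw [hlow hj (by omega), mul_zero],
        sub_zero]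

lemma isZeroAtImInfty_zero : IsZeroAtImInfty (0 : ℍ → ℂ) := Filter.zero_zeroAtFilter _

lemma IsSForm.zero (k : ℤ) (N : ℕ) : IsSForm k N 0 :=
  ⟨mdifferentiable_const, fun γ _ ↦ SlashAction.zero_slash k γ, ⟨0, Asymptotics.isBigO_zero _ _⟩,
    fun γ _ ↦ by rw [SlashAction.zero_slash k γ]; exact isZeroAtImInfty_zero⟩

/-- The space `M_k^∞(Γ₀(N))`. -/
def mFormSubmodule (k : ℤ) (N : ℕ) : Submodule ℂ (ℍ → ℂ) where
  carrier := {f | IsMForm k N f}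
  add_mem' hf hg := IsMForm.add hf hg
  zero_mem' := (IsSForm.zero k N).isMForm
  smul_mem' c _ hf := IsMForm.const_mul hf c

/-- The space `S_k^∞(Γ₀(N))`. -/
def sFormSubmodule (k : ℤ) (N : ℕ) : Submodule ℂ (ℍ → ℂ) where
  carrier := {f | IsSForm k N f}
  add_mem' hf hg := IsSForm.add hf hg
  zero_mem' := IsSForm.zero k N
  smul_mem' c _ hf := IsSForm.const_mul hf c

end Elimination

/-! ### Duality and Hecke equivariance. -/

section DualFamilies

open WeaklyHolomorphic

variable {k : ℤ} {N : ℕ} [NeZero N]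

/-- Forms of all orders `-n` with `n ≥ 2` in `M_{2-k}^∞(Γ₀(N))` rule out forms of order at least `2` in
`S_k^∞(Γ₀(N))`. -/
lemma IsSForm.eq_zero_of_coeff
    (hφ : ∀ n : ℤ, 2 ≤ n → ∃ φ, IsMForm (2 - k) N φ ∧ ∃ A, HasIntegralLeading φ (-n) A)
    {f : ℍ → ℂ} (hf : IsSForm k N f) {a : ℤ → ℂ} (ha : HasQExpansion f a)
    (h0 : ∀ n < 2, a n = 0) : f = 0 := by
  refine funext fun τ ↦ ha.eq_zero_of_forall (fun n ↦ ?_) τ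
  by_contra hne
  obtain ⟨m, -, hm, hlt⟩ := ha.exists_leading hne
  obtain ⟨φ, hφM, A, hA⟩ := hφ m (by by_contra! h; exact hm (h0 m h))
  obtain ⟨c, hc, -, hlead, -⟩ := ha.exists_mul hA.hasQExpansion hlt
    fun n hn ↦ by simp [hA.eq_zero n hn]
  have h2 := hf.mul hφM
  rw [add_sub_cancel] at h2
  have h3 := h2.coeff_zero hc
  rw [add_neg_cancel, h3, hA.eq_one, Int.cast_one, mul_one] at hlead
  exact hm hlead.symm

/-- Below index 2 the input has only the coefficient at `-1`. For `j ≤ 0` a divisor `p ^ i` picks up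
an input index that is at most `0`, and this index equals `-1` only for `i = n` and `j = -p ^ n`.
For `j = 1` only the divisor 1 occurs. -/
lemma heckeT_prime_pow_of_le_one {p : ℕ} [NeZero p] (hp : p.Prime) {C : ℤ → ℤ}
    (h1 : C (-1) = -1) (h0 : ∀ n < 2, n ≠ -1 → C n = 0) (n : ℕ) {j : ℤ} (hj : j < 2) :
    heckeT k (p ^ n) (fun j ↦ (C j : ℂ)) j =
      (if j = -(p : ℤ) ^ n then -(p : ℂ) ^ ((k - 1) * n) else 0) +
        if j = 1 then (C ((p : ℤ) ^ n) : ℂ) else 0 := by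
  have hp0 : (0 : ℤ) < p := by exact_mod_cast hp.pos
  have hp2 : (2 : ℤ) ≤ p := by exact_mod_cast hp.two_le
  have hpn : (0 : ℤ) < (p : ℤ) ^ n := by positivity
  rw [heckeT_prime_pow hp]
  rcases (show j = 1 ∨ j ≤ 0 by omega) with rfl | hj0
  · rw [if_neg (by omega), if_pos rfl, zero_add, Finset.sum_eq_single_of_mem 0 (by simp)]
    · simp
    · intro i _ hi
      rw [if_neg]
      intro hd
      have := Int.le_of_dvd one_pos hd
      have : (2 : ℤ) ≤ (p : ℤ) ^ i := hp2.trans (le_self_pow₀ (by omega) hi)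
      omega
  · have hj1 : j ≠ 1 := by omega
    rw [if_neg hj1, add_zero]
    have key (i : ℕ) (hi : i ∈ Finset.range (n + 1)) (l : ℤ) (hl : j = p ^ i * l) :
        (p : ℤ) ^ n * j / (p ^ i) ^ 2 = p ^ (n - i) * l := by
      rw [Finset.mem_range] at hi
      have e : (p : ℤ) ^ n * j = (p ^ i) ^ 2 * (p ^ (n - i) * l) := by
        rw [hl, ← pow_sub_mul_pow (p : ℤ) (show i ≤ n by omega)]
        ring
      rw [e, Int.mul_ediv_cancel_left _ (by positivity)]
    have hzero (i : ℕ) (hi : i ∈ Finset.range (n + 1)) (l : ℤ) (hl : j = p ^ i * l)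
        (h : ¬ (i = n ∧ j = -(p : ℤ) ^ n)) : C ((p : ℤ) ^ (n - i) * l) = 0 := by
      have hpi : (0 : ℤ) < (p : ℤ) ^ i := by positivity
      have hpni : (0 : ℤ) < (p : ℤ) ^ (n - i) := by positivity
      have hl0 : l ≤ 0 := by
        by_contra! hlt
        nlinarith
      refine h0 _ (by nlinarith) fun he ↦ h ?_
      have hdiv : (p : ℤ) ^ (n - i) ∣ 1 := by
        rw [← dvd_neg]
        exact ⟨l, he.symm⟩
      have h3 : n - i = 0 := by
        by_contra hne
        have h4 := Int.le_of_dvd one_pos hdiv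
        have : (2 : ℤ) ≤ (p : ℤ) ^ (n - i) := hp2.trans (le_self_pow₀ (by omega) hne)
        omega
      rw [Finset.mem_range] at hi
      obtain rfl : i = n := by omega
      rw [h3, pow_zero, one_mul] at he
      exact ⟨rfl, by rw [hl, he]; ring⟩
    split_ifs with hjn
    · rw [Finset.sum_eq_single_of_mem n (by simp)]
      · have hd : j = (p : ℤ) ^ n * (-1) := by rw [hjn]; ring
        rw [if_pos ⟨_, hd⟩, key n (by simp) _ hd]
        simp only [Nat.sub_self, pow_zero, one_mul, h1]
        rw [← zpow_natCast (p : ℂ) n, ← zpow_mul, mul_comm (n : ℤ)]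
        simp
      · intro i hi hin
        split_ifs with hd
        · obtain ⟨l, hl⟩ := hd
          rw [key i hi l hl, hzero i hi l hl fun h ↦ hin h.1]
          simp
        · rfl
    · refine Finset.sum_eq_zero fun i hi ↦ ?_
      split_ifs with hd
      · obtain ⟨l, hl⟩ := hd
        rw [key i hi l hl, hzero i hi l hl fun h ↦ hjn h.2]
        simp
      · rfl

/-- Suppose that `S_k(Γ₀(N))` contains a form `q + O(q ^ 2)`, that `M_{2-k}^∞(Γ₀(N))` contains forms of all
orders `-n` with `n ≥ 2`, and that `S_k^∞(Γ₀(N))` contains forms of all orders `-m` with `m ≥ 1` (and also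
`m = 0` if `k = 4`). Then the reduced bases of these spaces have the Hecke equivariance property. -/
theorem exists_dual_families (hk : k = 2 ∨ k = 4) {g : ℍ → ℂ} (hg : IsSForm k N g) {B : ℤ → ℤ}
    (hB : HasIntegralLeading g 1 B)
    (hφ : ∀ n : ℤ, 2 ≤ n → ∃ φ, IsMForm (2 - k) N φ ∧ ∃ A, HasIntegralLeading φ (-n) A)
    (hψ : ∀ m : ℤ, 1 ≤ m ∨ (k = 4 ∧ m = 0) →
      ∃ ψ, IsSForm k N ψ ∧ ∃ A, HasIntegralLeading ψ (-m) A) :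
    ∃ g : CuspForm ((Gamma0 N).map (mapGL ℝ)) k,
      (∃ a : ℤ → ℂ, WeaklyHolomorphic.HasQExpansion g a ∧ a 1 = 1) ∧
      (∀ h : CuspForm ((Gamma0 N).map (mapGL ℝ)) k, ∃ c : ℂ, h = c • g) ∧
      (∀ n : ℕ, 2 ≤ n → ∃ (φ : ℍ → ℂ) (A : ℤ → ℤ), WeaklyHolomorphic.IsPhin k N n φ A) ∧
      (∀ m : ℤ, (m = -1 ∨ 1 ≤ m ∨ (k = 4 ∧ m = 0)) →
        ∃! F : ℍ → ℂ, ∃ C : ℤ → ℤ, WeaklyHolomorphic.IsFm k N m F C) ∧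
      (∀ p : ℕ, p.Prime → ¬ p ∣ N → ∀ n : ℕ, ∀ (F F' : ℍ → ℂ) (C C' : ℤ → ℤ),
        WeaklyHolomorphic.IsFm k N 1 F C → WeaklyHolomorphic.IsFm k N ((p : ℤ) ^ n) F' C' →
        WeaklyHolomorphic.HasQExpansion
          (fun τ ↦ (p : ℂ) ^ ((k - 1) * n) * F' τ + (C ((p : ℤ) ^ n) : ℂ) * g τ)
          (WeaklyHolomorphic.heckeT k (p ^ n) (fun j ↦ (C j : ℂ)))) := by
  have hg0 : IsZeroAtImInfty g :=
    hB.hasQExpansion.isZeroAtImInfty fun n hn ↦ by simp [hB.eq_zero n (by omega)]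
  have hFm {m : ℤ} {F : ℍ → ℂ} {C : ℤ → ℤ} (hF : IsFm k N m F C) : IsSForm k N F :=
    isSForm_iff_memSInfty.2 hF.mem
  refine ⟨hg.toCuspForm hg0, ⟨_, hB.hasQExpansion, by simp [hB.eq_one]⟩, fun h ↦ ?_, fun n hn ↦ ?_,
    fun m hm ↦ ?_, fun p hp hpN n F F' C C' hF hF' ↦ ?_⟩
  · obtain ⟨a, ha⟩ := h.isSForm.exists_hasQExpansion
    have h0 : IsZeroAtImInfty h := by
      have := CuspFormClass.zero_at_infty_slash h 1
      rwa [SlashAction.slash_one] at this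
    refine ⟨a 1, ?_⟩
    have := (h.isSForm.sub (hg.const_mul (a 1))).eq_zero_of_coeff hφ
      (ha.sub (hB.hasQExpansion.const_mul (a 1))) fun n hn ↦ ?_
    · ext τ
      exact sub_eq_zero.1 (congrFun this τ)
    · rcases (show n = 1 ∨ n ≤ 0 by omega) with rfl | hn
      · simp [hB.eq_one]
      · simp [hB.eq_zero n (by omega), ha.coeff_eq_zero_of_isZero h0 hn]
  -- In weight `2 - k = 0` the constant function 1 joins the family and is used to clear the
  -- constant coefficient.
  · set I : Set ℤ := {i | 2 ≤ i ∨ (k = 2 ∧ i = 0)} with hI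
    have hexists : ∀ i ∈ I, ∃ f ∈ mFormSubmodule (2 - k) N, ∃ A, HasIntegralLeading f (-i) A := by
      rintro i (hi | ⟨rfl, rfl⟩)
      · exact hφ i hi
      · exact ⟨_, IsMForm.const 1, _, HasIntegralLeading.one⟩
    obtain ⟨φ, hφV, A, hA, hA'⟩ := exists_reduced (mFormSubmodule (2 - k) N) I (b := 0)
      (fun i hi ↦ by rcases hi with hi | hi <;> omega) hexists n (.inl (by omega))
    refine ⟨φ, A, isMForm_iff_memMInfty.1 hφV, hA.hasQExpansion, hA.eq_one, fun m hm hmn ↦ ?_,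
      fun hk2 ↦ ?_⟩
    · simpa using hA' (-m) (.inl (by omega)) (by omega)
    · simpa using hA' 0 (.inr ⟨hk2, rfl⟩) (by omega)
  · have huniq {F F' : ℍ → ℂ} {C C' : ℤ → ℤ} (hF : IsFm k N m F C) (hF' : IsFm k N m F' C') :
        F = F' := by
      have := ((hFm hF).sub (hFm hF')).eq_zero_of_coeff hφ
        (hF.hasQExpansion.sub hF'.hasQExpansion) fun n hn ↦ ?_
      · exact sub_eq_zero.1 this
      · rcases eq_or_ne n (-m) with rfl | hnm
        · simp [hF.coeff_neg, hF'.coeff_neg]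
        · simp [hF.coeff_eq_zero n hn hnm, hF'.coeff_eq_zero n hn hnm]
    refine existsUnique_of_exists_of_unique ?_ fun F F' ⟨C, hF⟩ ⟨C', hF'⟩ ↦ huniq hF hF'
    -- The index `-1` is the cusp form `g`, which clears the coefficient of `q`. For `k = 2` no form
    -- has order 0, and the constant coefficient vanishes by the residue theorem instead.
    set I : Set ℤ := {i | i = -1 ∨ 1 ≤ i ∨ (k = 4 ∧ i = 0)} with hI
    have hexists : ∀ i ∈ I, ∃ f ∈ sFormSubmodule k N, ∃ A, HasIntegralLeading f (-i) A := by
      rintro i (rfl | hi)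
      · exact ⟨g, hg, B, by simpa using hB⟩
      · exact hψ i hi
    obtain ⟨φ, hφV, A, hA, hA'⟩ := exists_reduced (sFormSubmodule k N) I (b := -1)
      (fun i hi ↦ by rcases hi with hi | hi | hi <;> omega) hexists m hm
    refine ⟨fun τ ↦ (-1 : ℂ) * φ τ, fun n ↦ -A n,
      isSForm_iff_memSInfty.1 (IsSForm.const_mul hφV (-1)),
      (hA.hasQExpansion.const_mul (-1)).congr fun n ↦ by simp, by simp [hA.eq_one],
      fun n hn hnm ↦ ?_⟩
    rw [neg_eq_zero]
    by_cases hnI : -n ∈ I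
    · simpa using hA' (-n) hnI (by omega)
    · simp only [hI, Set.mem_ofPred_eq, not_or, not_and] at hnI
      obtain rfl : n = 0 := by omega
      obtain rfl : k = 2 := hk.resolve_right fun h ↦ hnI.2.2 h (by omega)
      exact_mod_cast IsSForm.coeff_zero hφV hA.hasQExpansion
  · have : NeZero p := ⟨hp.ne_zero⟩
    obtain ⟨H, hH, hHq⟩ := (hFm hF).exists_heckeT hp ((hp.coprime_iff_not_dvd).2 hpN)
      hF.hasQExpansion n
    have hsum := ((hF'.hasQExpansion.const_mul ((p : ℂ) ^ ((k - 1) * n))).add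
      (hB.hasQExpansion.const_mul (C ((p : ℤ) ^ n) : ℂ)))
    -- Both sides lie in `S_k^∞`, so it suffices to compare coefficients of index below 2.
    have := (hH.sub (((hFm hF').const_mul ((p : ℂ) ^ ((k - 1) * n))).add
      (hg.const_mul (C ((p : ℤ) ^ n) : ℂ)))).eq_zero_of_coeff hφ (hHq.sub hsum) fun j hj ↦ ?_
    · convert hHq using 1
      exact (sub_eq_zero.1 this).symm
    · have hpn : (0 : ℤ) < (p : ℤ) ^ n := by have := hp.pos; positivity
      rw [heckeT_prime_pow_of_le_one hp hF.coeff_neg hF.coeff_eq_zero n hj]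
      have hC' : C' j = if j = -(p : ℤ) ^ n then -1 else 0 := by
        split_ifs with h
        · rw [h, hF'.coeff_neg]
        · exact hF'.coeff_eq_zero j hj h
      have hBj : B j = if j = 1 then 1 else 0 := by
        split_ifs with h
        · rw [h, hB.eq_one]
        · exact hB.eq_zero j (by omega)
      rw [hC', hBj]
      split_ifs <;> simp

end DualFamilies

/-! ### Products of Klein forms and their orders at the cusps. -/

/-- The data `u, v, M, L, m` of a power `k(u / M, v / M)(L τ) ^ m` of a Klein form. -/
structure KleinFactor where
  u : ℤ
  v : ℤ
  M : ℕ
  L : ℕ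
  m : ℤ

section KleinProducts

open Filter Topology WeaklyHolomorphic Asymptotics

namespace KleinFactor

/-- The arithmetic conditions on a power of a Klein form for it to be of level dividing `N`. -/
abbrev IsValid (N : ℕ) (x : KleinFactor) : Prop :=
  ¬ ((x.M : ℤ) ∣ x.u ∧ (x.M : ℤ) ∣ x.v) ∧ x.M ∣ N ∧ x.L ∣ N ∧ (x.v = 0 ∨ x.M * x.L ∣ N)

/-- The Klein form underlying `x`. -/
noncomputable def form (x : KleinFactor) : ℍ → ℂ := kleinAt (x.u / x.M) (x.v / x.M) x.L

/-- The exponent of growth of the power of a Klein form at the cusp `a / c`. -/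
def order (x : KleinFactor) (a c : ℤ) : ℚ :=
  let g := Int.gcd x.L c
  let n := (x.u * x.L * a + x.v * c) / g
  x.m * ((n % x.M) * (x.M - n % x.M) : ℤ) * g ^ 2 / (x.M ^ 2 * x.L)

variable {N : ℕ} [NeZero N] {x : KleinFactor}

lemma IsValid.M_pos (h : x.IsValid N) : 0 < x.M := Nat.pos_of_dvd_of_pos h.2.1 (NeZero.pos N)

lemma IsValid.L_pos (h : x.IsValid N) : 0 < x.L := Nat.pos_of_dvd_of_pos h.2.2.1 (NeZero.pos N)

lemma IsValid.ne_int (h : x.IsValid N) (m n : ℤ) (hm : (x.u : ℝ) / x.M = m) :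
    (x.v : ℝ) / x.M ≠ n := by
  intro hn
  have hM : (x.M : ℝ) ≠ 0 := Nat.cast_ne_zero.2 h.M_pos.ne'
  rw [div_eq_iff hM] at hm hn
  exact h.1 ⟨⟨m, by rw [mul_comm]; exact_mod_cast hm⟩, ⟨n, by rw [mul_comm]; exact_mod_cast hn⟩⟩

lemma IsValid.form_ne_zero (h : x.IsValid N) (τ : ℍ) : x.form τ ≠ 0 :=
  kleinAt.ne_zero h.L_pos h.ne_int τ

lemma IsValid.isTheta_slash (h : x.IsValid N) (γ : SL(2, ℤ)) :
    (fun τ ↦ (x.form ∣[(-1 : ℤ)] γ) τ ^ x.m) =Θ[atImInfty]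
      fun τ ↦ Real.exp (Real.pi * (x.order (γ 0 0) (γ 1 0) : ℝ) * τ.im) := by
  refine ((kleinAt.isTheta_slash h.ne_int h.L_pos γ).zpow x.m).trans_eventuallyEq (.of_forall fun τ ↦ ?_)
  dsimp only
  rw [← Real.rpow_intCast, ← Real.exp_mul]
  congr 1
  have hM : (x.M : ℝ) ≠ 0 := Nat.cast_ne_zero.2 h.M_pos.ne'
  have hL : (x.L : ℝ) ≠ 0 := Nat.cast_ne_zero.2 h.L_pos.ne'
  set g := Int.gcd x.L (γ 1 0) with hg
  have hg0 : (g : ℤ) ≠ 0 := by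
    have := h.L_pos
    simp [hg, Int.gcd_eq_zero_iff, this.ne']
  set n := (x.u * x.L * γ 0 0 + x.v * γ 1 0) / (g : ℤ) with hn
  have hgn : (g : ℤ) * n = x.u * x.L * γ 0 0 + x.v * γ 1 0 := by
    refine Int.mul_ediv_cancel' (dvd_add ?_ ?_)
    · exact ((Int.gcd_dvd_left _ _).mul_left _).mul_right _
    · exact (Int.gcd_dvd_right _ _).mul_left _
  have hX : ((x.u : ℝ) / x.M * x.L * γ 0 0 + (x.v : ℝ) / x.M * γ 1 0) / g = n / x.M := by
    have hg1 : (g : ℝ) ≠ 0 := by exact_mod_cast hg0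
    have hgn' : (g : ℝ) * n = x.u * x.L * γ 0 0 + x.v * γ 1 0 := by exact_mod_cast hgn
    field_simp
    linear_combination -hgn'
  rw [hX, Int.fract_div_intCast_eq_div_intCast_mod, order]
  simp only [← hg, ← hn]
  push_cast
  field_simp

/-- Makes the cusp conditions a finite check: the growth exponent depends only on `a` and `c` modulo
`N`. -/
lemma IsValid.order_add (h : x.IsValid N) (a c s t : ℤ) :
    x.order (a + N * s) (c + N * t) = x.order a c := by
  obtain ⟨y, hy⟩ := h.2.2.1
  have hg : Int.gcd x.L (c + N * t) = Int.gcd x.L c := by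
    rw [hy]
    push_cast
    rw [mul_assoc]
    simp
  have hg0 : (Int.gcd x.L c : ℤ) ≠ 0 := by
    have := h.L_pos
    simp [Int.gcd_eq_zero_iff, this.ne']
  obtain ⟨l, hl⟩ : (Int.gcd x.L c : ℤ) ∣ x.L := Int.gcd_dvd_left _ _
  -- The numerator changes by a multiple of `M`. The `u` term needs only `M ∣ N`; the `v` term has
  -- no factor `L` to absorb the gcd, which explains the requirement `v = 0` or `M L ∣ N`.
  obtain ⟨z, hz⟩ : ∃ z, x.u * x.L * (N * s) + x.v * (N * t) = Int.gcd x.L c * (x.M * z) := by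
    obtain ⟨w, hw⟩ := h.2.1
    have hw' : (N : ℤ) = x.M * w := by exact_mod_cast hw
    rcases h.2.2.2 with hv | ⟨w', hw2⟩
    · refine ⟨x.u * l * w * s, ?_⟩
      rw [hv, hw']
      linear_combination x.u * x.M * w * s * hl
    · have hw2' : (N : ℤ) = x.M * x.L * w' := by exact_mod_cast hw2
      refine ⟨x.u * l * w * s + x.v * l * w' * t, ?_⟩
      linear_combination x.u * x.L * s * hw' + x.v * t * hw2' +
        (x.u * x.M * w * s + x.v * x.M * w' * t) * hl
  have hn : (x.u * x.L * (a + N * s) + x.v * (c + N * t)) / (Int.gcd x.L c : ℤ) =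
      (x.u * x.L * a + x.v * c) / (Int.gcd x.L c : ℤ) + x.M * z := by
    rw [← Int.add_mul_ediv_left _ _ hg0, ← hz]
    congr 1
    ring
  simp only [order, hg, hn, Int.add_mul_emod_self_left]

end KleinFactor

/-- A product of powers of Klein forms. -/
noncomputable def kleinProd (l : List KleinFactor) (τ : ℍ) : ℂ :=
  (l.map fun x ↦ x.form τ ^ x.m).prod

/-- The weight of a product of powers of Klein forms. -/
def kleinWeight (l : List KleinFactor) : ℤ := -(l.map fun x ↦ x.m).sum

/-- The exponent of growth of a product of powers of Klein forms at the cusp `a / c`. -/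
def kleinOrder (l : List KleinFactor) (a c : ℤ) : ℚ := (l.map fun x ↦ x.order a c).sum

namespace kleinProd

variable {N : ℕ} [NeZero N] {l : List KleinFactor}

lemma cons (x : KleinFactor) (l : List KleinFactor) (τ : ℍ) :
    kleinProd (x :: l) τ = x.form τ ^ x.m * kleinProd l τ := by
  simp [kleinProd]

lemma mdifferentiable (h : ∀ x ∈ l, x.IsValid N) : MDifferentiable 𝓘(ℂ) 𝓘(ℂ) (kleinProd l) := by
  induction l with
  | nil => exact mdifferentiable_const
  | cons x l ih =>
    have h1 := kleinAt.mdifferentiable (x.u / x.M) (x.v / x.M) (h x (by simp)).L_pos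
    have h2 : MDifferentiable 𝓘(ℂ) 𝓘(ℂ) fun τ ↦ x.form τ ^ x.m := by
      rw [UpperHalfPlane.mdifferentiable_iff] at h1 ⊢
      refine DifferentiableOn.zpow (m := x.m) h1 (.inl fun w hw ↦ ?_)
      exact (h x (by simp)).form_ne_zero _
    have h3 : kleinProd (x :: l) = (fun τ ↦ x.form τ ^ x.m) * kleinProd l := funext (cons x l)
    rw [h3]
    exact h2.mul (ih fun y hy ↦ h y (by simp [hy]))

/-- The automorphy factor of weight `k` splits into powers of the weight `-1` factors, so each Klein
form can be translated separately. -/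
lemma slash_apply {k : ℤ} (hk : kleinWeight l = k) (γ : SL(2, ℤ)) (τ : ℍ) :
    (kleinProd l ∣[k] γ) τ = (l.map fun x ↦ (x.form ∣[(-1 : ℤ)] γ) τ ^ x.m).prod := by
  simp only [SL_slash_apply, neg_neg, zpow_one]
  rw [← hk, kleinWeight, neg_neg]
  have hd := denom_ne_zero γ τ
  induction l generalizing k with
  | nil => simp [kleinProd]
  | cons x l ih =>
    have := ih rfl
    rw [cons, List.map_cons, List.map_cons, List.sum_cons, List.prod_cons, ← this, zpow_add₀ hd,
      mul_zpow]
    ring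

lemma isTheta_slash (h : ∀ x ∈ l, x.IsValid N) {k : ℤ} (hk : kleinWeight l = k) (γ : SL(2, ℤ)) :
    (kleinProd l ∣[k] γ) =Θ[atImInfty]
      fun τ ↦ Real.exp (Real.pi * (kleinOrder l (γ 0 0) (γ 1 0) : ℝ) * τ.im) := by
  rw [funext (slash_apply hk γ)]
  clear hk
  induction l with
  | nil => simp [kleinOrder]
  | cons x l ih =>
    have h1 := ((h x (by simp)).isTheta_slash γ).mul (ih fun y hy ↦ h y (by simp [hy]))
    simp only [List.map_cons, List.prod_cons]
    refine h1.trans_eventuallyEq (.of_forall fun τ ↦ ?_)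
    dsimp only
    rw [← Real.exp_add]
    simp only [kleinOrder, List.map_cons, List.sum_cons]
    push_cast
    ring_nf

lemma growth (h : ∀ x ∈ l, x.IsValid N) :
    ∃ n : ℕ, kleinProd l =O[atImInfty] fun τ ↦ Real.exp (2 * Real.pi * n * τ.im) := by
  have h1 := isTheta_slash h rfl 1
  rw [SlashAction.slash_one] at h1
  obtain ⟨n, hn⟩ := exists_nat_ge (kleinOrder l ((1 : SL(2, ℤ)) 0 0) ((1 : SL(2, ℤ)) 1 0) : ℝ)
  refine ⟨n, h1.isBigO.trans (IsBigO.of_bound 1 (.of_forall fun τ ↦ ?_))⟩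
  rw [Real.norm_eq_abs, Real.norm_eq_abs, Real.abs_exp, Real.abs_exp, one_mul]
  have h2 := τ.im_pos
  have h3 := Real.pi_pos
  refine Real.exp_le_exp.2 (mul_le_mul_of_nonneg_right ?_ h2.le)
  have h4 : (0 : ℝ) ≤ n := n.cast_nonneg
  nlinarith

lemma kleinOrder_add (h : ∀ x ∈ l, x.IsValid N) (a c s t : ℤ) :
    kleinOrder l (a + N * s) (c + N * t) = kleinOrder l a c := by
  rw [kleinOrder, kleinOrder]
  exact congrArg List.sum (List.map_congr_left fun x hx ↦ (h x hx).order_add a c s t)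

/-- Every pair `a, c` coming from a cusp other than `∞` may be reduced modulo `N`. -/
lemma exists_reduced_cusp (h : ∀ x ∈ l, x.IsValid N) {γ : SL(2, ℤ)} (hγ : ¬ (N : ℤ) ∣ γ 1 0) :
    ∃ a < N, ∃ c < N, c ≠ 0 ∧ (a.gcd c).gcd N = 1 ∧
      kleinOrder l (γ 0 0) (γ 1 0) = kleinOrder l (a : ℕ) (c : ℕ) := by
  have hN : (0 : ℤ) < N := by exact_mod_cast NeZero.pos N
  have hmod (z : ℤ) : ∃ w : ℕ, w < N ∧ z = w + N * (z / N) := by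
    refine ⟨(z % N).toNat, ?_, ?_⟩
    · have := Int.emod_lt_of_pos z hN
      have := Int.emod_nonneg z hN.ne'
      omega
    · rw [Int.toNat_of_nonneg (Int.emod_nonneg z hN.ne'), Int.emod_add_mul_ediv]
  obtain ⟨a, haN, ha⟩ := hmod (γ 0 0)
  obtain ⟨c, hcN, hc⟩ := hmod (γ 1 0)
  refine ⟨a, haN, c, hcN, ?_, ?_, ?_⟩
  · rintro rfl
    exact hγ ⟨_, by simpa using hc⟩
  · set d := (a.gcd c).gcd N with hd
    have hdN : (d : ℤ) ∣ N := Int.natCast_dvd_natCast.2 (Nat.gcd_dvd_right _ _)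
    have hda : (d : ℤ) ∣ a :=
      Int.natCast_dvd_natCast.2 ((Nat.gcd_dvd_left _ _).trans (Nat.gcd_dvd_left _ _))
    have hdc : (d : ℤ) ∣ c :=
      Int.natCast_dvd_natCast.2 ((Nat.gcd_dvd_left _ _).trans (Nat.gcd_dvd_right _ _))
    have h1 : (d : ℤ) ∣ γ 0 0 := ha ▸ dvd_add hda (hdN.mul_right _)
    have h2 : (d : ℤ) ∣ γ 1 0 := hc ▸ dvd_add hdc (hdN.mul_right _)
    have hdet := γ.det_coe
    rw [Matrix.det_fin_two] at hdet
    have h3 : (d : ℤ) ∣ 1 := hdet ▸ dvd_sub (h1.mul_right _) (h2.mul_left _)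
    exact_mod_cast Int.eq_one_of_dvd_one (by positivity) h3
  · conv_lhs => rw [ha, hc]
    exact kleinOrder_add h _ _ _ _

/-- A criterion for holomorphy at the cusps other than `∞`. -/
theorem isBounded_slash (h : ∀ x ∈ l, x.IsValid N) {k : ℤ} (hk : kleinWeight l = k)
    (hl : ∀ a < N, ∀ c < N, c ≠ 0 → (a.gcd c).gcd N = 1 → kleinOrder l (a : ℕ) (c : ℕ) ≤ 0)
    {γ : SL(2, ℤ)} (hγ : ¬ (N : ℤ) ∣ γ 1 0) : IsBoundedAtImInfty (kleinProd l ∣[k] γ) := by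
  obtain ⟨a, ha, c, hc, hc0, hac, hac'⟩ := exists_reduced_cusp h hγ
  have h1 : ((kleinOrder l (a : ℕ) (c : ℕ) : ℚ) : ℝ) ≤ 0 := by exact_mod_cast hl a ha c hc hc0 hac
  refine (isTheta_slash h hk γ).isBigO.trans (IsBigO.of_bound 1 (.of_forall fun τ ↦ ?_))
  rw [Real.norm_eq_abs, Real.abs_exp, hac', Pi.one_apply, norm_one, one_mul, Real.exp_le_one_iff]
  have h2 := τ.im_pos
  have h3 := Real.pi_pos
  exact mul_nonpos_of_nonpos_of_nonneg (mul_nonpos_of_nonneg_of_nonpos h3.le h1) h2.le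

/-- A criterion for vanishing at the cusps other than `∞`. -/
theorem isZero_slash (h : ∀ x ∈ l, x.IsValid N) {k : ℤ} (hk : kleinWeight l = k)
    (hl : ∀ a < N, ∀ c < N, c ≠ 0 → (a.gcd c).gcd N = 1 → kleinOrder l (a : ℕ) (c : ℕ) < 0)
    {γ : SL(2, ℤ)} (hγ : ¬ (N : ℤ) ∣ γ 1 0) : IsZeroAtImInfty (kleinProd l ∣[k] γ) := by
  obtain ⟨a, ha, c, hc, hc0, hac, hac'⟩ := exists_reduced_cusp h hγ
  have h1 : ((kleinOrder l (a : ℕ) (c : ℕ) : ℚ) : ℝ) < 0 := by exact_mod_cast hl a ha c hc hc0 hac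
  refine (isTheta_slash h hk γ).isBigO.trans_tendsto ?_
  rw [hac']
  have h2 : Tendsto (fun y : ℝ ↦ Real.exp (Real.pi * ((kleinOrder l (a : ℕ) (c : ℕ) : ℚ) : ℝ) * y))
      atTop (𝓝 0) :=
    Real.tendsto_exp_atBot.comp
      (tendsto_id.const_mul_atTop_of_neg (mul_neg_of_pos_of_neg Real.pi_pos h1))
  exact h2.comp tendsto_comap

/-- Products of Klein forms in `M_k^∞(Γ₀(N))`. -/
theorem isMForm (h : ∀ x ∈ l, x.IsValid N) {k : ℤ} (hk : kleinWeight l = k)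
    (hl : ∀ a < N, ∀ c < N, c ≠ 0 → (a.gcd c).gcd N = 1 → kleinOrder l (a : ℕ) (c : ℕ) ≤ 0)
    (hinv : ∀ γ : SL(2, ℤ), (N : ℤ) ∣ γ 1 0 → kleinProd l ∣[k] γ = kleinProd l) :
    IsMForm k N (kleinProd l) :=
  ⟨mdifferentiable h, hinv, growth h, fun _ hγ ↦ isBounded_slash h hk hl hγ⟩

/-- Products of Klein forms in `S_k^∞(Γ₀(N))`. -/
theorem isSForm (h : ∀ x ∈ l, x.IsValid N) {k : ℤ} (hk : kleinWeight l = k)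
    (hl : ∀ a < N, ∀ c < N, c ≠ 0 → (a.gcd c).gcd N = 1 → kleinOrder l (a : ℕ) (c : ℕ) < 0)
    (hinv : ∀ γ : SL(2, ℤ), (N : ℤ) ∣ γ 1 0 → kleinProd l ∣[k] γ = kleinProd l) :
    IsSForm k N (kleinProd l) :=
  ⟨mdifferentiable h, hinv, growth h, fun _ hγ ↦ isZero_slash h hk hl hγ⟩

end kleinProd

end KleinProducts

/-! ### Integral q-expansions of Klein forms. -/

section UnitExpansions

open WeaklyHolomorphic

lemma HasPowerSeries.comp_pow {u : ℂ → ℂ} {P : PowerSeries ℂ} (h : HasPowerSeries u P) {d : ℕ}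
    (hd : 0 < d) : HasPowerSeries (fun q ↦ u (q ^ d))
      (.mk fun n ↦ if d ∣ n then P.coeff (n / d) else 0) := by
  intro q hq
  have hinj : Function.Injective fun n : ℕ ↦ d * n := mul_right_injective₀ hd.ne'
  have hqd : ‖q ^ d‖ < 1 := by
    rw [norm_pow]
    exact pow_lt_one₀ (norm_nonneg _) hq hd.ne'
  rw [← hinj.hasSum_iff]
  · refine (h _ hqd).congr_fun fun n ↦ ?_
    simp [hd.ne', pow_mul]
  · intro n hn
    rw [PowerSeries.coeff_mk, if_neg, zero_mul]
    rintro ⟨m, rfl⟩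
    exact hn ⟨m, rfl⟩

/-- `f(τ) = κ exp(π i ρ τ) U(q ^ d)`, where `U` is a power series with integer coefficients, constant term
`1` and no zeros in the unit disc. -/
def HasUnitExpansion (d : ℕ) (f : ℍ → ℂ) (κ : ℂ) (ρ : ℝ) : Prop :=
  ∃ U, IsUnitSeries U ∧
    ∀ τ : ℍ, f τ = κ * Complex.exp (Real.pi * Complex.I * ρ * τ) * U (expTwoPi τ ^ d)

namespace HasUnitExpansion

variable {d : ℕ} {f g : ℍ → ℂ} {κ κ' : ℂ} {ρ ρ' : ℝ}

lemma one : HasUnitExpansion d (fun _ ↦ 1) 1 0 := ⟨_, IsUnitSeries.one, fun τ ↦ by simp⟩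

lemma mul (hf : HasUnitExpansion d f κ ρ) (hg : HasUnitExpansion d g κ' ρ') :
    HasUnitExpansion d (fun τ ↦ f τ * g τ) (κ * κ') (ρ + ρ') := by
  obtain ⟨U, hU, hfU⟩ := hf
  obtain ⟨V, hV, hgV⟩ := hg
  refine ⟨_, hU.mul hV, fun τ ↦ ?_⟩
  dsimp only
  rw [hfU, hgV, show (Real.pi * Complex.I * ((ρ + ρ' : ℝ) : ℂ) * τ : ℂ) =
    Real.pi * Complex.I * ρ * τ + Real.pi * Complex.I * ρ' * τ by push_cast; ring, Complex.exp_add]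
  ring

lemma zpow (hf : HasUnitExpansion d f κ ρ) (m : ℤ) :
    HasUnitExpansion d (fun τ ↦ f τ ^ m) (κ ^ m) (m * ρ) := by
  obtain ⟨U, hU, hfU⟩ := hf
  refine ⟨_, hU.zpow m, fun τ ↦ ?_⟩
  dsimp only
  rw [hfU, mul_zpow, mul_zpow, ← Complex.exp_int_mul]
  push_cast
  ring_nf

lemma const_mul (hf : HasUnitExpansion d f κ ρ) (c : ℂ) :
    HasUnitExpansion d (fun τ ↦ c * f τ) (c * κ) ρ := by
  obtain ⟨U, hU, hfU⟩ := hf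
  exact ⟨U, hU, fun τ ↦ by dsimp only; rw [hfU]; ring⟩

lemma hasIntegralLeading (hd : 0 < d) (hf : HasUnitExpansion d f 1 ρ) {n : ℤ} (hn : ρ = 2 * n) :
    ∃ A, HasIntegralLeading f n A ∧ ∀ j, A j ≠ 0 → (d : ℤ) ∣ j - n := by
  obtain ⟨U, hU, hfU⟩ := hf
  obtain ⟨P, hP⟩ := hU.series
  have h := HasQExpansion.of_hasPowerSeries (f := f) (hP.comp_pow hd) (m := n) fun τ ↦ by
    rw [hfU, ← expTwoPi.int_mul, one_mul, expTwoPi.eq_1 (n * τ), hn]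
    push_cast
    ring_nf
  refine ⟨fun j ↦ if n ≤ j then if d ∣ (j - n).toNat then P.coeff ((j - n).toNat / d) else 0 else 0,
    ⟨h.congr fun j ↦ ?_, fun j hj ↦ if_neg (not_le.2 hj), ?_⟩, fun j hj ↦ ?_⟩
  · rw [PowerSeries.coeff_mk]
    split_ifs <;> simp
  · have h1 := hP.apply_zero
    rw [hU.apply_zero, ← PowerSeries.coeff_zero_eq_constantCoeff_apply, PowerSeries.coeff_map,
      eq_intCast] at h1
    simp only [le_refl, if_true, sub_self, Int.toNat_zero, dvd_zero, Nat.zero_div]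
    exact_mod_cast h1.symm
  · dsimp only at hj
    split_ifs at hj with h1 h2
    · rw [← Int.toNat_of_nonneg (sub_nonneg.2 h1)]
      exact Int.natCast_dvd_natCast.2 h2
    all_goals exact absurd rfl hj

end HasUnitExpansion

/-- The constant in the Fourier expansion of a Klein form. -/
noncomputable def kleinConst : ℂ := -(2 * Real.pi * Complex.I)⁻¹

lemma kleinConst_ne_zero : kleinConst ≠ 0 := neg_ne_zero.2 (inv_ne_zero Complex.two_pi_I_ne_zero)

/-- With second characteristic 0 and argument `M d h τ`, every variable in the q-products is an
integral power of `q ^ d`, with exponents `j h`, `M h - j h` and `M h`; no roots of unity occur. -/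
lemma kleinAt.hasUnitExpansion {j M h d : ℕ} (hj : 0 < j) (hjM : j < M) (hh : 0 < h) :
    HasUnitExpansion d (kleinAt (j / M) 0 (M * d * h)) kleinConst (-(j * (M - j) * (d * h) / M)) := by
  have hM : (M : ℂ) ≠ 0 := by
    have : M ≠ 0 := by omega
    exact_mod_cast this
  have hlt : j * h < M * h := Nat.mul_lt_mul_of_pos_right hjM hh
  have hL : 0 < M * h := Nat.mul_pos (by omega) hh
  refine ⟨_, ((IsUnitSeries.qPochhammer (e := j * h) (Nat.mul_pos hj hh) hL).mul
    (IsUnitSeries.qPochhammer (e := M * h - j * h) (by omega) hL)).mul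
    ((IsUnitSeries.qPochhammer hL hL).pow 2).inv, fun τ ↦ ?_⟩
  have h1 : ((j / M : ℝ) : ℂ) * ((M * d * h : ℕ) * τ) + (0 : ℝ) = (d * (j * h) : ℕ) * τ := by
    push_cast
    field_simp
    ring
  have h2 : ((M * d * h : ℕ) * τ - (d * (j * h) : ℕ) * τ : ℂ) =
      ((d * (M * h - j * h) : ℕ) : ℂ) * τ := by
    rw [Nat.cast_mul d (M * h - j * h), Nat.cast_sub hlt.le]
    push_cast
    ring
  have h2' : M * d * h = d * (M * h) := by ring
  rw [kleinAt, kleinForm, kleinSigma, h1, h2, expTwoPi.nat_mul, expTwoPi.nat_mul, expTwoPi.nat_mul,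
    kleinConst, h2', pow_mul, pow_mul, pow_mul]
  have h3 : Complex.exp (Real.pi * Complex.I * ((-(j * (M - j) * (d * h) / M) : ℝ) : ℂ) * τ) =
      Complex.exp (Real.pi * Complex.I * (((j / M : ℝ) : ℂ) * ((d * (j * h) : ℕ) * τ))) *
        Complex.exp (-(Real.pi * Complex.I * ((d * (j * h) : ℕ) * τ))) := by
    rw [← Complex.exp_add]
    congr 1
    push_cast
    field_simp
    ring
  rw [h3]
  ring_nf

lemma kleinAt.add_mul_left (r : ℝ) (n : ℤ) {L : ℕ} (hL : 0 < L) (τ : ℍ) :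
    kleinAt (r + n) 0 L τ = (-1) ^ n * kleinAt r 0 L τ := by
  rw [kleinAt, kleinForm.add_int_left _ _ _ (im_pos hL τ), ← kleinAt]
  congr 1
  rw [← Complex.exp_pi_mul_I, ← Complex.exp_int_mul]
  push_cast
  ring_nf

/-- The product formula behind the Fourier expansion of `k(0, 1 / 3)`. -/
lemma qPochhammer.mul_mul_eq_cube {w q : ℂ} (hw : w ^ 2 + w + 1 = 0) (hq : ‖q‖ < 1) :
    qPochhammer (w * q) q * qPochhammer (w ^ 2 * q) q * qPochhammer q q =
      qPochhammer (q ^ 3) (q ^ 3) := by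
  rw [qPochhammer, qPochhammer, qPochhammer, qPochhammer,
    ← (multipliable _ hq).tprod_mul (multipliable _ hq),
    ← ((multipliable _ hq).mul (multipliable _ hq)).tprod_mul (multipliable _ hq)]
  refine tprod_congr fun n ↦ ?_
  have hw3 : w ^ 3 = 1 := by linear_combination (w - 1) * hw
  rw [← pow_mul, mul_comm 3 n, pow_mul]
  linear_combination (-(q * q ^ n) + w * (q * q ^ n) ^ 2) * hw - (q * q ^ n) ^ 3 * hw3

/-- The product formula behind the Fourier expansion of `k(0, 1 / 2)`. -/
lemma qPochhammer.mul_eq_sq {q : ℂ} (hq : ‖q‖ < 1) :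
    qPochhammer (-q) q * qPochhammer q q = qPochhammer (q ^ 2) (q ^ 2) := by
  rw [qPochhammer, qPochhammer, qPochhammer, ← (multipliable _ hq).tprod_mul (multipliable _ hq)]
  refine tprod_congr fun n ↦ ?_
  rw [← pow_mul, mul_comm 2 n, pow_mul]
  ring

lemma expTwoPi.norm_pow_lt_one (τ : ℍ) {L : ℕ} (hL : 0 < L) : ‖expTwoPi τ ^ L‖ < 1 := by
  rw [norm_pow]
  exact pow_lt_one₀ (norm_nonneg _) (expTwoPi.norm_lt_one τ.im_pos) hL.ne'

/-- The q-products twisted by the two primitive cube roots of unity combine into an integral one: up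
to a constant this Klein form is the eta quotient `η(3 L τ) / η(L τ) ^ 3`. -/
lemma kleinAt.hasUnitExpansion_third {L : ℕ} (hL : 0 < L) :
    ∃ κ ≠ 0, HasUnitExpansion 1 (kleinAt 0 (1 / 3) L) κ 0 := by
  set w := expTwoPi (1 / 3) with hw
  have hw1 : w ≠ 1 := by
    rw [hw, Ne, expTwoPi.eq_one_iff]
    rintro ⟨n, hn⟩
    have h1 : (1 : ℂ) = ((3 * n : ℤ) : ℂ) := by push_cast; linear_combination 3 * hn
    have h2 : (1 : ℤ) = 3 * n := by exact_mod_cast h1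
    omega
  have hw3 : w ^ 3 = 1 := by
    rw [hw, ← expTwoPi.nat_mul, expTwoPi.eq_one_iff]
    exact ⟨1, by norm_num⟩
  have hw2 : w ^ 2 + w + 1 = 0 := by
    refine (mul_eq_zero.1 (?_ : (w - 1) * (w ^ 2 + w + 1) = 0)).resolve_left (sub_ne_zero.2 hw1)
    linear_combination hw3
  have hw0 : w ≠ 0 := expTwoPi.ne_zero _
  have hL3 : 0 < 3 * L := by positivity
  refine ⟨-(Complex.exp (-(Real.pi * Complex.I * (1 / 3))) / (2 * Real.pi * Complex.I)) * (1 - w), ?_, _,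
    (IsUnitSeries.qPochhammer hL3 hL3).mul ((IsUnitSeries.qPochhammer hL hL).pow 3).inv,
    fun τ ↦ ?_⟩
  · exact mul_ne_zero (neg_ne_zero.2 (div_ne_zero (Complex.exp_ne_zero _) Complex.two_pi_I_ne_zero))
      (sub_ne_zero.2 hw1.symm)
  · rw [pow_one (expTwoPi τ)]
    have hq := expTwoPi.norm_pow_lt_one τ hL
    have h0 := qPochhammer.self_ne_zero hq
    have h1 : ((0 : ℝ) : ℂ) * ((L : ℂ) * τ) + ((1 / 3 : ℝ) : ℂ) = 1 / 3 := by push_cast; ring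
    have h2 : expTwoPi τ ^ L / w = w ^ 2 * expTwoPi τ ^ L := by
      field_simp
      rw [hw3, mul_one]
    rw [kleinAt, kleinForm, kleinSigma, h1, expTwoPi.sub, expTwoPi.nat_mul, ← hw, h2,
      qPochhammer.eq_mul w hq, mul_comm 3 L, pow_mul, ← qPochhammer.mul_mul_eq_cube hw2 hq]
    simp only [Complex.ofReal_zero, zero_mul, mul_zero, Complex.exp_zero, one_mul, mul_one]
    field_simp

/-- Up to a constant this is the eta quotient `η(2 L τ) ^ 2 / η(L τ) ^ 4`. -/
lemma kleinAt.hasUnitExpansion_half {L : ℕ} (hL : 0 < L) :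
    ∃ κ ≠ 0, HasUnitExpansion 1 (kleinAt 0 (1 / 2) L) κ 0 := by
  have hw : expTwoPi (1 / 2) = -1 := by
    rw [expTwoPi, show 2 * Real.pi * Complex.I * (1 / 2) = Real.pi * Complex.I by ring,
      Complex.exp_pi_mul_I]
  have hL2 : 0 < 2 * L := by positivity
  refine ⟨-(Complex.exp (-(Real.pi * Complex.I * (1 / 2))) / (2 * Real.pi * Complex.I)) * 2, ?_, _,
    ((IsUnitSeries.qPochhammer hL2 hL2).pow 2).mul ((IsUnitSeries.qPochhammer hL hL).pow 4).inv,
    fun τ ↦ ?_⟩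
  · exact mul_ne_zero (neg_ne_zero.2 (div_ne_zero (Complex.exp_ne_zero _) Complex.two_pi_I_ne_zero))
      two_ne_zero
  · rw [pow_one (expTwoPi τ)]
    have hq := expTwoPi.norm_pow_lt_one τ hL
    have h0 := qPochhammer.self_ne_zero hq
    have h1 : ((0 : ℝ) : ℂ) * ((L : ℂ) * τ) + ((1 / 2 : ℝ) : ℂ) = 1 / 2 := by push_cast; ring
    rw [kleinAt, kleinForm, kleinSigma, h1, expTwoPi.sub, expTwoPi.nat_mul, hw,
      qPochhammer.eq_mul (-1) hq, mul_comm 2 L, pow_mul, ← qPochhammer.mul_eq_sq hq, div_neg, div_one,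
      neg_one_mul]
    simp only [Complex.ofReal_zero, zero_mul, mul_zero, Complex.exp_zero, one_mul, mul_one]
    field_simp
    ring

namespace KleinFactor

variable {N : ℕ} [NeZero N] {x : KleinFactor}

lemma IsValid.order_one_zero (h : x.IsValid N) :
    x.order 1 0 = x.m * ((x.u % x.M) * (x.M - x.u % x.M) : ℤ) * x.L / x.M ^ 2 := by
  have hM : (x.M : ℚ) ≠ 0 := Nat.cast_ne_zero.2 h.M_pos.ne'
  have hL : (x.L : ℚ) ≠ 0 := Nat.cast_ne_zero.2 h.L_pos.ne'
  have hL' : (x.L : ℤ) ≠ 0 := by exact_mod_cast hL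
  simp only [order, Int.gcd_zero_right, Int.natAbs_natCast, mul_one, mul_zero, add_zero,
    Int.mul_ediv_cancel _ hL']
  field_simp

/-- The Fourier expansion of `k(u / M, 0)(L τ)`. -/
lemma IsValid.hasUnitExpansion (h : x.IsValid N) (hv : x.v = 0) {d : ℕ} (hML : x.M * d ∣ x.L) :
    HasUnitExpansion d (fun τ ↦ x.form τ ^ x.m) ((kleinConst * (-1) ^ (x.u / x.M)) ^ x.m)
      (-(x.order 1 0 : ℝ)) := by
  obtain ⟨l, hl⟩ := hML
  have hM := h.M_pos
  have hM0 : (x.M : ℤ) ≠ 0 := by omega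
  have hM1 : (x.M : ℝ) ≠ 0 := by exact_mod_cast hM0
  have hl0 : 0 < l := Nat.pos_of_mul_pos_left (hl ▸ h.L_pos)
  obtain ⟨j, hj⟩ := Int.eq_ofNat_of_zero_le (Int.emod_nonneg x.u hM0)
  have hj0 : 0 < j := by
    rcases Nat.eq_zero_or_pos j with rfl | hpos
    · exact absurd ⟨Int.dvd_of_emod_eq_zero hj, hv ▸ dvd_zero _⟩ h.1
    · exact hpos
  have hjM : j < x.M := by
    have := Int.emod_lt_of_pos x.u (show (0 : ℤ) < x.M by omega)
    omega
  have h1 : x.form = fun τ ↦ (-1) ^ (x.u / x.M) * kleinAt (j / x.M) 0 (x.M * d * l) τ := by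
    ext τ
    rw [← kleinAt.add_mul_left _ _ (hl ▸ h.L_pos), form, hv, ← hl]
    congr 1
    · have h2 : (x.u : ℝ) = j + x.M * ((x.u / x.M : ℤ) : ℝ) := by
        have := Int.emod_add_mul_ediv x.u x.M
        rw [hj] at this
        exact_mod_cast this.symm
      field_simp
      linear_combination h2
    · simp
  rw [h1]
  have h2 := ((kleinAt.hasUnitExpansion (d := d) hj0 hjM hl0).const_mul ((-1) ^ (x.u / x.M))).zpow x.m
  rw [mul_comm kleinConst]
  convert h2 using 1
  rw [h.order_one_zero, hj, hl]
  push_cast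
  field_simp

end KleinFactor

end UnitExpansions

/-! ### Galois-conjugate products of Klein forms under `Γ₀(N)`. -/

section KleinFamilies

open WeaklyHolomorphic

lemma Complex.exp_pi_I_mul_int_mul_two (n : ℤ) :
    Complex.exp (Real.pi * Complex.I * (2 * n)) = 1 := by
  rw [Complex.exp_eq_one_iff]
  exact ⟨n, by ring⟩

namespace kleinProd

variable {N : ℕ} [NeZero N] {l : List KleinFactor}

lemma hasUnitExpansion {d : ℕ} (κ : KleinFactor → ℂ) (h : ∀ x ∈ l,
    HasUnitExpansion d (fun τ ↦ x.form τ ^ x.m) (κ x ^ x.m) (-(x.order 1 0 : ℝ))) :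
    HasUnitExpansion d (kleinProd l) (l.map fun x ↦ κ x ^ x.m).prod (-(kleinOrder l 1 0 : ℝ)) := by
  induction l with
  | nil =>
    have h1 : kleinProd [] = fun _ ↦ 1 := funext fun τ ↦ by simp [kleinProd]
    rw [h1]
    simpa [kleinOrder] using HasUnitExpansion.one
  | cons x l ih =>
    have h1 := (h x (by simp)).mul (ih fun y hy ↦ h y (by simp [hy]))
    rw [funext (cons x l)]
    rw [List.map_cons, List.prod_cons]
    convert h1 using 1
    simp only [kleinOrder, List.map_cons, List.sum_cons]
    push_cast
    ring

/-- The leading coefficients of the Fourier expansions of products of forms `k(u / M, 0)(L τ)`. -/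
theorem hasIntegralLeading (h : ∀ x ∈ l, x.IsValid N) {d : ℕ} (hd : 0 < d)
    (hv : ∀ x ∈ l, x.v = 0 ∧ x.M * d ∣ x.L) {n : ℤ}
    (hn : kleinOrder l 1 0 = -(2 * n)) {ε : ℤ}
    (hε : Even (l.map fun x : KleinFactor ↦ x.u / x.M * x.m).sum ∧ ε = 1 ∨
      Odd (l.map fun x : KleinFactor ↦ x.u / x.M * x.m).sum ∧ ε = -1) :
    ∃ A, HasIntegralLeading (fun τ ↦ kleinConst ^ kleinWeight l * ε * kleinProd l τ) n A ∧
      ∀ j, A j ≠ 0 → (d : ℤ) ∣ j - n := by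
  have h1 := hasUnitExpansion (fun x ↦ kleinConst * (-1) ^ (x.u / x.M)) fun x hx ↦
    (h x hx).hasUnitExpansion (hv x hx).1 (hv x hx).2
  have h2 : (l.map fun x : KleinFactor ↦ (kleinConst * (-1) ^ (x.u / x.M)) ^ x.m).prod =
      kleinConst ^ (-kleinWeight l) * (-1) ^ (l.map fun x : KleinFactor ↦ x.u / x.M * x.m).sum := by
    clear h hv hn hε h1
    induction l with
    | nil => simp [kleinWeight]
    | cons x l ih =>
      rw [List.map_cons, List.prod_cons, ih, kleinWeight, kleinWeight, neg_neg, neg_neg,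
        List.map_cons, List.sum_cons, List.map_cons, List.sum_cons,
        zpow_add₀ kleinConst_ne_zero, zpow_add₀ (by norm_num), mul_zpow, zpow_mul]
      ring
  have h3 : ((-1 : ℂ) ^ (l.map fun x : KleinFactor ↦ x.u / x.M * x.m).sum) = ε := by
    rcases hε with ⟨h, rfl⟩ | ⟨h, rfl⟩
    · simp [h.neg_one_zpow]
    · simp [h.neg_one_zpow]
  have h4 : (ε : ℂ) * ε = 1 := by
    rcases hε with ⟨-, rfl⟩ | ⟨-, rfl⟩ <;> norm_num
  rw [h2, h3, hn] at h1
  have h5 := h1.const_mul (kleinConst ^ kleinWeight l * ε)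
  have h6 : kleinConst ^ kleinWeight l * ε * (kleinConst ^ (-kleinWeight l) * ε) = 1 := by
    rw [mul_mul_mul_comm, ← zpow_add₀ kleinConst_ne_zero, add_neg_cancel, zpow_zero, h4, one_mul]
  rw [h6] at h5
  exact h5.hasIntegralLeading hd (by push_cast; ring)

end kleinProd

/-- The products of the functions `k(j i / M, 0)(L τ) ^ m`, for `(j, m)` in a list. -/
def kleinFamily (M L : ℕ) (base : List (ℤ × ℤ)) (i : ℤ) : List KleinFactor :=
  base.map fun p ↦ ⟨p.1 * i, 0, M, L, p.2⟩

namespace kleinFamily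

variable {M L : ℕ} {base : List (ℤ × ℤ)}

lemma cons (M L : ℕ) (p : ℤ × ℤ) (base : List (ℤ × ℤ)) (i : ℤ) :
    kleinFamily M L (p :: base) i = ⟨p.1 * i, 0, M, L, p.2⟩ :: kleinFamily M L base i :=
  rfl

/-- The characteristic `(j / M, 0)` becomes `(j a / M, j h b)`, where `a` and `b` form the top row
of `γ`. Removing the integral second component costs the root of unity. -/
lemma form_slash (hM : 0 < M) {h : ℕ} (hh : 0 < h) (hL : L = M * h) (j m : ℤ) {γ : SL(2, ℤ)}
    (hγ : (L : ℤ) ∣ γ 1 0) (τ : ℍ) :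
    ((KleinFactor.mk j 0 M L m).form ∣[(-1 : ℤ)] γ) τ =
      Complex.exp (Real.pi * Complex.I * (j * h * γ 0 1 * (1 + j * γ 0 0 / M))) *
        (KleinFactor.mk (j * γ 0 0) 0 M L m).form τ := by
  obtain ⟨c, hc⟩ := hγ
  have hL0 : 0 < L := by rw [hL]; positivity
  have hM0 : (M : ℝ) ≠ 0 := by exact_mod_cast hM.ne'
  rw [SL_slash_apply, neg_neg, zpow_one, KleinFactor.form, KleinFactor.form,
    kleinAt.smul_eq _ _ hL0 γ hc, mul_comm _ (denom _ _), mul_inv_cancel_left₀ (denom_ne_zero γ τ)]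
  have h1 : (j / M : ℝ) * γ 0 0 + ((0 : ℤ) / M : ℝ) * c = (j * γ 0 0 : ℤ) / M := by
    push_cast
    ring
  have h2 : (j / M : ℝ) * (L * γ 0 1) + ((0 : ℤ) / M : ℝ) * γ 1 1 =
      (0 : ℤ) / M + ((j * h * γ 0 1 : ℤ) : ℝ) := by
    rw [hL]
    push_cast
    field_simp
    ring
  rw [h1, h2, kleinAt, kleinForm.add_int_right, ← kleinAt]
  push_cast
  ring_nf

/-- The total phase involves the base only through a linear and a quadratic moment of the
characteristics; these are the congruence conditions imposed in `kleinFamily.slash`. -/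
lemma slash_apply (hM : 0 < M) {h : ℕ} (hh : 0 < h) (hL : L = M * h) (i : ℤ) {γ : SL(2, ℤ)}
    (hγ : (L : ℤ) ∣ γ 1 0) (τ : ℍ) :
    ((kleinFamily M L base i).map fun x ↦ (x.form ∣[(-1 : ℤ)] γ) τ ^ x.m).prod =
      Complex.exp (Real.pi * Complex.I * (i * γ 0 1 * (h * (base.map fun p ↦ p.1 * p.2).sum : ℤ) +
        i ^ 2 * γ 0 0 * γ 0 1 * ((h * (base.map fun p ↦ p.1 ^ 2 * p.2).sum : ℤ) / M))) *
        kleinProd (kleinFamily M L base (i * γ 0 0)) τ := by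
  induction base with
  | nil => simp [kleinFamily, kleinProd]
  | cons p base ih =>
    rw [cons, cons, List.map_cons, List.prod_cons, ih, form_slash hM hh hL _ _ hγ, kleinProd.cons,
      mul_zpow, ← Complex.exp_int_mul, mul_mul_mul_comm, ← Complex.exp_add, ← mul_assoc p.1]
    congr 2
    simp only [List.map_cons, List.sum_cons]
    push_cast
    ring

/-- The action of `Γ₀(N)` on a family of products of Klein forms. -/
theorem slash (hM : 0 < M) {h : ℕ} (hh : 0 < h) (hL : L = M * h)
    (h1 : 2 ∣ h * (base.map fun p ↦ p.1 * p.2).sum)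
    (h2 : 2 * (M : ℤ) ∣ h * (base.map fun p ↦ p.1 ^ 2 * p.2).sum) {i k : ℤ}
    (hk : kleinWeight (kleinFamily M L base i) = k) {γ : SL(2, ℤ)} (hγ : (L : ℤ) ∣ γ 1 0) :
    kleinProd (kleinFamily M L base i) ∣[k] γ = kleinProd (kleinFamily M L base (i * γ 0 0)) := by
  ext τ
  obtain ⟨s, hs⟩ := h1
  obtain ⟨t, ht⟩ := h2
  have hM0 : (M : ℂ) ≠ 0 := by exact_mod_cast hM.ne'
  rw [kleinProd.slash_apply hk, slash_apply hM hh hL i hγ, hs, ht]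
  have h3 : (i * γ 0 1 * ((2 * s : ℤ) : ℂ) +
      i ^ 2 * γ 0 0 * γ 0 1 * (((2 * M * t : ℤ) : ℂ) / M)) =
      2 * ((i * γ 0 1 * s + i ^ 2 * γ 0 0 * γ 0 1 * t : ℤ) : ℂ) := by
    push_cast
    field_simp
  rw [h3, Complex.exp_pi_I_mul_int_mul_two, one_mul]

lemma form_add (hM : 0 < M) (hL : 0 < L) (u n m : ℤ) (τ : ℍ) :
    (KleinFactor.mk (u + M * n) 0 M L m).form τ = (-1) ^ n * (KleinFactor.mk u 0 M L m).form τ := by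
  have hM0 : (M : ℝ) ≠ 0 := by exact_mod_cast hM.ne'
  rw [KleinFactor.form, KleinFactor.form]
  have h1 : ((u + M * n : ℤ) / M : ℝ) = u / M + n := by
    push_cast
    field_simp
  simp only [h1, Int.cast_zero, zero_div]
  exact kleinAt.add_mul_left _ _ hL τ

lemma form_neg (hL : 0 < L) (u m : ℤ) (τ : ℍ) :
    (KleinFactor.mk (-u) 0 M L m).form τ = -(KleinFactor.mk u 0 M L m).form τ := by
  rw [KleinFactor.form, KleinFactor.form]
  have h1 : ((-u : ℤ) / M : ℝ) = -(u / M) := by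
    push_cast
    ring
  simp only [h1, Int.cast_zero, zero_div]
  have h2 := kleinForm.neg (u / M) 0 (kleinAt.im_pos hL τ)
  rwa [neg_zero] at h2

lemma prod_add (hM : 0 < M) (hL : 0 < L) (h : Even (base.map fun p ↦ p.1 * p.2).sum) (i n : ℤ) :
    kleinProd (kleinFamily M L base (i + M * n)) = kleinProd (kleinFamily M L base i) := by
  ext τ
  have key : kleinProd (kleinFamily M L base (i + M * n)) τ =
      (-1) ^ ((base.map fun p ↦ p.1 * p.2).sum * n) * kleinProd (kleinFamily M L base i) τ := by
    clear h
    induction base with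
    | nil => simp [kleinFamily, kleinProd]
    | cons p base ih =>
      rw [cons, cons, kleinProd.cons, ih, kleinProd.cons,
        show p.1 * (i + M * n) = p.1 * i + M * (p.1 * n) by ring,
        form_add hM hL, mul_zpow, ← zpow_mul, List.map_cons, List.sum_cons, add_mul,
        zpow_add₀ (by norm_num)]
      ring_nf
  rw [key, (h.mul_right n).neg_one_zpow, one_mul]

lemma prod_neg (hL : 0 < L) (h : Even (base.map fun p ↦ p.2).sum) (i : ℤ) :
    kleinProd (kleinFamily M L base (-i)) = kleinProd (kleinFamily M L base i) := by
  ext τ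
  have key : kleinProd (kleinFamily M L base (-i)) τ =
      (-1) ^ (base.map fun p ↦ p.2).sum * kleinProd (kleinFamily M L base i) τ := by
    clear h
    induction base with
    | nil => simp [kleinFamily, kleinProd]
    | cons p base ih =>
      rw [cons, cons, kleinProd.cons, ih, kleinProd.cons, mul_neg, form_neg hL, ← neg_one_mul, mul_zpow, List.map_cons, List.sum_cons,
        zpow_add₀ (by norm_num)]
      ring
  rw [key, h.neg_one_zpow, one_mul]

end kleinFamily

/-! ### Roots of unity for individual Klein forms. -/

section Phases

/-- The action of `Γ₀(L)` on `k(1 / M, 0)(L τ)`. -/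
lemma KleinFactor.form_slash_left {M L h : ℕ} (hM : 0 < M) (hh : 0 < h) (hLM : L = M * (M * h)) (m : ℤ)
    {γ : SL(2, ℤ)} (hγ : (L : ℤ) ∣ γ 1 0) {ε t : ℤ} (hε : ε = 1 ∨ ε = -1) (ha : γ 0 0 = ε + M * t)
    (τ : ℍ) : ((KleinFactor.mk 1 0 M L m).form ∣[(-1 : ℤ)] γ) τ =
      Complex.exp (Real.pi * Complex.I * (t + h * γ 0 1 * (M + γ 0 0))) * ε *
        (KleinFactor.mk 1 0 M L m).form τ := by
  have hM0 : (M : ℂ) ≠ 0 := by exact_mod_cast hM.ne'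
  have hL : 0 < L := by rw [hLM]; positivity
  rw [kleinFamily.form_slash hM (by positivity) hLM _ _ hγ, one_mul]
  have h1 : (KleinFactor.mk (γ 0 0) 0 M L m).form τ =
      (-1) ^ t * (ε * (KleinFactor.mk 1 0 M L m).form τ) := by
    rw [ha, kleinFamily.form_add hM hL]
    rcases hε with rfl | rfl
    · simp
    · rw [kleinFamily.form_neg hL]
      simp
  rw [h1, ← Complex.exp_pi_mul_I, ← Complex.exp_int_mul, mul_add (Real.pi * Complex.I : ℂ),
    Complex.exp_add, show (Real.pi * Complex.I * t : ℂ) = t * (Real.pi * Complex.I) by ring]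
  have h2 : (Real.pi * Complex.I * (((1 : ℤ) : ℂ) * (M * h : ℕ) * γ 0 1 *
      (1 + ((1 : ℤ) : ℂ) * γ 0 0 / M))) = Real.pi * Complex.I * (h * γ 0 1 * (M + γ 0 0)) := by
    push_cast
    field_simp
  rw [h2]
  ring

/-- The action of `Γ₀(l L)` on `k(0, 1 / l)(L τ)`. -/
lemma KleinFactor.form_slash_right {l L : ℕ} (hl : 0 < l) (hL : 0 < L) (m : ℤ) {γ : SL(2, ℤ)}
    {n : ℤ} (hn : γ 1 0 = L * (l * n)) {ε t : ℤ} (hε : ε = 1 ∨ ε = -1) (hd : γ 1 1 = ε + l * t)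
    (τ : ℍ) : ((KleinFactor.mk 0 1 l L m).form ∣[(-1 : ℤ)] γ) τ =
      Complex.exp (Real.pi * Complex.I * (t + n - n * γ 1 1 / l)) * ε *
        (KleinFactor.mk 0 1 l L m).form τ := by
  have hl0 : (l : ℝ) ≠ 0 := by exact_mod_cast hl.ne'
  have hl1 : (l : ℂ) ≠ 0 := by exact_mod_cast hl.ne'
  rw [SL_slash_apply, neg_neg, zpow_one, KleinFactor.form, kleinAt.smul_eq _ _ hL γ hn,
    mul_comm _ (denom _ _), mul_inv_cancel_left₀ (denom_ne_zero γ τ)]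
  have h1 : ((0 : ℤ) / l : ℝ) * γ 0 0 + ((1 : ℤ) / l : ℝ) * (l * n : ℤ) = 0 + n := by
    push_cast
    field_simp
    ring
  have h2 : ((0 : ℤ) / l : ℝ) * (L * γ 0 1) + ((1 : ℤ) / l : ℝ) * γ 1 1 = ε * (1 / l) + t := by
    rw [hd]
    push_cast
    field_simp
    ring
  have h3 : kleinForm 0 (ε * (1 / l)) (L * τ) = ε * kleinForm 0 (1 / l) (L * τ) := by
    rcases hε with rfl | rfl
    · simp
    · have := kleinForm.neg 0 (1 / l) (kleinAt.im_pos hL τ)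
      simpa using this
  rw [h1, h2, kleinAt, kleinForm.add_int_left _ _ _ (kleinAt.im_pos hL τ), kleinForm.add_int_right,
    h3, kleinAt, ← mul_assoc, ← mul_assoc, ← Complex.exp_add]
  have h4 : (Real.pi * Complex.I * (n * (1 - ((ε * (1 / l) + t : ℝ) : ℂ))) +
      Real.pi * Complex.I * (t * (1 + (0 : ℝ))) : ℂ) =
      Real.pi * Complex.I * (t + n - n * γ 1 1 / l) := by
    rw [hd]
    push_cast
    field_simp
    ring
  rw [h4]
  simp

end Phases

end KleinFamilies

/-! ### Generating all orders from finitely many forms. -/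

section LeadingForms

open WeaklyHolomorphic

/-- The spaces `S_k(Γ₀(N))`, `M_{2-k}^∞(Γ₀(N))` and `S_k^∞(Γ₀(N))` contain forms with integral Fourier
expansions, leading coefficient `1` and the orders at `∞` which are needed for Hecke equivariance. -/
structure HasLeadingForms (k : ℤ) (N : ℕ) : Prop where
  weight : k = 2 ∨ k = 4
  cusp : ∃ g, IsSForm k N g ∧ ∃ B, HasIntegralLeading g 1 B
  dual : ∀ n : ℤ, 2 ≤ n → ∃ φ, IsMForm (2 - k) N φ ∧ ∃ A, HasIntegralLeading φ (-n) A
  weak : ∀ m : ℤ, 1 ≤ m ∨ (k = 4 ∧ m = 0) →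
    ∃ ψ, IsSForm k N ψ ∧ ∃ A, HasIntegralLeading ψ (-m) A

variable {N : ℕ} {f g x y φ : ℍ → ℂ} {A B C : ℤ → ℤ} {m n : ℤ}

/-- Every `n ≥ 2` is `2 i + 3 j`, so the monomials `x ^ i y ^ j` have all pole orders from 2 on.
Multiplying by `g` lowers the pole order by one and imposes vanishing at the other cusps. -/
theorem HasLeadingForms.of_weight_two (hg : IsSForm 2 N g) (hA : HasIntegralLeading g 1 A)
    (hx : IsMForm 0 N x) (hB : HasIntegralLeading x (-2) B)
    (hy : IsMForm 0 N y) (hC : HasIntegralLeading y (-3) C) : HasLeadingForms 2 N := by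
  have key (n : ℤ) (hn : 2 ≤ n) : ∃ φ, IsMForm 0 N φ ∧ ∃ A, HasIntegralLeading φ (-n) A := by
    obtain ⟨i, j, hij⟩ : ∃ i j : ℕ, n = 2 * i + 3 * j := by
      rcases Int.even_or_odd' n with ⟨r, hr | hr⟩
      · exact ⟨r.toNat, 0, by omega⟩
      · exact ⟨(r - 1).toNat, 1, by omega⟩
    obtain ⟨P, hP⟩ := hB.pow i
    obtain ⟨Q, hQ⟩ := hC.pow j
    obtain ⟨R, hR⟩ := hP.mul hQ
    refine ⟨_, (hx.pow i).mul (hy.pow j), R, ?_⟩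
    convert hR using 1
    rw [hij]
    ring
  refine ⟨.inl rfl, ⟨g, hg, A, hA⟩, key, fun m hm ↦ ?_⟩
  obtain ⟨φ, hφ, P, hP⟩ := key (m + 1) (by omega)
  obtain ⟨Q, hQ⟩ := hA.mul hP
  refine ⟨_, hg.mul hφ, Q, ?_⟩
  convert hQ using 1
  ring

/-- Powers of a function with a simple pole shift the orders of `φ` and `g` one step at a time. -/
theorem HasLeadingForms.of_weight_four (hg : IsSForm 4 N g) (hA : HasIntegralLeading g 1 A)
    (hφ : IsMForm (-2) N φ) (hB : HasIntegralLeading φ (-2) B)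
    (hx : IsMForm 0 N x) (hC : HasIntegralLeading x (-1) C) : HasLeadingForms 4 N := by
  refine ⟨.inr rfl, ⟨g, hg, A, hA⟩, fun n hn ↦ ?_, fun m hm ↦ ?_⟩
  · obtain ⟨P, hP⟩ := hC.pow (n - 2).toNat
    obtain ⟨Q, hQ⟩ := hB.mul hP
    refine ⟨_, hφ.mul (hx.pow (n - 2).toNat), Q, ?_⟩
    convert hQ using 1
    rw [Int.toNat_of_nonneg (by omega)]
    ring
  · obtain ⟨P, hP⟩ := hC.pow (m + 1).toNat
    obtain ⟨Q, hQ⟩ := hA.mul hP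
    refine ⟨_, hg.mul (hx.pow (m + 1).toNat), Q, ?_⟩
    convert hQ using 1
    rw [Int.toNat_of_nonneg (by omega)]
    ring

/-- The function `f` has an integral Fourier expansion of order at least `m`. -/
def HasIntegralOrder (f : ℍ → ℂ) (m : ℤ) : Prop :=
  ∃ A : ℤ → ℤ, HasQExpansion f (fun n ↦ (A n : ℂ)) ∧ ∀ n < m, A n = 0

lemma HasIntegralLeading.hasIntegralOrder (h : HasIntegralLeading f m A) : HasIntegralOrder f m :=
  ⟨A, h.hasQExpansion, h.eq_zero⟩

namespace HasIntegralOrder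

lemma mono (h : HasIntegralOrder f m) (hn : n ≤ m) : HasIntegralOrder f n :=
  let ⟨A, hA, hA0⟩ := h
  ⟨A, hA, fun i hi ↦ hA0 i (by omega)⟩

lemma add (hf : HasIntegralOrder f m) (hg : HasIntegralOrder g m) :
    HasIntegralOrder (fun τ ↦ f τ + g τ) m := by
  obtain ⟨A, hA, hA0⟩ := hf
  obtain ⟨B, hB, hB0⟩ := hg
  exact ⟨fun n ↦ A n + B n, (hA.add hB).congr fun n ↦ by push_cast; rfl,
    fun n hn ↦ by simp [hA0 n hn, hB0 n hn]⟩

lemma int_mul (hf : HasIntegralOrder f m) (c : ℤ) : HasIntegralOrder (fun τ ↦ (c : ℂ) * f τ) m := by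
  obtain ⟨A, hA, hA0⟩ := hf
  exact ⟨fun n ↦ c * A n, (hA.const_mul c).congr fun n ↦ by push_cast; rfl,
    fun n hn ↦ by simp [hA0 n hn]⟩

lemma mul (hf : HasIntegralOrder f m) (hg : HasIntegralOrder g n) :
    HasIntegralOrder (fun τ ↦ f τ * g τ) (m + n) := by
  obtain ⟨A, hA, hA0⟩ := hf
  obtain ⟨B, hB, hB0⟩ := hg
  obtain ⟨c, hc, h0, -, hS⟩ := hA.exists_mul hB
    (m := m) (m' := n) (fun n hn ↦ by simp [hA0 n hn]) fun n hn ↦ by simp [hB0 n hn]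
  choose C hC using hS (Int.castRingHom ℂ).range (fun n ↦ ⟨A n, rfl⟩) fun n ↦ ⟨B n, rfl⟩
  simp only [eq_intCast] at hC
  exact ⟨C, hc.congr fun n ↦ (hC n).symm, fun n hn ↦ by exact_mod_cast (hC n).trans (h0 n hn)⟩

end HasIntegralOrder

lemma HasIntegralLeading.add (hf : HasIntegralLeading f m A) (hg : HasIntegralOrder g n)
    (hmn : m < n) : ∃ C, HasIntegralLeading (fun τ ↦ f τ + g τ) m C := by
  obtain ⟨B, hB, hB0⟩ := hg
  exact ⟨fun n ↦ A n + B n, (hf.hasQExpansion.add hB).congr fun n ↦ by push_cast; rfl,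
    fun i hi ↦ by simp [hf.eq_zero i hi, hB0 i (by omega)],
    by simp [hf.eq_one, hB0 m hmn]⟩

end LeadingForms

/-! ### Criteria for modularity of products and traces. -/

section KleinCriteria

open WeaklyHolomorphic

/-- The diagonal entries of a matrix in `Γ₀(N)` are inverse to each other modulo divisors of `N`. -/
lemma intCast_mul_eq_one {M : ℕ} {γ : SL(2, ℤ)} (hγ : (M : ℤ) ∣ γ 1 0) :
    ((γ 0 0 : ℤ) : ZMod M) * (γ 1 1 : ℤ) = 1 := by
  have hdet := γ.det_coe
  rw [Matrix.det_fin_two] at hdet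
  have h1 : ((γ 1 0 : ℤ) : ZMod M) = 0 := (ZMod.intCast_zmod_eq_zero_iff_dvd _ _).2 hγ
  have h2 := congrArg (Int.cast : ℤ → ZMod M) hdet
  push_cast at h2
  rw [h1, mul_zero, sub_zero] at h2
  exact h2

lemma exists_eq_add_mul {M : ℕ} {a ε : ℤ} (h : (a : ZMod M) = ε) : ∃ t : ℤ, a = ε + M * t := by
  rw [ZMod.intCast_eq_intCast_iff_dvd_sub] at h
  obtain ⟨t, ht⟩ := h
  exact ⟨-t, by linear_combination -ht⟩

namespace kleinFamily

variable {M L : ℕ} {base : List (ℤ × ℤ)}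

/-- Each factor depends up to sign on its characteristic modulo `M` and modulo negation; the parity
conditions make the signs cancel in the product. -/
lemma prod_congr (hM : 0 < M) (hL : 0 < L) (h1 : Even (base.map fun p ↦ p.1 * p.2).sum)
    (h0 : Even (base.map fun p ↦ p.2).sum) {i j : ℤ} (h : (i : ZMod M) = j ∨ (i : ZMod M) = -j) :
    kleinProd (kleinFamily M L base i) = kleinProd (kleinFamily M L base j) := by
  rcases h with h | h
  · obtain ⟨t, rfl⟩ := exists_eq_add_mul h
    exact prod_add hM hL h1 j t
  · obtain ⟨t, rfl⟩ := exists_eq_add_mul (ε := -j) (by rw [h]; push_cast; rfl)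
    rw [prod_add hM hL h1, prod_neg hL h0]

/-- The leading terms of products of Klein forms of weight `0`. -/
lemma hasIntegralLeading {N : ℕ} [NeZero N] {l : List KleinFactor} (h : ∀ x ∈ l, x.IsValid N) (d : ℕ)
    (hd : 0 < d) (hv : ∀ x ∈ l, x.v = 0 ∧ x.M * d ∣ x.L) (hw : kleinWeight l = 0) (n : ℤ)
    (hn : kleinOrder l 1 0 = -(2 * n)) (ε : ℤ)
    (hε : Even (l.map fun x : KleinFactor ↦ x.u / x.M * x.m).sum ∧ ε = 1 ∨
      Odd (l.map fun x : KleinFactor ↦ x.u / x.M * x.m).sum ∧ ε = -1) :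
    ∃ A, HasIntegralLeading (fun τ ↦ ε * kleinProd l τ) n A ∧ ∀ j, A j ≠ 0 → (d : ℤ) ∣ j - n := by
  simpa [hw] using kleinProd.hasIntegralLeading h hd hv hn hε

/-- The behaviour of three conjugate products of Klein forms under `Γ₀(N)`. -/
lemma cyclic (hM : M = 7 ∨ M = 9) (hL : 0 < L) (h1 : Even (base.map fun p ↦ p.1 * p.2).sum)
    (h0 : Even (base.map fun p ↦ p.2).sum) {a d : ℤ} (had : (a : ZMod M) * d = 1) :
    let P := fun i ↦ kleinProd (kleinFamily M L base i)
    (P (1 * a) = P 1 ∧ P (2 * a) = P 2 ∧ P (4 * a) = P 4) ∨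
      (P (1 * a) = P 2 ∧ P (2 * a) = P 4 ∧ P (4 * a) = P 1) ∨
      (P (1 * a) = P 4 ∧ P (2 * a) = P 1 ∧ P (4 * a) = P 2) := by
  intro P
  have hM0 : 0 < M := by omega
  have hP {i j : ℤ} (h : (i : ZMod M) = j ∨ (i : ZMod M) = -j) : P i = P j :=
    prod_congr hM0 hL h1 h0 h
  -- For `M = 7` and `M = 9` the units modulo sign form a cyclic group of order three, generated by
  -- 2.
  have key : ((a : ZMod M) = 1 ∨ (a : ZMod M) = -1) ∨ ((a : ZMod M) = 2 ∨ (a : ZMod M) = -2) ∨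
      ((a : ZMod M) = 4 ∨ (a : ZMod M) = -4) := by
    generalize (a : ZMod M) = a' at had
    generalize (d : ZMod M) = d' at had
    rcases hM with rfl | rfl <;> revert a' d' <;> decide
  have h8 : (8 : ZMod M) = 1 ∨ (8 : ZMod M) = -1 := by
    rcases hM with rfl | rfl <;> decide
  have hmul (i r j : ℤ) (ha : (a : ZMod M) = r ∨ (a : ZMod M) = -r)
      (hj : ((i * r : ℤ) : ZMod M) = j ∨ ((i * r : ℤ) : ZMod M) = -j) : P (i * a) = P j := by
    refine hP ?_
    push_cast at hj ⊢
    rcases ha with ha | ha <;> rw [ha]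
    · exact hj
    · rw [mul_neg]
      exact hj.symm.imp (fun h ↦ by rw [h, neg_neg]) fun h ↦ by rw [h]
  rcases key with h | h | h
  · exact .inl ⟨hmul 1 1 1 (by simpa using h) (by simp), hmul 2 1 2 (by simpa using h) (by simp),
      hmul 4 1 4 (by simpa using h) (by simp)⟩
  · refine .inr (.inl ⟨hmul 1 2 2 (by simpa using h) (by simp), hmul 2 2 4 (by simpa using h) ?_,
      hmul 4 2 1 (by simpa using h) ?_⟩)
    · norm_num
    · norm_num
      exact h8
  · refine .inr (.inr ⟨hmul 1 4 4 (by simpa using h) (by simp), hmul 2 4 1 (by simpa using h) ?_,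
      hmul 4 4 2 (by simpa using h) ?_⟩)
    · norm_num
      exact h8
    · norm_num
      rw [show (16 : ZMod M) = 8 * 2 by norm_num]
      rcases h8 with h | h <;> simp [h]

/-- The action of `Γ₀(N)` on three conjugate products of Klein forms of weight `0`. -/
theorem slash_cyclic (hM : M = 7 ∨ M = 9) {h : ℕ} (hh : 0 < h) (hL : L = M * h)
    (h0 : (base.map fun p ↦ p.2).sum = 0) (h1 : Even (base.map fun p ↦ p.1 * p.2).sum)
    (h2 : 2 * (M : ℤ) ∣ h * (base.map fun p ↦ p.1 ^ 2 * p.2).sum)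
    {P : ℤ → ℍ → ℂ} (hP : P = fun i ↦ kleinProd (kleinFamily M L base i)) {γ : SL(2, ℤ)}
    (hγ : (L : ℤ) ∣ γ 1 0) :
    (P 1 ∣[(0 : ℤ)] γ = P 1 ∧ P 2 ∣[(0 : ℤ)] γ = P 2 ∧ P 4 ∣[(0 : ℤ)] γ = P 4) ∨
      (P 1 ∣[(0 : ℤ)] γ = P 2 ∧ P 2 ∣[(0 : ℤ)] γ = P 4 ∧ P 4 ∣[(0 : ℤ)] γ = P 1) ∨
      (P 1 ∣[(0 : ℤ)] γ = P 4 ∧ P 2 ∣[(0 : ℤ)] γ = P 1 ∧ P 4 ∣[(0 : ℤ)] γ = P 2) := by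
  have hM0 : 0 < M := by omega
  have hL0 : 0 < L := by rw [hL]; positivity
  have hMγ : (M : ℤ) ∣ γ 1 0 := Dvd.dvd.trans ⟨h, by exact_mod_cast hL⟩ hγ
  have hs (i : ℤ) : P i ∣[(0 : ℤ)] γ = P (i * γ 0 0) := by
    subst hP
    refine slash hM0 hh hL ((even_iff_two_dvd.1 h1).mul_left _) h2 ?_ hγ
    simpa [kleinWeight, kleinFamily, Function.comp_def] using h0
  rw [hs, hs, hs]
  subst hP
  exact cyclic hM hL0 h1 (h0 ▸ Even.zero) (intCast_mul_eq_one hMγ)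

/-- The sum of three conjugate products of Klein forms. -/
noncomputable def trace (M L : ℕ) (base : List (ℤ × ℤ)) (τ : ℍ) : ℂ :=
  kleinProd (kleinFamily M L base 1) τ + kleinProd (kleinFamily M L base 2) τ +
    kleinProd (kleinFamily M L base 4) τ

/-- `Γ₀(N)` permutes the three conjugates cyclically, so their sum is invariant although the single
products need not be. -/
theorem isMForm_trace {N : ℕ} [NeZero N] (hM : M = 7 ∨ M = 9) (hLN : L ∣ N) {h : ℕ}
    (hh : 0 < h) (hL : L = M * h) (h0 : (base.map fun p ↦ p.2).sum = 0)
    (h1 : Even (base.map fun p ↦ p.1 * p.2).sum)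
    (h2 : 2 * (M : ℤ) ∣ h * (base.map fun p ↦ p.1 ^ 2 * p.2).sum)
    (hval : ∀ i ∈ [1, 2, 4], ∀ x ∈ kleinFamily M L base i, x.IsValid N)
    (hord : ∀ i ∈ [1, 2, 4], ∀ a < N, ∀ c < N, c ≠ 0 → (a.gcd c).gcd N = 1 →
      kleinOrder (kleinFamily M L base i) (a : ℕ) (c : ℕ) ≤ 0) :
    IsMForm 0 N (trace M L base) := by
  have hw (i : ℤ) : kleinWeight (kleinFamily M L base i) = 0 := by
    simpa [kleinWeight, kleinFamily, Function.comp_def] using h0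
  have e : trace M L base = kleinProd (kleinFamily M L base 1) + kleinProd (kleinFamily M L base 2) +
    kleinProd (kleinFamily M L base 4) := rfl
  refine ⟨?_, fun γ hγ ↦ ?_, ?_, fun γ hγ ↦ ?_⟩
  · exact ((kleinProd.mdifferentiable (hval 1 (by simp))).add
      (kleinProd.mdifferentiable (hval 2 (by simp)))).add
      (kleinProd.mdifferentiable (hval 4 (by simp)))
  · have hLγ : (L : ℤ) ∣ γ 1 0 := (Int.natCast_dvd_natCast.2 hLN).trans hγ
    rw [e, SlashAction.add_slash, SlashAction.add_slash]
    rcases slash_cyclic hM hh hL h0 h1 h2 rfl hLγ with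
      ⟨e1, e2, e3⟩ | ⟨e1, e2, e3⟩ | ⟨e1, e2, e3⟩ <;> simp only [e1, e2, e3] <;> abel
  · obtain ⟨n1, hn1⟩ := kleinProd.growth (hval 1 (by simp))
    obtain ⟨n2, hn2⟩ := kleinProd.growth (hval 2 (by simp))
    obtain ⟨n3, hn3⟩ := kleinProd.growth (hval 4 (by simp))
    exact ⟨max (max n1 n2) n3, ((hn1.trans (exp_growth_mono (by omega))).add
      (hn2.trans (exp_growth_mono (by omega)))).add (hn3.trans (exp_growth_mono (by omega)))⟩
  · rw [e, SlashAction.add_slash, SlashAction.add_slash]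
    exact ((kleinProd.isBounded_slash (hval 1 (by simp)) (hw 1) (hord 1 (by simp)) hγ).add
      (kleinProd.isBounded_slash (hval 2 (by simp)) (hw 2) (hord 2 (by simp)) hγ)).add
      (kleinProd.isBounded_slash (hval 4 (by simp)) (hw 4) (hord 4 (by simp)) hγ)

/-- Single products of Klein forms which are invariant under `Γ₀(N)`. -/
theorem isMForm {N : ℕ} [NeZero N] (hM : 0 < M) (hMN : M ∣ N) (hLN : L ∣ N) {h : ℕ}
    (hh : 0 < h) (hL : L = M * h) {k : ℤ} (hk : kleinWeight (kleinFamily M L base 1) = k)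
    (h1 : 2 ∣ h * (base.map fun p ↦ p.1 * p.2).sum)
    (h2 : 2 * (M : ℤ) ∣ h * (base.map fun p ↦ p.1 ^ 2 * p.2).sum)
    (hinv : ∀ a d : ℤ, (a : ZMod M) * d = 1 →
      kleinProd (kleinFamily M L base a) = kleinProd (kleinFamily M L base 1))
    (hval : ∀ x ∈ kleinFamily M L base 1, x.IsValid N)
    (hord : ∀ a < N, ∀ c < N, c ≠ 0 → (a.gcd c).gcd N = 1 →
      kleinOrder (kleinFamily M L base 1) (a : ℕ) (c : ℕ) ≤ 0) :
    IsMForm k N (kleinProd (kleinFamily M L base 1)) := by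
  refine kleinProd.isMForm hval hk hord fun γ hγ ↦ ?_
  have hMγ : (M : ℤ) ∣ γ 1 0 := (Int.natCast_dvd_natCast.2 hMN).trans hγ
  have hLγ : (L : ℤ) ∣ γ 1 0 := (Int.natCast_dvd_natCast.2 hLN).trans hγ
  rw [slash hM hh hL h1 h2 hk hLγ, one_mul]
  exact hinv _ _ (intCast_mul_eq_one hMγ)

end kleinFamily

end KleinCriteria

/-! ### Invariance of the cusp forms given by eta products. -/

section ExplicitForms

open WeaklyHolomorphic

namespace KleinFactor

variable {N : ℕ} [NeZero N] {x : KleinFactor}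

lemma IsValid.exists_hasUnitExpansion (h : x.IsValid N)
    (hx : x.v = 0 ∧ x.M ∣ x.L ∨ x.u = 0 ∧ x.v = 1 ∧ (x.M = 2 ∨ x.M = 3)) :
    ∃ κ ≠ 0, HasUnitExpansion 1 (fun τ ↦ x.form τ ^ x.m) (κ ^ x.m) (-(x.order 1 0 : ℝ)) := by
  rcases hx with ⟨hv, hML⟩ | ⟨hu, hv, hM⟩
  · exact ⟨_, mul_ne_zero kleinConst_ne_zero (zpow_ne_zero _ (by norm_num)),
      h.hasUnitExpansion hv (by simpa using hML)⟩
  · have key : ∃ κ ≠ 0, HasUnitExpansion 1 (kleinAt 0 (1 / x.M) x.L) κ 0 := by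
      rcases hM with hM | hM <;> rw [hM]
      · exact_mod_cast kleinAt.hasUnitExpansion_half h.L_pos
      · exact_mod_cast kleinAt.hasUnitExpansion_third h.L_pos
    obtain ⟨κ, hκ, hU⟩ := key
    refine ⟨κ, hκ, ?_⟩
    have h1 : x.form = kleinAt 0 (1 / x.M) x.L := by
      simp [form, hu, hv]
    rw [h1, h.order_one_zero, hu]
    simpa using hU.zpow x.m

end KleinFactor

lemma kleinProd.exists_hasIntegralLeading {N : ℕ} [NeZero N] {l : List KleinFactor}
    (h : ∀ x ∈ l, x.IsValid N)
    (hl : ∀ x ∈ l, x.v = 0 ∧ x.M ∣ x.L ∨ x.u = 0 ∧ x.v = 1 ∧ (x.M = 2 ∨ x.M = 3)) {n : ℤ}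
    (hn : kleinOrder l 1 0 = -(2 * n)) :
    ∃ κ : ℂ, ∃ A, HasIntegralLeading (fun τ ↦ κ * kleinProd l τ) n A := by
  have key (x : KleinFactor) : ∃ κ : ℂ, κ ≠ 0 ∧ (x ∈ l →
      HasUnitExpansion 1 (fun τ ↦ x.form τ ^ x.m) (κ ^ x.m) (-(x.order 1 0 : ℝ))) := by
    by_cases hx : x ∈ l
    · obtain ⟨κ, hκ, hU⟩ := (h x hx).exists_hasUnitExpansion (hl x hx)
      exact ⟨κ, hκ, fun _ ↦ hU⟩
    · exact ⟨1, one_ne_zero, fun h ↦ absurd h hx⟩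
  choose κ hκ hU using key
  have h1 := kleinProd.hasUnitExpansion κ hU
  have h2 : (l.map fun x ↦ κ x ^ x.m).prod ≠ 0 := by
    rw [Ne, List.prod_eq_zero_iff, List.mem_map]
    rintro ⟨x, -, hx⟩
    exact zpow_ne_zero _ (hκ x) hx
  have h3 := h1.const_mul (l.map fun x ↦ κ x ^ x.m).prod⁻¹
  rw [inv_mul_cancel₀ h2, hn] at h3
  obtain ⟨A, hA, -⟩ := h3.hasIntegralLeading one_pos (n := n) (by push_cast; ring)
  exact ⟨_, A, hA⟩

lemma exists_eq_two_mul_of_zmod {z : ℤ} (h : (z : ZMod 2) = 0) : ∃ k : ℤ, z = 2 * k :=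
  (ZMod.intCast_zmod_eq_zero_iff_dvd z 2).1 h

/-- The units modulo 3 are their own inverses, so both diagonal entries carry the same sign. -/
lemma exists_diagonal_mod_three {γ : SL(2, ℤ)} (hγ : (3 : ℤ) ∣ γ 1 0) :
    ∃ ε t u : ℤ, (ε = 1 ∨ ε = -1) ∧ γ 0 0 = ε + 3 * t ∧ γ 1 1 = ε + 3 * u := by
  have h1 := intCast_mul_eq_one (M := 3) hγ
  have h2 : ∀ a d : ZMod 3, a * d = 1 → (a = 1 ∧ d = 1) ∨ (a = -1 ∧ d = -1) := by decide
  rcases h2 _ _ h1 with ⟨ha, hd⟩ | ⟨ha, hd⟩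
  · obtain ⟨t, ht⟩ := exists_eq_add_mul (M := 3) (ε := 1) (by simpa using ha)
    obtain ⟨u, hu⟩ := exists_eq_add_mul (M := 3) (ε := 1) (by simpa using hd)
    exact ⟨1, t, u, .inl rfl, ht, hu⟩
  · obtain ⟨t, ht⟩ := exists_eq_add_mul (M := 3) (ε := -1) (by simpa using ha)
    obtain ⟨u, hu⟩ := exists_eq_add_mul (M := 3) (ε := -1) (by simpa using hd)
    exact ⟨-1, t, u, .inr rfl, ht, hu⟩

lemma exists_diagonal_mod_two {γ : SL(2, ℤ)} (hγ : (2 : ℤ) ∣ γ 1 0) :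
    ∃ t u : ℤ, γ 0 0 = 1 + 2 * t ∧ γ 1 1 = 1 + 2 * u := by
  have h1 := intCast_mul_eq_one (M := 2) hγ
  have h2 : ∀ a d : ZMod 2, a * d = 1 → a = 1 ∧ d = 1 := by decide
  obtain ⟨ha, hd⟩ := h2 _ _ h1
  obtain ⟨t, ht⟩ := exists_eq_add_mul (M := 2) (ε := 1) (by simpa using ha)
  obtain ⟨u, hu⟩ := exists_eq_add_mul (M := 2) (ε := 1) (by simpa using hd)
  exact ⟨t, u, ht, hu⟩

/-- The parity condition for products of `k(1 / 3, 0)(9 τ)` and `k(0, 1 / 3)(3 τ)`. -/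
lemma even_phase_mod_three {a b c d ε t u : ℤ} (hdet : a * d - b * c = 1) (hε : ε = 1 ∨ ε = -1)
    (ha : a = ε + 3 * t) (hd : d = ε + 3 * u) :
    ∃ k : ℤ, t + b * (3 + a) + (u + c - c * d) = 2 * k := by
  refine exists_eq_two_mul_of_zmod ?_
  have h1 := congrArg (Int.cast : ℤ → ZMod 2) hdet
  have h2 : (ε : ZMod 2) = 1 := by rcases hε with rfl | rfl <;> decide
  have h3 : (3 : ZMod 2) = 1 := by decide
  rw [ha, hd] at *
  push_cast at h1 ⊢
  rw [h2, h3] at *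
  generalize (b : ZMod 2) = b' at *
  generalize (c : ZMod 2) = c' at *
  generalize (t : ZMod 2) = t' at *
  generalize (u : ZMod 2) = u' at *
  revert b' c' t' u'
  decide

/-- Up to a constant the product is `η(3 τ) ^ 8`. The signs `ε` occur to an even total power, and
the phases cancel by the parity condition. -/
lemma slash_cusp_form_nine {γ : SL(2, ℤ)} (hγ : (9 : ℤ) ∣ γ 1 0) :
    kleinProd [⟨1, 0, 3, 9, -1⟩, ⟨0, 1, 3, 3, -3⟩] ∣[(4 : ℤ)] γ =
      kleinProd [⟨1, 0, 3, 9, -1⟩, ⟨0, 1, 3, 3, -3⟩] := by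
  obtain ⟨c, hc⟩ := hγ
  obtain ⟨ε, t, u, hε, ha, hd⟩ := exists_diagonal_mod_three (γ := γ) ⟨3 * c, by rw [hc]; ring⟩
  have hdet := γ.det_coe
  rw [Matrix.det_fin_two, hc] at hdet
  obtain ⟨k, hk⟩ := even_phase_mod_three (c := 9 * c) hdet hε ha hd
  ext τ
  have h1 : ((KleinFactor.mk 1 0 3 9 (-1)).form ∣[(-1 : ℤ)] γ) τ = _ :=
    KleinFactor.form_slash_left (M := 3) (h := 1) (by norm_num) (by norm_num) rfl (-1)
      ⟨c, hc⟩ hε ha τ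
  have h2 : ((KleinFactor.mk 0 1 3 3 (-3)).form ∣[(-1 : ℤ)] γ) τ = _ :=
    KleinFactor.form_slash_right (l := 3) (L := 3) (by norm_num) (by norm_num) (-3) (n := c)
      (by rw [hc]; push_cast; ring) hε hd τ
  have key : Complex.exp (Real.pi * Complex.I * (t + (1 : ℕ) * γ 0 1 * ((3 : ℕ) + γ 0 0))) ^ (-1 : ℤ) *
      Complex.exp (Real.pi * Complex.I * (u + c - c * γ 1 1 / (3 : ℕ))) ^ (-3 : ℤ) = 1 := by
    rw [← Complex.exp_int_mul, ← Complex.exp_int_mul, ← Complex.exp_add,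
      -- Twice this integer is the total phase: `-2 k` replaces the expression in
      -- `even_phase_mod_three`, and the other terms collect the difference, which is even.
      ← Complex.exp_pi_I_mul_int_mul_two (-k + 3 * c - 4 * c * γ 1 1 - u)]
    congr 1
    have hk' := congrArg (Int.cast : ℤ → ℂ) hk
    push_cast at hk' ⊢
    linear_combination -(Real.pi * Complex.I) * hk'
  rw [kleinProd.slash_apply (k := 4) (by decide)]
  simp only [kleinProd, List.map_cons, List.map_nil, List.prod_cons, List.prod_nil, h1, h2, mul_zpow]
  have hε4 : (ε : ℂ) ^ (-1 : ℤ) * (ε : ℂ) ^ (-3 : ℤ) = 1 := by rcases hε with rfl | rfl <;> norm_num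
  generalize (KleinFactor.mk 1 0 3 9 (-1)).form τ ^ (-1 : ℤ) = X
  generalize (KleinFactor.mk 0 1 3 3 (-3)).form τ ^ (-3 : ℤ) = Y
  linear_combination (ε : ℂ) ^ (-1 : ℤ) * (ε : ℂ) ^ (-3 : ℤ) * X * Y * key + X * Y * hε4

/-- Up to a constant the product is `η(3 τ) ^ 2 η(9 τ) ^ 2`. -/
lemma slash_cusp_form_twenty_seven {γ : SL(2, ℤ)} (hγ : (27 : ℤ) ∣ γ 1 0) :
    kleinProd [⟨1, 0, 3, 9, -1⟩, ⟨0, 1, 3, 3, -1⟩] ∣[(2 : ℤ)] γ =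
      kleinProd [⟨1, 0, 3, 9, -1⟩, ⟨0, 1, 3, 3, -1⟩] := by
  obtain ⟨c, hc⟩ := hγ
  obtain ⟨ε, t, u, hε, ha, hd⟩ := exists_diagonal_mod_three (γ := γ) ⟨9 * c, by rw [hc]; ring⟩
  have hdet := γ.det_coe
  rw [Matrix.det_fin_two, hc] at hdet
  obtain ⟨k, hk⟩ := even_phase_mod_three (c := 27 * c) hdet hε ha hd
  ext τ
  have h1 : ((KleinFactor.mk 1 0 3 9 (-1)).form ∣[(-1 : ℤ)] γ) τ = _ :=
    KleinFactor.form_slash_left (M := 3) (h := 1) (by norm_num) (by norm_num) rfl (-1)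
      ⟨3 * c, by rw [hc]; push_cast; ring⟩ hε ha τ
  have h2 : ((KleinFactor.mk 0 1 3 3 (-1)).form ∣[(-1 : ℤ)] γ) τ = _ :=
    KleinFactor.form_slash_right (l := 3) (L := 3) (by norm_num) (by norm_num) (-1) (n := 3 * c)
      (by rw [hc]; push_cast; ring) hε hd τ
  have key : Complex.exp (Real.pi * Complex.I * (t + (1 : ℕ) * γ 0 1 * ((3 : ℕ) + γ 0 0))) ^ (-1 : ℤ) *
      Complex.exp (Real.pi * Complex.I * (u + (3 * c : ℤ) - (3 * c : ℤ) * γ 1 1 / (3 : ℕ))) ^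
        (-1 : ℤ) = 1 := by
    rw [← Complex.exp_int_mul, ← Complex.exp_int_mul, ← Complex.exp_add,
      ← Complex.exp_pi_I_mul_int_mul_two (-k + 12 * c - 13 * c * γ 1 1)]
    congr 1
    have hk' := congrArg (Int.cast : ℤ → ℂ) hk
    push_cast at hk' ⊢
    linear_combination -(Real.pi * Complex.I) * hk'
  rw [kleinProd.slash_apply (k := 2) (by decide)]
  simp only [kleinProd, List.map_cons, List.map_nil, List.prod_cons, List.prod_nil, h1, h2, mul_zpow]
  have hε4 : (ε : ℂ) ^ (-1 : ℤ) * (ε : ℂ) ^ (-1 : ℤ) = 1 := by rcases hε with rfl | rfl <;> norm_num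
  generalize (KleinFactor.mk 1 0 3 9 (-1)).form τ ^ (-1 : ℤ) = X
  generalize (KleinFactor.mk 0 1 3 3 (-1)).form τ ^ (-1 : ℤ) = Y
  linear_combination (ε : ℂ) ^ (-1 : ℤ) * (ε : ℂ) ^ (-1 : ℤ) * X * Y * key + X * Y * hε4

/-- Up to a constant the product is `η(4 τ) ^ 2 η(8 τ) ^ 2`. -/
lemma slash_cusp_form_thirty_two {γ : SL(2, ℤ)} (hγ : (32 : ℤ) ∣ γ 1 0) :
    kleinProd [⟨1, 0, 2, 8, -1⟩, ⟨0, 1, 2, 4, -1⟩] ∣[(2 : ℤ)] γ =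
      kleinProd [⟨1, 0, 2, 8, -1⟩, ⟨0, 1, 2, 4, -1⟩] := by
  obtain ⟨c, hc⟩ := hγ
  obtain ⟨t, u, ha, hd⟩ := exists_diagonal_mod_two (γ := γ) ⟨16 * c, by rw [hc]; ring⟩
  have hdet := γ.det_coe
  rw [Matrix.det_fin_two, hc] at hdet
  -- Half of the determinant relation; it shows that `t + u` is even, which is what the phases
  -- require.
  have htu : t + u = 16 * γ 0 1 * c - 2 * t * u := by
    rw [ha, hd] at hdet
    have : 2 * (t + u) = 2 * (16 * γ 0 1 * c - 2 * t * u) := by linear_combination hdet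
    omega
  ext τ
  have h1 : ((KleinFactor.mk 1 0 2 8 (-1)).form ∣[(-1 : ℤ)] γ) τ = _ :=
    KleinFactor.form_slash_left (M := 2) (h := 2) (by norm_num) (by norm_num) rfl (-1)
      ⟨4 * c, by rw [hc]; push_cast; ring⟩ (.inl rfl) ha τ
  have h2 : ((KleinFactor.mk 0 1 2 4 (-1)).form ∣[(-1 : ℤ)] γ) τ = _ :=
    KleinFactor.form_slash_right (l := 2) (L := 4) (by norm_num) (by norm_num) (-1) (n := 4 * c)
      (by rw [hc]; push_cast; ring) (.inl rfl) hd τ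
  have key : Complex.exp (Real.pi * Complex.I * (t + (2 : ℕ) * γ 0 1 * ((2 : ℕ) + γ 0 0))) ^ (-1 : ℤ) *
      Complex.exp (Real.pi * Complex.I * (u + (4 * c : ℤ) - (4 * c : ℤ) * γ 1 1 / (2 : ℕ))) ^
        (-1 : ℤ) = 1 := by
    rw [← Complex.exp_int_mul, ← Complex.exp_int_mul, ← Complex.exp_add,
      ← Complex.exp_pi_I_mul_int_mul_two
        (-(8 * γ 0 1 * c - t * u) - γ 0 1 * (2 + γ 0 0) - 2 * c + c * γ 1 1)]
    congr 1
    have hk' := congrArg (Int.cast : ℤ → ℂ) htu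
    push_cast at hk' ⊢
    linear_combination -(Real.pi * Complex.I) * hk'
  rw [kleinProd.slash_apply (k := 2) (by decide)]
  simp only [kleinProd, List.map_cons, List.map_nil, List.prod_cons, List.prod_nil, h1, h2, mul_zpow,
    Int.cast_one, one_zpow]
  generalize (KleinFactor.mk 1 0 2 8 (-1)).form τ ^ (-1 : ℤ) = X
  generalize (KleinFactor.mk 0 1 2 4 (-1)).form τ ^ (-1 : ℤ) = Y
  linear_combination X * Y * key

/-- Up to a constant the product is `η(6 τ) ^ 4`. -/
lemma slash_cusp_form_thirty_six {γ : SL(2, ℤ)} (hγ : (36 : ℤ) ∣ γ 1 0) :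
    kleinProd [⟨1, 0, 3, 18, 1⟩, ⟨0, 1, 3, 6, 3⟩, ⟨1, 0, 2, 12, -2⟩, ⟨0, 1, 2, 6, -4⟩] ∣[(2 : ℤ)] γ =
      kleinProd [⟨1, 0, 3, 18, 1⟩, ⟨0, 1, 3, 6, 3⟩, ⟨1, 0, 2, 12, -2⟩, ⟨0, 1, 2, 6, -4⟩] := by
  obtain ⟨c, hc⟩ := hγ
  obtain ⟨ε, t, u, hε, ha, hd⟩ := exists_diagonal_mod_three (γ := γ) ⟨12 * c, by rw [hc]; ring⟩
  obtain ⟨t', u', ha', hd'⟩ := exists_diagonal_mod_two (γ := γ) ⟨18 * c, by rw [hc]; ring⟩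
  -- The diagonal entries are odd, and so is `ε`; hence `3 t` and `3 u` are even.
  obtain ⟨r, rfl⟩ : ∃ r, t = 2 * r := ⟨t / 2, by omega⟩
  obtain ⟨s, rfl⟩ : ∃ s, u = 2 * s := ⟨u / 2, by omega⟩
  ext τ
  have h1 : ((KleinFactor.mk 1 0 3 18 1).form ∣[(-1 : ℤ)] γ) τ = _ :=
    KleinFactor.form_slash_left (M := 3) (h := 2) (by norm_num) (by norm_num) rfl 1
      ⟨2 * c, by rw [hc]; push_cast; ring⟩ hε ha τ
  have h2 : ((KleinFactor.mk 0 1 3 6 3).form ∣[(-1 : ℤ)] γ) τ = _ :=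
    KleinFactor.form_slash_right (l := 3) (L := 6) (by norm_num) (by norm_num) 3 (n := 2 * c)
      (by rw [hc]; push_cast; ring) hε hd τ
  have h3 : ((KleinFactor.mk 1 0 2 12 (-2)).form ∣[(-1 : ℤ)] γ) τ = _ :=
    KleinFactor.form_slash_left (M := 2) (h := 3) (by norm_num) (by norm_num) rfl (-2)
      ⟨3 * c, by rw [hc]; push_cast; ring⟩ (.inl rfl) ha' τ
  have h4 : ((KleinFactor.mk 0 1 2 6 (-4)).form ∣[(-1 : ℤ)] γ) τ = _ :=
    KleinFactor.form_slash_right (l := 2) (L := 6) (by norm_num) (by norm_num) (-4) (n := 3 * c)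
      (by rw [hc]; push_cast; ring) (.inl rfl) hd' τ
  have key : Complex.exp (Real.pi * Complex.I *
        ((2 * r : ℤ) + (2 : ℕ) * γ 0 1 * ((3 : ℕ) + γ 0 0))) ^ (1 : ℤ) *
      Complex.exp (Real.pi * Complex.I *
        ((2 * s : ℤ) + (2 * c : ℤ) - (2 * c : ℤ) * γ 1 1 / (3 : ℕ))) ^ (3 : ℤ) *
      Complex.exp (Real.pi * Complex.I * (t' + (3 : ℕ) * γ 0 1 * ((2 : ℕ) + γ 0 0))) ^ (-2 : ℤ) *
      Complex.exp (Real.pi * Complex.I * (u' + (3 * c : ℤ) - (3 * c : ℤ) * γ 1 1 / (2 : ℕ))) ^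
        (-4 : ℤ) = 1 := by
    rw [← Complex.exp_int_mul, ← Complex.exp_int_mul, ← Complex.exp_int_mul, ← Complex.exp_int_mul,
      ← Complex.exp_add, ← Complex.exp_add, ← Complex.exp_add,
      ← Complex.exp_pi_I_mul_int_mul_two (r + γ 0 1 * (3 + γ 0 0) + 3 * s + 3 * c - c * γ 1 1 -
        t' - 3 * γ 0 1 * (2 + γ 0 0) - 2 * u' - 6 * c + 3 * c * γ 1 1)]
    congr 1
    push_cast
    ring
  rw [kleinProd.slash_apply (k := 2) (by decide)]
  simp only [kleinProd, List.map_cons, List.map_nil, List.prod_cons, List.prod_nil, h1, h2, h3, h4,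
    mul_zpow, Int.cast_one, one_zpow]
  have hε4 : (ε : ℂ) ^ (1 : ℤ) * (ε : ℂ) ^ (3 : ℤ) = 1 := by rcases hε with rfl | rfl <;> norm_num
  generalize (KleinFactor.mk 1 0 3 18 1).form τ ^ (1 : ℤ) = X
  generalize (KleinFactor.mk 0 1 3 6 3).form τ ^ (3 : ℤ) = Y
  generalize (KleinFactor.mk 1 0 2 12 (-2)).form τ ^ (-2 : ℤ) = Z
  generalize (KleinFactor.mk 0 1 2 6 (-4)).form τ ^ (-4 : ℤ) = W
  linear_combination (ε : ℂ) ^ (1 : ℤ) * (ε : ℂ) ^ (3 : ℤ) * X * Y * Z * W * key +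
    X * Y * Z * W * hε4

end ExplicitForms

/-! ### The forms at levels 9, 27, 32 and 36. -/

section Levels

open WeaklyHolomorphic

namespace kleinFamily

variable {M L : ℕ} {base : List (ℤ × ℤ)}

lemma prod_apply (M L : ℕ) (base : List (ℤ × ℤ)) (i : ℤ) (τ : ℍ) :
    kleinProd (kleinFamily M L base i) τ =
      (base.map fun p ↦ (KleinFactor.mk (p.1 * i) 0 M L 0).form τ ^ p.2).prod := by
  simp [kleinProd, kleinFamily, Function.comp_def, KleinFactor.form]

lemma form_reflect (hM : 0 < M) (hL : 0 < L) (u n : ℤ) (τ : ℍ) :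
    (KleinFactor.mk (M * n - u) 0 M L 0).form τ =
      -((-1) ^ n * (KleinFactor.mk u 0 M L 0).form τ) := by
  rw [show M * n - u = -u + M * n by ring, form_add hM hL, form_neg hL, mul_neg]

end kleinFamily

/-- The conjugates have orders `-n`, `0` and `n`, with leading coefficients `1`, `1` and `-1`, so
the first one dominates. -/
lemma hasIntegralLeading_trace {N : ℕ} [NeZero N] {L : ℕ} (h : ∀ i ∈ [1, 2, 4],
      ∀ x ∈ kleinFamily 9 L [(2, 1), (4, 1), (1, -2)] i, x.IsValid N ∧ x.v = 0 ∧ x.M * 1 ∣ x.L)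
    {n : ℤ} (hn : 0 < n)
    (h1 : kleinOrder (kleinFamily 9 L [(2, 1), (4, 1), (1, -2)] 1) 1 0 = -(2 * (-n : ℤ)))
    (h2 : kleinOrder (kleinFamily 9 L [(2, 1), (4, 1), (1, -2)] 2) 1 0 = -(2 * (0 : ℤ)))
    (h4 : kleinOrder (kleinFamily 9 L [(2, 1), (4, 1), (1, -2)] 4) 1 0 = -(2 * (n : ℤ))) :
    ∃ A, HasIntegralLeading (kleinFamily.trace 9 L [(2, 1), (4, 1), (1, -2)]) (-n) A := by
  obtain ⟨A, hA, -⟩ := kleinFamily.hasIntegralLeading (fun x hx ↦ (h 1 (by simp) x hx).1) 1 one_pos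
    (fun x hx ↦ (h 1 (by simp) x hx).2) (by simp [kleinWeight, kleinFamily]) (-n) h1 1
    (by simp [kleinFamily])
  obtain ⟨B, hB, -⟩ := kleinFamily.hasIntegralLeading (fun x hx ↦ (h 2 (by simp) x hx).1) 1 one_pos
    (fun x hx ↦ (h 2 (by simp) x hx).2) (by simp [kleinWeight, kleinFamily]) 0 h2 1
    (by simp [kleinFamily])
  obtain ⟨C, hC, -⟩ := kleinFamily.hasIntegralLeading (fun x hx ↦ (h 4 (by simp) x hx).1) 1 one_pos
    (fun x hx ↦ (h 4 (by simp) x hx).2) (by simp [kleinWeight, kleinFamily]) n h4 (-1)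
    (by simp [kleinFamily])
  obtain ⟨D, hD⟩ := hA.add hB.hasIntegralOrder (by omega)
  obtain ⟨E, hE⟩ := hD.add (hC.hasIntegralOrder.int_mul (-1)) (by omega)
  refine ⟨E, ?_⟩
  convert hE using 1
  ext τ
  simp [kleinFamily.trace]

/-- The weight -2 form is the square of `k(1 / 3, 0)(9 τ)`, and the function with a simple pole is a
trace of characteristics modulo 9. -/
theorem hasLeadingForms_nine : HasLeadingForms 4 9 := by
  obtain ⟨κ, A, hA⟩ := kleinProd.exists_hasIntegralLeading (N := 9) (n := 1)
    (l := [⟨1, 0, 3, 9, -1⟩, ⟨0, 1, 3, 3, -3⟩]) (by decide) (by decide) (by decide +kernel)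
  obtain ⟨B, hB, -⟩ := kleinProd.hasIntegralLeading (N := 9) (n := -2) (d := 1) (ε := 1)
    (l := kleinFamily 3 9 [(1, 2)] 1) (by decide) one_pos (by decide) (by decide +kernel) (by decide)
  obtain ⟨C, hC⟩ := hasIntegralLeading_trace (N := 9) (L := 9) (n := 1) (by decide) one_pos
    (by decide +kernel) (by decide +kernel) (by decide +kernel)
  refine .of_weight_four (IsSForm.const_mul (kleinProd.isSForm (by decide) (by decide)
    (by decide +kernel) fun γ hγ ↦ slash_cusp_form_nine hγ) κ) hA
    (IsMForm.const_mul (kleinFamily.isMForm (M := 3) (L := 9) (h := 3) (by norm_num) (by norm_num)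
      (by norm_num) (by norm_num) rfl (by decide) (by decide) (by decide) (fun a d had ↦ ?_) (by decide)
      (by decide +kernel)) _) hB
    (kleinFamily.isMForm_trace (M := 9) (L := 9) (h := 1) (.inr rfl) (by norm_num) (by norm_num) rfl
      (by decide) (by decide) (by decide) (by decide) (by decide +kernel)) hC
  refine kleinFamily.prod_congr (by norm_num) (by norm_num) (by decide) (by decide) ?_
  have : ∀ a d : ZMod 3, a * d = 1 → a = 1 ∨ a = -1 := by decide
  simpa using this _ _ had

/-- The function with a double pole is a single product, invariant because its characteristics are
stable under the units modulo 9; the one with a triple pole is a trace. -/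
theorem hasLeadingForms_twenty_seven : HasLeadingForms 2 27 := by
  obtain ⟨κ, A, hA⟩ := kleinProd.exists_hasIntegralLeading (N := 27) (n := 1)
    (l := [⟨1, 0, 3, 9, -1⟩, ⟨0, 1, 3, 3, -1⟩]) (by decide) (by decide) (by decide +kernel)
  obtain ⟨B, hB, -⟩ := kleinProd.hasIntegralLeading (N := 27) (n := -2) (d := 1) (ε := 1)
    (l := kleinFamily 9 27 [(3, 3), (1, -1), (2, -1), (4, -1)] 1) (by decide) one_pos (by decide)
    (by decide +kernel) (by decide)
  obtain ⟨C, hC⟩ := hasIntegralLeading_trace (N := 27) (L := 27) (n := 3) (by decide) (by norm_num)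
    (by decide +kernel) (by decide +kernel) (by decide +kernel)
  refine .of_weight_two (IsSForm.const_mul (kleinProd.isSForm (by decide) (by decide)
    (by decide +kernel) fun γ hγ ↦ slash_cusp_form_twenty_seven hγ) κ) hA
    (IsMForm.const_mul (kleinFamily.isMForm (M := 9) (L := 27) (h := 3) (by norm_num) (by norm_num)
      (by norm_num) (by norm_num) rfl (by decide) (by decide) (by decide) (fun a d had ↦ ?_) (by decide)
      (by decide +kernel)) _) hB
    (kleinFamily.isMForm_trace (M := 9) (L := 27) (h := 3) (.inr rfl) (by norm_num) (by norm_num) rfl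
      (by decide) (by decide) (by decide) (by decide) (by decide +kernel)) hC
  have hr := kleinFamily.form_reflect (M := 9) (L := 27) (by norm_num) (by norm_num)
  -- Modulo 9 and sign, doubling fixes 3 and permutes 1, 2, 4 cyclically. The reflections take care
  -- of the signs.
  have h2 : kleinProd (kleinFamily 9 27 [(3, 3), (1, -1), (2, -1), (4, -1)] 2) =
      kleinProd (kleinFamily 9 27 [(3, 3), (1, -1), (2, -1), (4, -1)] 1) := by
    ext τ
    have h6 := hr 3 1 τ
    have h8 := hr 1 1 τ
    norm_num at h6 h8
    simp only [kleinFamily.prod_apply, List.map_cons, List.map_nil, List.prod_cons, List.prod_nil]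
    norm_num
    rw [h6, h8]
    ring
  have h4 : kleinProd (kleinFamily 9 27 [(3, 3), (1, -1), (2, -1), (4, -1)] 4) =
      kleinProd (kleinFamily 9 27 [(3, 3), (1, -1), (2, -1), (4, -1)] 1) := by
    ext τ
    have h12 := hr (-3) 1 τ
    have h8 := hr 1 1 τ
    have h16 := hr 2 2 τ
    have h3 := kleinFamily.form_neg (M := 9) (L := 27) (by norm_num) 3 0 τ
    norm_num at h12 h8 h16
    simp only [kleinFamily.prod_apply, List.map_cons, List.map_nil, List.prod_cons, List.prod_nil]
    norm_num
    rw [h12, h8, h16, h3]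
    ring
  have : ∀ a d : ZMod 9, a * d = 1 →
    (a = 1 ∨ a = -1) ∨ (a = 2 ∨ a = -2) ∨ (a = 4 ∨ a = -4) := by decide
  have hcongr {i j : ℤ} := kleinFamily.prod_congr (M := 9) (L := 27)
    (base := [(3, 3), (1, -1), (2, -1), (4, -1)]) (by norm_num) (by norm_num) (by decide) (by decide)
    (i := i) (j := j)
  rcases this _ _ had with h | h | h
  · exact hcongr (by simpa using h)
  · rw [← h2]
    exact hcongr (by simpa using h)
  · rw [← h4]
    exact hcongr (by simpa using h)

/-- The functions with poles of orders 2 and 3 use characteristics modulo 4 and modulo 8. -/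
theorem hasLeadingForms_thirty_two : HasLeadingForms 2 32 := by
  obtain ⟨κ, A, hA⟩ := kleinProd.exists_hasIntegralLeading (N := 32) (n := 1)
    (l := [⟨1, 0, 2, 8, -1⟩, ⟨0, 1, 2, 4, -1⟩]) (by decide) (by decide) (by decide +kernel)
  obtain ⟨B, hB, -⟩ := kleinProd.hasIntegralLeading (N := 32) (n := -2) (d := 1) (ε := 1)
    (l := kleinFamily 4 32 [(2, 2), (1, -2)] 1) (by decide) one_pos (by decide)
    (by decide +kernel) (by decide)
  obtain ⟨C, hC, -⟩ := kleinProd.hasIntegralLeading (N := 32) (n := -3) (d := 1) (ε := 1)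
    (l := kleinFamily 8 32 [(2, 2), (4, 2), (1, -2), (3, -2)] 1) (by decide) one_pos (by decide)
    (by decide +kernel) (by decide)
  refine .of_weight_two (IsSForm.const_mul (kleinProd.isSForm (by decide) (by decide)
    (by decide +kernel) fun γ hγ ↦ slash_cusp_form_thirty_two hγ) κ) hA
    (IsMForm.const_mul (kleinFamily.isMForm (M := 4) (L := 32) (h := 8) (by norm_num) (by norm_num)
      (by norm_num) (by norm_num) rfl (by decide) (by decide) (by decide) (fun a d had ↦ ?_) (by decide)
      (by decide +kernel)) _) hB
    (IsMForm.const_mul (kleinFamily.isMForm (M := 8) (L := 32) (h := 4) (by norm_num) (by norm_num)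
      (by norm_num) (by norm_num) rfl (by decide) (by decide) (by decide) (fun a d had ↦ ?_) (by decide)
      (by decide +kernel)) _) hC
  · refine kleinFamily.prod_congr (by norm_num) (by norm_num) (by decide) (by decide) ?_
    have : ∀ a d : ZMod 4, a * d = 1 → a = 1 ∨ a = -1 := by decide
    simpa using this _ _ had
  · have hr := kleinFamily.form_reflect (M := 8) (L := 32) (by norm_num) (by norm_num)
    -- Modulo 8 and sign, tripling fixes 2 and 4 and exchanges 1 and 3, which carry equal exponents.
    have h3 : kleinProd (kleinFamily 8 32 [(2, 2), (4, 2), (1, -2), (3, -2)] 3) =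
        kleinProd (kleinFamily 8 32 [(2, 2), (4, 2), (1, -2), (3, -2)] 1) := by
      ext τ
      have h6 := hr 2 1 τ
      have h12 := hr 4 2 τ
      have h9 := hr (-1) 1 τ
      have h1 := kleinFamily.form_neg (M := 8) (L := 32) (by norm_num) 1 0 τ
      norm_num at h6 h12 h9
      simp only [kleinFamily.prod_apply, List.map_cons, List.map_nil, List.prod_cons, List.prod_nil]
      norm_num
      rw [h6, h12, h9, h1]
      ring
    have : ∀ a d : ZMod 8, a * d = 1 → (a = 1 ∨ a = -1) ∨ (a = 3 ∨ a = -3) := by decide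
    have hcongr {i j : ℤ} := kleinFamily.prod_congr (M := 8) (L := 32)
      (base := [(2, 2), (4, 2), (1, -2), (3, -2)]) (by norm_num) (by norm_num) (by decide) (by decide)
      (i := i) (j := j)
    rcases this _ _ had with h | h
    · exact hcongr (by simpa using h)
    · rw [← h3]
      exact hcongr (by simpa using h)

/-- The only units modulo 6 are `±1`, so no conjugates arise. -/
theorem hasLeadingForms_thirty_six : HasLeadingForms 2 36 := by
  obtain ⟨κ, A, hA⟩ := kleinProd.exists_hasIntegralLeading (N := 36) (n := 1)
    (l := [⟨1, 0, 3, 18, 1⟩, ⟨0, 1, 3, 6, 3⟩, ⟨1, 0, 2, 12, -2⟩, ⟨0, 1, 2, 6, -4⟩]) (by decide)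
    (by decide) (by decide +kernel)
  obtain ⟨B, hB, -⟩ := kleinProd.hasIntegralLeading (N := 36) (n := -2) (d := 1) (ε := 1)
    (l := kleinFamily 6 36 [(3, 1), (1, -1)] 1) (by decide) one_pos (by decide)
    (by decide +kernel) (by decide)
  obtain ⟨C, hC, -⟩ := kleinProd.hasIntegralLeading (N := 36) (n := -3) (d := 1) (ε := 1)
    (l := kleinFamily 6 36 [(2, 2), (1, -2)] 1) (by decide) one_pos (by decide)
    (by decide +kernel) (by decide)
  have h6 : ∀ a d : ZMod 6, a * d = 1 → a = 1 ∨ a = -1 := by decide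
  refine .of_weight_two (IsSForm.const_mul (kleinProd.isSForm (by decide) (by decide)
    (by decide +kernel) fun γ hγ ↦ slash_cusp_form_thirty_six hγ) κ) hA
    (IsMForm.const_mul (kleinFamily.isMForm (M := 6) (L := 36) (h := 6) (by norm_num) (by norm_num)
      (by norm_num) (by norm_num) rfl (by decide) (by decide) (by decide) (fun a d had ↦ ?_) (by decide)
      (by decide +kernel)) _) hB
    (IsMForm.const_mul (kleinFamily.isMForm (M := 6) (L := 36) (h := 6) (by norm_num) (by norm_num)
      (by norm_num) (by norm_num) rfl (by decide) (by decide) (by decide) (fun a d had ↦ ?_) (by decide)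
      (by decide +kernel)) _) hC
  all_goals
    refine kleinFamily.prod_congr (by norm_num) (by norm_num) (by decide) (by decide) ?_
    simpa using h6 _ _ had

end Levels

/-! ### Level 49: a cusp form from derivatives of conjugate functions. -/

section LevelFortyNine

open WeaklyHolomorphic Derivative

lemma normalizedDeriv_slash_zero {f : ℍ → ℂ} (hf : MDifferentiable 𝓘(ℂ) 𝓘(ℂ) f) (γ : SL(2, ℤ)) :
    normalizedDerivOfComplex f ∣[(2 : ℤ)] γ = normalizedDerivOfComplex (f ∣[(0 : ℤ)] γ) := by
  rw [normalizedDerivOfComplex_SL_slash (k := 0) hf (γ := γ)]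
  ext τ
  simp

/-- The derivative of a function which is bounded at `i∞` vanishes at `i∞`. -/
lemma UpperHalfPlane.IsBoundedAtImInfty.normalizedDeriv {f : ℍ → ℂ}
    (hf : MDifferentiable 𝓘(ℂ) 𝓘(ℂ) f) (hb : IsBoundedAtImInfty f) :
    IsZeroAtImInfty (normalizedDerivOfComplex f) := by
  rw [UpperHalfPlane.mdifferentiable_iff] at hf
  obtain ⟨C, B, hC⟩ := isBoundedAtImInfty_iff.1 hb
  refine isZeroAtImInfty_iff.2 fun ε hε ↦ ⟨max (2 * B) (2 * |C| / ε), fun τ hτ ↦ ?_⟩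
  have hτ0 := τ.im_pos
  have h1 : 2 * B ≤ τ.im := (le_max_left _ _).trans hτ
  have h2 : 2 * |C| / ε ≤ τ.im := (le_max_right _ _).trans hτ
  have him {w : ℂ} (hw : w ∈ Metric.closedBall (τ : ℂ) (τ.im / 2)) : τ.im / 2 ≤ w.im := by
    rw [Metric.mem_closedBall, dist_eq_norm] at hw
    have h3 := (Complex.abs_im_le_norm (w - τ)).trans hw
    rw [Complex.sub_im, coe_im, abs_le] at h3
    linarith [h3.1]
  -- Cauchy's estimate on the disc of radius `Im τ / 2`, where the imaginary part stays at least `Im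
  -- τ / 2 ≥ B`.
  have h3 : ‖deriv (f ∘ ofComplex) τ‖ ≤ C / (τ.im / 2) := by
    refine Complex.norm_deriv_le_of_forall_mem_sphere_norm_le (by positivity)
      (hf.diffContOnCl_ball fun w hw ↦ ?_) fun w hw ↦ ?_
    · have := him hw
      change 0 < w.im
      linarith
    · have h4 := him (Metric.sphere_subset_closedBall hw)
      have h5 : 0 < w.im := by linarith
      rw [Function.comp_apply, ofComplex_apply_of_im_pos h5]
      exact hC _ (by change B ≤ w.im; linarith)
  have h4 : ‖(2 * Real.pi * Complex.I : ℂ)⁻¹‖ ≤ 1 := by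
    rw [norm_inv]
    refine inv_le_one_of_one_le₀ ?_
    have := Real.pi_gt_three
    simp [abs_of_pos Real.pi_pos]
    linarith
  have h5 : C / (τ.im / 2) ≤ ε := by
    rw [div_le_iff₀ hε] at h2
    rw [div_le_iff₀ (by positivity)]
    have := le_abs_self C
    nlinarith
  rw [normalizedDerivOfComplex, norm_mul]
  exact (mul_le_of_le_one_left (norm_nonneg _) h4).trans (h3.trans h5)

/-- The combination `2 f g' - g f'` for functions `f, g` of weight `0`. -/
noncomputable def twistedBracket (f g : ℍ → ℂ) : ℍ → ℂ :=
  (2 : ℂ) • (f * normalizedDerivOfComplex g) - g * normalizedDerivOfComplex f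

namespace twistedBracket

variable {f g : ℍ → ℂ}

lemma mdifferentiable (hf : MDifferentiable 𝓘(ℂ) 𝓘(ℂ) f) (hg : MDifferentiable 𝓘(ℂ) 𝓘(ℂ) g) :
    MDifferentiable 𝓘(ℂ) 𝓘(ℂ) (twistedBracket f g) :=
  ((hf.mul (normalizedDerivOfComplex_mdifferentiable hg)).const_smul 2).sub
    (hg.mul (normalizedDerivOfComplex_mdifferentiable hf))

lemma slash (hf : MDifferentiable 𝓘(ℂ) 𝓘(ℂ) f) (hg : MDifferentiable 𝓘(ℂ) 𝓘(ℂ) g) (γ : SL(2, ℤ)) :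
    twistedBracket f g ∣[(2 : ℤ)] γ = twistedBracket (f ∣[(0 : ℤ)] γ) (g ∣[(0 : ℤ)] γ) := by
  have h (u v : ℍ → ℂ) : (u * v) ∣[(2 : ℤ)] γ = u ∣[(0 : ℤ)] γ * v ∣[(2 : ℤ)] γ := by
    have := mul_slash_SL2 0 2 γ u v
    rwa [zero_add] at this
  rw [twistedBracket, sub_eq_add_neg, SlashAction.add_slash, SlashAction.neg_slash, SL_smul_slash, h,
    h, normalizedDeriv_slash_zero hf, normalizedDeriv_slash_zero hg, ← sub_eq_add_neg, twistedBracket]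

lemma isZeroAtImInfty (hf : MDifferentiable 𝓘(ℂ) 𝓘(ℂ) f) (hg : MDifferentiable 𝓘(ℂ) 𝓘(ℂ) g)
    (hfb : IsBoundedAtImInfty f) (hgb : IsBoundedAtImInfty g) :
    IsZeroAtImInfty (twistedBracket f g) := by
  have h1 := (hgb.normalizedDeriv hg).mul_isBounded hfb
  have h2 := (hfb.normalizedDeriv hf).mul_isBounded hgb
  rw [mul_comm] at h1 h2
  rw [twistedBracket, sub_eq_add_neg]
  exact Filter.ZeroAtFilter.add (Filter.ZeroAtFilter.smul _ h1) (Filter.ZeroAtFilter.neg h2)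

end twistedBracket

/-- If the Fourier expansion of `f` is supported on the integers congruent to `m` modulo `d`, then
`f' ≡ m f` modulo `d`. -/
lemma WeaklyHolomorphic.HasQExpansion.hasIntegralOrder_deriv {f : ℍ → ℂ} {A : ℤ → ℤ} {m : ℤ} {d : ℕ}
    (hA : HasQExpansion f fun n ↦ (A n : ℂ)) (h0 : ∀ n < m, A n = 0)
    (hd : ∀ n, A n ≠ 0 → (d : ℤ) ∣ n - m) :
    HasIntegralOrder (fun τ ↦ (d : ℂ)⁻¹ * (normalizedDerivOfComplex f τ - m * f τ)) (m + d) := by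
  refine ⟨fun n ↦ (n - m) / d * A n,
    ((hA.normalizedDeriv.sub (hA.const_mul m)).const_mul (d : ℂ)⁻¹).congr fun n ↦ ?_, fun n hn ↦ ?_⟩
  · rcases eq_or_ne (A n) 0 with h | h
    · simp [h]
    · obtain ⟨j, hj⟩ := hd n h
      rcases Nat.eq_zero_or_pos d with rfl | hpos
      · simp
      · have hdz : (d : ℤ) ≠ 0 := by omega
        have hdc : (d : ℂ) ≠ 0 := by exact_mod_cast hdz
        dsimp only
        rw [hj, Int.mul_ediv_cancel_left _ hdz]
        have hj' := congrArg (Int.cast : ℤ → ℂ) hj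
        push_cast at hj' ⊢
        field_simp
        linear_combination hj'
  · rcases eq_or_ne (A n) 0 with h | h
    · simp [h]
    · obtain ⟨j, hj⟩ := hd n h
      have h1 : m ≤ n := by
        by_contra! hlt
        exact h (h0 n hlt)
      have h2 : (d : ℤ) * j < d := by omega
      have h3 : 0 ≤ (d : ℤ) * j := by omega
      have h4 : n - m = 0 := by
        rw [hj]
        rcases lt_trichotomy j 0 with hj0 | rfl | hj0
        · nlinarith
        · simp
        · nlinarith
      simp [h4]

/-- The conjugates `P 1`, `P 2`, `P 4` have orders -2, -1, 3 and are permuted cyclically by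
`Γ₀(49)`. Their first and second elementary symmetric functions have poles of orders 2 and 3, and
the cyclic sum of twisted brackets gives the cusp form. -/
theorem hasLeadingForms_forty_nine : HasLeadingForms 2 49 := by
  set P : ℤ → ℍ → ℂ := fun i ↦ kleinProd (kleinFamily 7 49 [(5, 1), (1, -1)] i) with hP
  have hval : ∀ i ∈ [1, 2, 4], ∀ x ∈ kleinFamily 7 49 [(5, 1), (1, -1)] i, x.IsValid 49 := by decide
  have hord : ∀ i ∈ [1, 2, 4], ∀ a < 49, ∀ c < 49, c ≠ 0 → (a.gcd c).gcd 49 = 1 →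
      kleinOrder (kleinFamily 7 49 [(5, 1), (1, -1)] i) (a : ℕ) (c : ℕ) ≤ 0 := by decide +kernel
  have hw : ∀ i ∈ [1, 2, 4], kleinWeight (kleinFamily 7 49 [(5, 1), (1, -1)] i) = 0 := by decide
  have hdiff (i : ℤ) (hi : i ∈ ([1, 2, 4] : List ℤ)) : MDifferentiable 𝓘(ℂ) 𝓘(ℂ) (P i) :=
    kleinProd.mdifferentiable (hval i hi)
  have hbdd {γ : SL(2, ℤ)} (hγ : ¬ ((49 : ℕ) : ℤ) ∣ γ 1 0) (i : ℤ) (hi : i ∈ ([1, 2, 4] : List ℤ)) :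
      IsBoundedAtImInfty (P i ∣[(0 : ℤ)] γ) :=
    kleinProd.isBounded_slash (hval i hi) (hw i hi) (hord i hi) hγ
  have hcyc {γ : SL(2, ℤ)} (hγ : ((49 : ℕ) : ℤ) ∣ γ 1 0) := kleinFamily.slash_cyclic (M := 7) (L := 49)
    (base := [(5, 1), (1, -1)]) (.inl rfl) (h := 7) (by norm_num) rfl (by decide) (by decide)
    (by decide) hP hγ
  obtain ⟨A, hA, hA7⟩ := kleinFamily.hasIntegralLeading (hval 1 (by simp)) 7 (by norm_num) (by decide)
    (hw 1 (by simp)) (-2) (by decide +kernel) 1 (by decide)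
  obtain ⟨B, hB, hB7⟩ := kleinFamily.hasIntegralLeading (hval 2 (by simp)) 7 (by norm_num) (by decide)
    (hw 2 (by simp)) (-1) (by decide +kernel) (-1) (by decide)
  obtain ⟨C, hC, hC7⟩ := kleinFamily.hasIntegralLeading (hval 4 (by simp)) 7 (by norm_num) (by decide)
    (hw 4 (by simp)) 3 (by decide +kernel) 1 (by decide)
  have h1 := hdiff 1 (by simp)
  have h2 := hdiff 2 (by simp)
  have h4 := hdiff 4 (by simp)
  change HasIntegralLeading (fun τ ↦ ((1 : ℤ) : ℂ) * P 1 τ) (-2) A at hA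
  change HasIntegralLeading (fun τ ↦ ((-1 : ℤ) : ℂ) * P 2 τ) (-1) B at hB
  change HasIntegralLeading (fun τ ↦ ((1 : ℤ) : ℂ) * P 4 τ) 3 C at hC
  simp only [Int.cast_one, one_mul] at hA hC
  have hB' : HasQExpansion (P 2) fun n ↦ ((-B n : ℤ) : ℂ) := by
    convert hB.hasQExpansion.const_mul (-1) using 1
    · ext τ
      simp
    · ext n
      simp
  have hb : HasIntegralOrder (P 2) (-1) := ⟨_, hB', fun n hn ↦ by rw [hB.eq_zero n hn, neg_zero]⟩
  have ha := hA.hasIntegralOrder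
  have hc := hC.hasIntegralOrder
  -- Each conjugate is supported on exponents in one class modulo 7, so its derivative is its order
  -- times itself up to 7 times an integral series of order 7 higher.
  have hda := hA.hasQExpansion.hasIntegralOrder_deriv hA.eq_zero hA7
  have hdb := hB'.hasIntegralOrder_deriv (fun n hn ↦ by rw [hB.eq_zero n hn, neg_zero])
    fun n hn ↦ hB7 n (by simpa using hn)
  have hdc := hC.hasQExpansion.hasIntegralOrder_deriv hC.eq_zero hC7
  have hx : IsMForm 0 49 fun τ ↦ P 1 τ + P 2 τ + P 4 τ :=
    kleinFamily.isMForm_trace (M := 7) (L := 49) (h := 7) (.inl rfl) (by norm_num) (by norm_num) rfl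
      (by decide) (by decide) (by decide) hval hord
  clear_value P
  obtain ⟨S, hS⟩ := hA.add hb (by norm_num)
  obtain ⟨X, hX⟩ := hS.add hc (by norm_num)
  set G := twistedBracket (P 1) (P 2) + twistedBracket (P 2) (P 4) + twistedBracket (P 4) (P 1) with hG
  obtain ⟨R, hR⟩ := hC.mul hA
  -- For orders `m` and `m'` the bracket is `(2 m' - m) f g` modulo 7. The cyclic pairs give the
  -- factors 0, 7 and -7: the polar product `P 1 P 2` drops out, and after division by `-7` the
  -- leading term is `P 4 P 1 = q + ...`. All remaining terms are integral of order at least 2.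
  obtain ⟨E, hE⟩ := hR.add (n := 2) (((((((hb.mul hc).int_mul (-1)).mono (n := 2) (by norm_num)).add
    (((ha.mul hdb).int_mul (-2)).mono (by norm_num))).add ((hb.mul hda).mono (by norm_num))).add
    (((hb.mul hdc).int_mul (-2)).mono (by norm_num))).add
    ((hc.mul hdb).mono (by norm_num)) |>.add
    (((hc.mul hda).int_mul (-2)).mono (by norm_num)) |>.add
    ((ha.mul hdc).mono (by norm_num))) (by norm_num)
  have hg : HasIntegralLeading (fun τ ↦ -(7 : ℂ)⁻¹ * G τ) 1 E := by
    convert hE using 1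
    ext τ
    simp only [hG, twistedBracket, Pi.add_apply, Pi.sub_apply, Pi.mul_apply, Pi.smul_apply, smul_eq_mul]
    push_cast
    ring
    norm_num
  have hGS : IsSForm 2 49 fun τ ↦ -(7 : ℂ)⁻¹ * G τ := by
    have hGq := hg.hasQExpansion.const_mul (-7)
    refine IsSForm.const_mul ⟨?_, fun γ hγ ↦ ?_, ?_, fun γ hγ ↦ ?_⟩ _
    · exact ((twistedBracket.mdifferentiable h1 h2).add (twistedBracket.mdifferentiable h2 h4)).add
        (twistedBracket.mdifferentiable h4 h1)
    · rw [hG, SlashAction.add_slash, SlashAction.add_slash, twistedBracket.slash h1 h2,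
        twistedBracket.slash h2 h4, twistedBracket.slash h4 h1]
      rcases hcyc hγ with ⟨e1, e2, e3⟩ | ⟨e1, e2, e3⟩ | ⟨e1, e2, e3⟩ <;> rw [e1, e2, e3] <;> abel
    · convert hGq.growth using 3
      ext τ
      ring
    · rw [hG, SlashAction.add_slash, SlashAction.add_slash, twistedBracket.slash h1 h2,
        twistedBracket.slash h2 h4, twistedBracket.slash h4 h1]
      have d1 := h1.slash 0 γ
      have d2 := h2.slash 0 γ
      have d4 := h4.slash 0 γ
      have b1 := hbdd hγ 1 (by simp)
      have b2 := hbdd hγ 2 (by simp)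
      have b4 := hbdd hγ 4 (by simp)
      exact ((twistedBracket.isZeroAtImInfty d1 d2 b1 b2).add
        (twistedBracket.isZeroAtImInfty d2 d4 b2 b4)).add (twistedBracket.isZeroAtImInfty d4 d1 b4 b1)
  -- The sign in `y` compensates the leading coefficient `-1` of `P 2`; the other two products have
  -- positive order.
  obtain ⟨T, hT⟩ := hA.mul hB
  obtain ⟨U, hU⟩ := hT.add ((((hb.mul hc).int_mul (-1)).mono (by norm_num)).add
    ((hc.mul ha).int_mul (-1))) (by norm_num)
  have e : (fun τ ↦ -1 * (P 1 * P 2 + P 2 * P 4 + P 4 * P 1) τ) =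
      fun τ ↦ P 1 τ * (((-1 : ℤ) : ℂ) * P 2 τ) + (((-1 : ℤ) : ℂ) * (P 2 τ * P 4 τ) +
        ((-1 : ℤ) : ℂ) * (P 4 τ * P 1 τ)) := by
    ext τ
    simp only [Pi.add_apply, Pi.mul_apply]
    push_cast
    ring
  rw [← e] at hU
  have hmul (u v : ℍ → ℂ) (γ : SL(2, ℤ)) :
      (u * v) ∣[(0 : ℤ)] γ = u ∣[(0 : ℤ)] γ * v ∣[(0 : ℤ)] γ := mul_slash_SL2 0 0 γ u v
  have hy : IsMForm 0 49 fun τ ↦ -1 * (P 1 * P 2 + P 2 * P 4 + P 4 * P 1) τ := by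
    refine IsMForm.const_mul ⟨((h1.mul h2).add (h2.mul h4)).add (h4.mul h1), fun γ hγ ↦ ?_, ?_,
      fun γ hγ ↦ ?_⟩ _
    · rw [SlashAction.add_slash, SlashAction.add_slash, hmul, hmul, hmul]
      rcases hcyc hγ with ⟨e1, e2, e3⟩ | ⟨e1, e2, e3⟩ | ⟨e1, e2, e3⟩ <;> rw [e1, e2, e3] <;> abel
    · convert (hU.hasQExpansion.const_mul (-1)).growth using 3
      ext τ
      ring
    · have b1 := hbdd hγ 1 (by simp)
      have b2 := hbdd hγ 2 (by simp)
      have b4 := hbdd hγ 4 (by simp)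
      rw [SlashAction.add_slash, SlashAction.add_slash, hmul, hmul, hmul]
      exact ((b1.mul b2).add (b2.mul b4)).add (b4.mul b1)
  exact .of_weight_two hGS hg hx hX hy hU

end LevelFortyNine

/-! ### Assembly of the five cases. -/

theorem proposition4p2 (k : ℤ) (N : ℕ)
    (hkN : (k, N) ∈ ({(2, 27), (2, 32), (2, 36), (2, 49), (4, 9)} : Set (ℤ × ℕ))) :
    -- the normalized cusp form `g` spanning the one-dimensional space `S_k(Γ₀(N))`
    ∃ g : CuspForm ((Gamma0 N).map (mapGL ℝ)) k,
      (∃ a : ℤ → ℂ, WeaklyHolomorphic.HasQExpansion g a ∧ a 1 = 1) ∧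
      (∀ h : CuspForm ((Gamma0 N).map (mapGL ℝ)) k, ∃ c : ℂ, h = c • g) ∧
      -- (a)
      (∀ n : ℕ, 2 ≤ n → ∃ (φ : ℍ → ℂ) (A : ℤ → ℤ), WeaklyHolomorphic.IsPhin k N n φ A) ∧
      -- (b)
      (∀ m : ℤ, (m = -1 ∨ 1 ≤ m ∨ (k = 4 ∧ m = 0)) →
        ∃! F : ℍ → ℂ, ∃ C : ℤ → ℤ, WeaklyHolomorphic.IsFm k N m F C) ∧
      -- (c)
      (∀ p : ℕ, p.Prime → ¬ p ∣ N → ∀ n : ℕ, ∀ (F F' : ℍ → ℂ) (C C' : ℤ → ℤ),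
        WeaklyHolomorphic.IsFm k N 1 F C → WeaklyHolomorphic.IsFm k N ((p : ℤ) ^ n) F' C' →
        WeaklyHolomorphic.HasQExpansion
          (fun τ ↦ (p : ℂ) ^ ((k - 1) * n) * F' τ + (C ((p : ℤ) ^ n) : ℂ) * g τ)
          (WeaklyHolomorphic.heckeT k (p ^ n) (fun j ↦ (C j : ℂ)))) := by
  have h : HasLeadingForms k N := by
    simp only [Set.mem_insert_iff, Prod.mk.injEq, Set.mem_singleton_iff] at hkN
    rcases hkN with ⟨rfl, rfl⟩ | ⟨rfl, rfl⟩ | ⟨rfl, rfl⟩ | ⟨rfl, rfl⟩ | ⟨rfl, rfl⟩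
    exacts [hasLeadingForms_twenty_seven, hasLeadingForms_thirty_two, hasLeadingForms_thirty_six,
      hasLeadingForms_forty_nine, hasLeadingForms_nine]
  obtain ⟨g, hg, B, hB⟩ := h.cusp
  have : NeZero N := ⟨by rintro rfl; simp at hkN⟩
  exact exists_dual_families h.weight hg hB h.dual h.weak
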